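/- A (nondeterministic) branching program $P$ of length $T\ge 1$ and width $W\ge 1$ on Boolean inputs $x_1,\dots,x_n$ is a layered directed graph with layers $L_1,\dots,L_T$ of $W$ nodes each. All nodes of $L_i$ ($i<T$) are associated with one variable $x_{f(i)}$, and edges go from $L_i$ to $L_{i+1}$, each marked with $0$ or $1$. $P$ accepts $x$ iff there is a path from the first node of $L_1$ to the first node of $L_T$ along which each edge is marked with the value of the variable of its tail. Let $n=a+b$. Alice holds $x_1,\dots,x_a$ and Bob holds $x_{a+1},\dots,x_n$ (for example $a=b=n/2$). In an $\mathsf{IP}$-protocol an all-powerful, untrusted Merlin who knows the whole input interacts with Alice in rounds; in each round Merlin sends a message to Alice and then Alice tosses public coins. Afterwards Bob, who sees his input and the public coins, sends one message to Alice, and Alice accepts or rejects. Write $\lg x=\max(1,\log_2 x)$ and $\ell=\lg\lg W+\lg\lg T+\lg\varepsilon^{-1}$. **Theorem.** There is an absolute constant $C$ such that for every such $P$, all $a,b\ge 0$, and every $\varepsilon>0$ there is an $\mathsf{IP}$-protocol for checking whether $P$ accepts $x_1,\dots,x_n$ in which 1. Merlin and Alice exchange at most $C\,\lg^2 W\,\lg^2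 T\cdot\ell$ bits (the public coins, which Alice reveals to Merlin, included); 2. Alice tosses at most $C\,\lg^2 W\,\lg^2 T\cdot\ell$ public coins; 3. Bob sends at most $C\,\ell$ bits to Alice; 4. Alice accepts or rejects in the end. If $P$ accepts $x$, then for some strategy of Merlin (depending on $x$) Alice accepts with certainty. If $P$ does not accept $x$, then for every strategy of Merlin Alice rejects with probability at least $1-\varepsilon$ over the public coins. The protocol is computationally efficient, uniformly: there are three fixed programs, not depending on $P$, $a$, $b$, $\varepsilon$, for a random access machine with logarithmic cost. Given $a,b,W,T$, the integer $\max(0,\lceil\log_2\varepsilon^{-1}\rceil)$ and the description of $P$, they compute the number of rounds and the message lengths; Bob's message from his input and the coins; and Alice's decision from her input, Merlin's messages, the coins and Bob's message. Each runs in time at most $(a+b+W+T+\lg\varepsilon^{-1})^{C}$. -/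

import Mathlib

/-! ### Branching programs -/

/-- A nondeterministic branching program of width `W` and length `T` on `n` Boolean inputs. The
layers are `0, …, T - 1`; all nodes of a layer `i < T - 1` query the same variable `var i`, and
`edge i u v c = true` says that there is an edge marked `c` from node `u` of layer `i` to node `v`
of layer `i + 1`. -/
structure BranchingProgram (n W T : ℕ) where
  var : Fin (T - 1) → Fin n
  edge : Fin (T - 1) → Fin W → Fin W → Bool → Bool

/-- `P` accepts `x` iff some path from the first node of the first layer to the first node of the
last layer uses only edges marked with the value of the variable queried at their tail. -/
def BranchingProgram.Accepts {n W T : ℕ} [NeZero W] [NeZero T] (P : BranchingProgram n W T)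
    (x : Fin n → Bool) : Prop :=
  ∃ path : Fin T → Fin W,
    path 0 = 0 ∧
    path ⟨T - 1, Nat.sub_lt (NeZero.pos T) Nat.one_pos⟩ = 0 ∧
    ∀ i : Fin (T - 1),
      P.edge i (path ⟨i, by omega⟩) (path ⟨i + 1, by omega⟩) (x (P.var i)) = true

/-! ### Interactive communication protocols

Alice holds `a` bits, Bob holds `b` bits, and the prover Merlin knows everything. -/

/-- A public-coin `IP` communication protocol. In each of `rounds` rounds Merlin sends `msgLen`
bits to Alice, and then Alice tosses `coinLen` public coins. After the last round Bob, who
sees his input and the public coins, sends `bobLen` bits to Alice. Alice then accepts (`true`) or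
rejects (`false`), knowing her input, Merlin's messages, the coins, and Bob's message. -/
structure IPProtocol (a b : ℕ) where
  rounds : ℕ
  msgLen : ℕ
  coinLen : ℕ
  bobLen : ℕ
  bob : (Fin b → Bool) → (Fin rounds → Fin coinLen → Bool) → (Fin bobLen → Bool)
  alice : (Fin a → Bool) → (Fin rounds → Fin msgLen → Bool) →
    (Fin rounds → Fin coinLen → Bool) → (Fin bobLen → Bool) → Bool

namespace IPProtocol

variable {a b : ℕ}

/-- The outcomes of all public coins. -/
abbrev Coins (Q : IPProtocol a b) : Type := Fin Q.rounds → Fin Q.coinLen → Bool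

/-- A (cheating or honest) Merlin: his message in round `i` may depend only on the public coins
tossed in the earlier rounds. (Merlin knows both inputs; strategies are always quantified after
the inputs.) -/
structure Merlin (Q : IPProtocol a b) where
  msg : Q.Coins → Fin Q.rounds → Fin Q.msgLen → Bool
  causal : ∀ (i : Fin Q.rounds) (c d : Q.Coins), (∀ j, j < i → c j = d j) → msg c i = msg d i

/-- Alice's decision at the end of the interaction. -/
def verdict (Q : IPProtocol a b) (xA : Fin a → Bool) (xB : Fin b → Bool) (M : Q.Merlin)
    (c : Q.Coins) : Bool :=
  Q.alice xA (M.msg c) c (Q.bob xB c)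

/-- The probability, over uniform public coins, that Alice rejects. -/
noncomputable def rejectProb (Q : IPProtocol a b) (xA : Fin a → Bool) (xB : Fin b → Bool)
    (M : Q.Merlin) : ℝ :=
  ((Finset.univ.filter fun c : Q.Coins => Q.verdict xA xB M c = false).card : ℝ) /
    (Fintype.card Q.Coins : ℝ)

/-- Number of public coins tossed. -/
def coinBits (Q : IPProtocol a b) : ℕ := Q.rounds * Q.coinLen

/-- Number of bits exchanged by Merlin and Alice: Merlin's messages, and the coins which Alice
reveals to Merlin. -/
def exchangedBits (Q : IPProtocol a b) : ℕ := Q.rounds * Q.msgLen + Q.rounds * Q.coinLen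

end IPProtocol

/-! ### Random access machines with logarithmic cost -/

namespace RAM

/-- Finitely many named registers are used by each program; `mem` is the addressable memory. -/
structure Store where
  reg : ℕ → ℕ
  mem : ℕ → ℕ

/-- Arithmetic expressions (`sub` is truncated and `div` rounds down). -/
inductive Expr where
  | lit (k : ℕ)
  | reg (r : ℕ)
  | load (addr : Expr)
  | add (e f : Expr)
  | sub (e f : Expr)
  | mul (e f : Expr)
  | div (e f : Expr)
  | mod (e f : Expr)

def Expr.eval (s : Store) : Expr → ℕ
  | lit k => k
  | reg r => s.reg r
  | load e => s.mem (e.eval s)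
  | add e f => e.eval s + f.eval s
  | sub e f => e.eval s - f.eval s
  | mul e f => e.eval s * f.eval s
  | div e f => e.eval s / f.eval s
  | mod e f => e.eval s % f.eval s

/-- Logarithmic cost: every value (and every address) that occurs is charged its binary length,
plus one per operation. -/
def Expr.cost (s : Store) : Expr → ℕ
  | lit k => k.size + 1
  | reg r => r.size + (s.reg r).size + 1
  | load e => e.cost s + (s.mem (e.eval s)).size + 1
  | add e f => e.cost s + f.cost s + (e.eval s + f.eval s).size + 1
  | sub e f => e.cost s + f.cost s + (e.eval s - f.eval s).size + 1
  | mul e f => e.cost s + f.cost s + (e.eval s * f.eval s).size + 1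
  | div e f => e.cost s + f.cost s + (e.eval s / f.eval s).size + 1
  | mod e f => e.cost s + f.cost s + (e.eval s % f.eval s).size + 1

/-- Structured programs; a test succeeds iff the expression is nonzero. -/
inductive Cmd where
  | skip
  | assign (r : ℕ) (e : Expr)
  | store (addr e : Expr)
  | seq (p q : Cmd)
  | ite (e : Expr) (p q : Cmd)
  | loop (e : Expr) (p : Cmd)

/-- `Exec p s s₁ t`: started in `s`, the program `p` halts in `s₁`, at total cost `t`. -/
inductive Exec : Cmd → Store → Store → ℕ → Prop where
  | skip (s : Store) : Exec .skip s s 1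
  | assign (r : ℕ) (e : Expr) (s : Store) :
      Exec (.assign r e) s { s with reg := Function.update s.reg r (e.eval s) }
        (e.cost s + r.size + 1)
  | store (addr e : Expr) (s : Store) :
      Exec (.store addr e) s { s with mem := Function.update s.mem (addr.eval s) (e.eval s) }
        (addr.cost s + e.cost s + 1)
  | seq {p q : Cmd} {s s₁ s₂ : Store} {t₁ t₂ : ℕ} :
      Exec p s s₁ t₁ → Exec q s₁ s₂ t₂ → Exec (.seq p q) s s₂ (t₁ + t₂)
  | ite_true {e : Expr} {p q : Cmd} {s s₁ : Store} {t : ℕ} :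
      e.eval s ≠ 0 → Exec p s s₁ t → Exec (.ite e p q) s s₁ (e.cost s + t + 1)
  | ite_false {e : Expr} {p q : Cmd} {s s₁ : Store} {t : ℕ} :
      e.eval s = 0 → Exec q s s₁ t → Exec (.ite e p q) s s₁ (e.cost s + t + 1)
  | loop_exit {e : Expr} {p : Cmd} {s : Store} :
      e.eval s = 0 → Exec (.loop e p) s s (e.cost s + 1)
  | loop_step {e : Expr} {p : Cmd} {s s₁ s₂ : Store} {t₁ t₂ : ℕ} :
      e.eval s ≠ 0 → Exec p s s₁ t₁ → Exec (.loop e p) s₁ s₂ t₂ →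
      Exec (.loop e p) s s₂ (e.cost s + t₁ + t₂ + 1)

/-- The input list is placed at the memory cells `0, 1, …`, and its length in register `0`. -/
def initStore (inp : List ℕ) : Store where
  reg r := if r = 0 then inp.length else 0
  mem i := inp.getD i 0

/-- On input `inp` the program halts within cost `t`, and leaves the list `out` at the memory cells
`0, 1, …` and its length in register `0`. -/
def ComputesWithin (p : Cmd) (inp out : List ℕ) (t : ℝ) : Prop :=
  ∃ (s : Store) (cost : ℕ), Exec p (initStore inp) s cost ∧ (cost : ℝ) ≤ t ∧
    s.reg 0 = out.length ∧ ∀ i : Fin out.length, s.mem i = out.get i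

end RAM

/-! ### Encoding of the inputs of the parties -/

/-- A bit string as a list of the numbers `0`, `1`. -/
def bitList {m : ℕ} (x : Fin m → Bool) : List ℕ := List.ofFn fun i => (x i).toNat

/-- The concatenation of `r` bit strings of length `m`. -/
def blockList {r m : ℕ} (x : Fin r → Fin m → Bool) : List ℕ :=
  (List.ofFn fun i => bitList (x i)).flatten

/-- The description of a branching program: the queried variables, layer by layer, and then for
all `i, u, v` (in lexicographic order) the two bits saying whether there is an edge marked `0`
resp. `1` from `(i, u)` to `(i + 1, v)`. -/
def BranchingProgram.encode {n W T : ℕ} (P : BranchingProgram n W T) : List ℕ :=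
  (List.ofFn fun i => (P.var i : ℕ)) ++
    (List.ofFn fun i => (List.ofFn fun u => (List.ofFn fun v =>
      [(P.edge i u v false).toNat, (P.edge i u v true).toNat]).flatten).flatten).flatten

/-- The input common to Alice and Bob: the parameters, the binary logarithm `k` of the inverse of
the allowed soundness error, and the branching program. -/
def commonInput {a b W T : ℕ} (P : BranchingProgram (a + b) W T) (k : ℕ) : List ℕ :=
  [a, b, W, T, k] ++ P.encode

/-- The protocol `Q` is carried out by three programs within cost `t`: `shape` computes the number
of rounds and the message lengths from the common input, `bob` computes Bob's message, and `alice`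
computes Alice's decision. Nothing is asked of the prover Merlin. -/
def IPProtocol.ImplementedWithin {a b W T : ℕ} (Q : IPProtocol a b)
    (P : BranchingProgram (a + b) W T) (k : ℕ) (shape bob alice : RAM.Cmd) (t : ℝ) : Prop :=
  RAM.ComputesWithin shape (commonInput P k) [Q.rounds, Q.msgLen, Q.coinLen, Q.bobLen] t ∧
  (∀ (xB : Fin b → Bool) (c : Q.Coins),
    RAM.ComputesWithin bob (commonInput P k ++ bitList xB ++ blockList c)
      (bitList (Q.bob xB c)) t) ∧
  (∀ (xA : Fin a → Bool) (m : Fin Q.rounds → Fin Q.msgLen → Bool) (c : Q.Coins)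
      (y : Fin Q.bobLen → Bool),
    RAM.ComputesWithin alice
      (commonInput P k ++ bitList xA ++ blockList m ++ blockList c ++ bitList y)
      [(Q.alice xA m c y).toNat] t)

/-! ### The bounds -/

/-- Binary logarithm, at least `1` (so that bounds make sense for small arguments as well). -/
noncomputable def lg (x : ℝ) : ℝ := max 1 (Real.logb 2 x)

/-- `log log W + log log T + log ε⁻¹`. -/
noncomputable def elementBits (W T : ℕ) (ε : ℝ) : ℝ :=
  lg (lg W) + lg (lg T) + lg ε⁻¹

/-!
The existence of an accepting path is turned into a quantified Boolean formula by repeated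
halving: there is a path from `u` to `v` through `2 ^ j` layers iff there is a middle node `w`
such that for both halves, the first from `u` to `w` and the second from `w` to `v`, there is a
path through `2 ^ (j - 1)` layers. The length is padded to a power of two by loops. With `m` bits
per node and `D` bits per layer index, one level consists of `m` disjunctions over the bits of
`w`, of a conjunction over the bit of the layer index that tells the halves apart, and of `m`
selections, which replace the end points by those of the chosen half. All levels use the same
coordinates for the bits of `w`, `u`, `v`. The formula ends in the step relation between the nodes
of two consecutive layers (`stageTrue_iff_walk`).

The formula is arithmetized over a prime field, with the multilinear extension `layerExt` of the
step relation as the base function. Each operation is followed by a linearization in all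
variables, and so all functions involved have degree at most three in the variable of the current
round (`polyDeg_round`). The interactive proof is the one for quantified Boolean formulas: in each
round Merlin sends a cubic polynomial, Alice checks it against the current claim, and a random
field element selects the next claim. If the initial claim is wrong and Alice accepts, then in
some round the coin is one of at most three roots of a polynomial fixed before the coin is tossed
(`FieldChecks.exists_badCoin`). The final claim is about the base function at a point which is
determined by the coins. As each layer queries a variable of Alice or of Bob, the base function is
the sum of a part known to Alice and a part known to Bob (`edges_add`), so that Bob has to send
only one field element per run.

A field element is given by `2 h` coins, where `2 ^ h` is at least three times the number
`O(lg² W lg² T)` of rounds of a run. The error of one run is then at most `2 ^ (-h)`, and about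
`k / h` runs in sequence make it `2 ^ (-k)` (`card_all_blocks_bad_le`, `card_accepting_le`). In
total this costs `O(k + h)` bits for each round of a run, and `O(k + h)` bits for Bob.

For the running times, the quantities computed by the parties are written as terms of a small
language, in which the values of all recursions are clamped. Every such term is compiled into a
program of polynomial cost (`RAM.Tm.spec`, `RAM.exists_program`), and closure properties of the
functions given by terms (`RAM.PC`, `RAM.PCZ`) show that the messages and decisions are among
them.
-/

/-! ### An expression language with polynomial cost -/

namespace RAM

/-- The arithmetic operations of the machine. -/
inductive Op where
  | add | sub | mul | div | mod

/-- The function computed by an operation. -/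
def Op.fn : Op → ℕ → ℕ → ℕ
  | add, x, y => x + y
  | sub, x, y => x - y
  | mul, x, y => x * y
  | div, x, y => x / y
  | mod, x, y => x % y

/-- The machine expression performing an operation. -/
def Op.expr : Op → Expr → Expr → Expr
  | add => .add
  | sub => .sub
  | mul => .mul
  | div => .div
  | mod => .mod

lemma Op.eval_expr (o : Op) (e f : Expr) (s : Store) :
    (o.expr e f).eval s = o.fn (e.eval s) (f.eval s) := by
  cases o <;> rfl

lemma Op.cost_expr (o : Op) (e f : Expr) (s : Store) :
    (o.expr e f).cost s = e.cost s + f.cost s + (o.fn (e.eval s) (f.eval s)).size + 1 := by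
  cases o <;> rfl

lemma Op.fn_le (o : Op) (x y : ℕ) : o.fn x y ≤ x * y + x + y := by
  cases o <;> simp only [Op.fn]
  · lia
  · lia
  · lia
  · exact (Nat.div_le_self _ _).trans (by lia)
  · exact (Nat.mod_le _ _).trans (by lia)

/-- Terms over named variables and a read-only input array. The term `fold v n i M b` starts with
the value `i` and replaces, for `j = 0, …, n - 1`, the current value `acc` by the value of
`b mod (M + 1)`, where the variables `v` and `v + 1` of `b` stand for `j` and `acc`. The clamping
to `M` keeps all values polynomially bounded. -/
inductive Tm where
  | lit (k : ℕ)
  | var (v : ℕ)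
  | load (e : Tm)
  | bin (o : Op) (e f : Tm)
  | ite (c e f : Tm)
  | letIn (v : ℕ) (e b : Tm)
  | fold (v : ℕ) (n i M b : Tm)

/-- Binding of the index and the accumulator of a fold. -/
def bind₂ (ρ : ℕ → ℕ) (v x y : ℕ) : ℕ → ℕ := Function.update (Function.update ρ v x) (v + 1) y

def Tm.eval (inp : ℕ → ℕ) : Tm → (ℕ → ℕ) → ℕ
  | lit k, _ => k
  | var v, ρ => ρ v
  | load e, ρ => inp (e.eval inp ρ)
  | bin o e f, ρ => o.fn (e.eval inp ρ) (f.eval inp ρ)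
  | ite c e f, ρ => if c.eval inp ρ ≠ 0 then e.eval inp ρ else f.eval inp ρ
  | letIn v e b, ρ => b.eval inp (Function.update ρ v (e.eval inp ρ))
  | fold v n i M b, ρ => Nat.rec (motive := fun _ => ℕ) (i.eval inp ρ)
      (fun j acc => b.eval inp (bind₂ ρ v j acc) % (M.eval inp ρ + 1)) (n.eval inp ρ)

/-- Compilation of a term into a program that leaves its value in register `t` and changes only
registers `≥ t`. The variable `v` is kept in register `ren v`, and register `0` holds the length of
the input array. -/
def Tm.compile : Tm → (ℕ → ℕ) → ℕ → Cmd
  | lit k, _, t => .assign t (.lit k)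
  | var v, ren, t => .assign t (.reg (ren v))
  | load e, ren, t => .seq (e.compile ren t)
      (.ite (.sub (.reg 0) (.reg t)) (.assign t (.load (.reg t))) (.assign t (.lit 0)))
  | bin o e f, ren, t => .seq (e.compile ren t) (.seq (f.compile ren (t + 1))
      (.assign t (o.expr (.reg t) (.reg (t + 1)))))
  | ite c e f, ren, t => .seq (c.compile ren t)
      (.ite (.reg t) (e.compile ren t) (f.compile ren t))
  | letIn v e b, ren, t => .seq (e.compile ren t)
      (.seq (b.compile (Function.update ren v t) (t + 1)) (.assign t (.reg (t + 1))))
  | fold v n i M b, ren, t => .seq (n.compile ren t) (.seq (i.compile ren (t + 1))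
      (.seq (M.compile ren (t + 2)) (.seq (.assign (t + 3) (.lit 0))
      (.seq (.loop (.sub (.reg t) (.reg (t + 3)))
        (.seq (b.compile (bind₂ ren v (t + 3) (t + 1)) (t + 4))
        (.seq (.assign (t + 1) (.mod (.reg (t + 4)) (.add (.reg (t + 2)) (.lit 1))))
          (.assign (t + 3) (.add (.reg (t + 3)) (.lit 1))))))
      (.assign t (.reg (t + 1)))))))

/-- The store `s` represents the input array `inp`, which vanishes from index `len` on, and the
values `ρ` of the variables, kept in registers below `t`. -/
structure Fits (len : ℕ) (inp ρ ren : ℕ → ℕ) (t : ℕ) (s : Store) : Prop where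
  pos : 0 < t
  ren_lt : ∀ v, ren v < t
  len_eq : s.reg 0 = len
  mem_eq : ∀ i < len, s.mem i = inp i
  inp_eq : ∀ i, len ≤ i → inp i = 0
  env_eq : ∀ v, s.reg (ren v) = ρ v

lemma Fits.of_frame {len : ℕ} {inp ρ ren : ℕ → ℕ} {t t' : ℕ} {s s' : Store}
    (h : Fits len inp ρ ren t s) (htt : t ≤ t') (hr : ∀ r < t, s'.reg r = s.reg r)
    (hm : s'.mem = s.mem) : Fits len inp ρ ren t' s' where
  pos := h.pos.trans_le htt
  ren_lt v := (h.ren_lt v).trans_le htt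
  len_eq := by rw [hr 0 h.pos, h.len_eq]
  mem_eq i hi := by rw [hm, h.mem_eq i hi]
  inp_eq := h.inp_eq
  env_eq v := by rw [hr _ (h.ren_lt v), h.env_eq]

lemma Fits.update {len : ℕ} {inp ρ ren : ℕ → ℕ} {t : ℕ} {s : Store} {v r : ℕ}
    (h : Fits len inp ρ ren t s) (hr : r < t) :
    Fits len inp (Function.update ρ v (s.reg r)) (Function.update ren v r) t s where
  pos := h.pos
  ren_lt w := by
    simp only [Function.update_apply]
    split_ifs
    exacts [hr, h.ren_lt w]
  len_eq := h.len_eq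
  mem_eq := h.mem_eq
  inp_eq := h.inp_eq
  env_eq w := by
    simp only [Function.update_apply]
    split_ifs
    exacts [rfl, h.env_eq w]

lemma Fits.bind₂ {len : ℕ} {inp ρ ren : ℕ → ℕ} {t : ℕ} {s : Store} {v r₁ r₂ : ℕ}
    (h : Fits len inp ρ ren t s) (h₁ : r₁ < t) (h₂ : r₂ < t) :
    Fits len inp (bind₂ ρ v (s.reg r₁) (s.reg r₂)) (bind₂ ren v r₁ r₂) t s :=
  (h.update h₁).update h₂

/-! ### Polynomial bounds -/

lemma pow_bound_mono {X x a b : ℕ} (hX : 2 ≤ X) (h : x ≤ X ^ a) (hab : a ≤ b) : x ≤ X ^ b :=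
  h.trans (Nat.pow_le_pow_right (by lia) hab)

lemma const_bound {X : ℕ} (hX : 2 ≤ X) (k : ℕ) : k ≤ X ^ k :=
  Nat.lt_two_pow_self.le.trans (Nat.pow_le_pow_left hX k)

lemma add_bound {X x y a b : ℕ} (hX : 2 ≤ X) (hx : x ≤ X ^ a) (hy : y ≤ X ^ b) :
    x + y ≤ X ^ (a + b + 1) := by
  have h1 : x ≤ X ^ (a + b) := pow_bound_mono hX hx (by lia)
  have h2 : y ≤ X ^ (a + b) := pow_bound_mono hX hy (by lia)
  calc x + y ≤ X ^ (a + b) * 2 := by lia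
    _ ≤ X ^ (a + b) * X := by gcongr
    _ = X ^ (a + b + 1) := (pow_succ _ _).symm

lemma mul_bound {X x y a b : ℕ} (hx : x ≤ X ^ a) (hy : y ≤ X ^ b) :
    x * y ≤ X ^ (a + b) := by
  rw [pow_add]; exact Nat.mul_le_mul hx hy

lemma size_le_self (x : ℕ) : x.size ≤ x := Nat.size_le.2 Nat.lt_two_pow_self

/-- A loop with an invariant indexed by the number of iterations done so far. -/
lemma exec_loop {e : Expr} {p : Cmd} (I : ℕ → Store → Prop) (n c d : ℕ)
    (hstep : ∀ j < n, ∀ s, I j s → e.eval s ≠ 0 ∧ e.cost s ≤ d ∧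
      ∃ s' c', Exec p s s' c' ∧ c' ≤ c ∧ I (j + 1) s')
    (hend : ∀ s, I n s → e.eval s = 0 ∧ e.cost s ≤ d) (s : Store) (h0 : I 0 s) :
    ∃ s' c', Exec (.loop e p) s s' c' ∧ c' ≤ n * (c + d + 1) + d + 1 ∧ I n s' := by
  suffices h : ∀ i j s, i + j = n → I j s →
      ∃ s' c', Exec (.loop e p) s s' c' ∧ c' ≤ i * (c + d + 1) + d + 1 ∧ I n s' from
    h n 0 s rfl h0
  intro i
  induction i with
  | zero =>
    intro j s hj hs
    obtain rfl : j = n := by lia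
    obtain ⟨h1, h2⟩ := hend s hs
    exact ⟨s, _, .loop_exit h1, by lia, hs⟩
  | succ i ih =>
    intro j s hj hs
    obtain ⟨h1, h2, s₁, c₁, hx, hc, hI⟩ := hstep j (by lia) s hs
    obtain ⟨s₂, c₂, hx₂, hc₂, hI₂⟩ := ih (j + 1) s₁ (by lia) hI
    refine ⟨s₂, _, .loop_step h1 hx hx₂, ?_, hI₂⟩
    rw [Nat.succ_mul]; lia

/-- The specification of a compiled term: for a fixed exponent `C`, whenever inputs and variables
are at most `X`, the value and the cost are at most `X ^ C`. -/
def Tm.Spec (e : Tm) (ren : ℕ → ℕ) (t : ℕ) : Prop :=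
  ∃ C : ℕ, ∀ (X len : ℕ) (inp ρ : ℕ → ℕ) (s : Store), 2 ≤ X → len ≤ X → (∀ i, inp i ≤ X) →
    (∀ v, ρ v ≤ X) → Fits len inp ρ ren t s →
    ∃ s' c, Exec (e.compile ren t) s s' c ∧ c ≤ X ^ C ∧ e.eval inp ρ ≤ X ^ C ∧
      s'.reg t = e.eval inp ρ ∧ s'.mem = s.mem ∧ ∀ r < t, s'.reg r = s.reg r

lemma Tm.spec_lit (k : ℕ) (ren : ℕ → ℕ) (t : ℕ) : (Tm.lit k).Spec ren t := by
  refine ⟨2 * k + 2 * t + 3, fun X len inp ρ s hX hlen hinp hρ hf => ?_⟩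
  refine ⟨_, _, .assign t (.lit k) s, ?_, ?_, by simp [Expr.eval, Tm.eval], rfl, ?_⟩
  · have h1 := size_le_self k
    have h2 := size_le_self t
    exact le_trans (by simp only [Expr.cost]; lia) (const_bound hX _)
  · exact (const_bound hX k).trans (Nat.pow_le_pow_right (by lia) (by lia))
  · intro r hr; simp [hr.ne]

lemma Tm.spec_var (v : ℕ) (ren : ℕ → ℕ) (t : ℕ) : (Tm.var v).Spec ren t := by
  refine ⟨2 * t + 2 + 1 + 1, fun X len inp ρ s hX hlen hinp hρ hf => ?_⟩
  refine ⟨_, _, .assign t (.reg (ren v)) s, ?_, ?_, ?_, rfl, ?_⟩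
  · have h1 := size_le_self (ren v)
    have h2 := size_le_self t
    have h3 := size_le_self (s.reg (ren v))
    have h4 := hf.ren_lt v
    have h5 := hρ v
    rw [hf.env_eq] at h3
    refine le_trans ?_ (add_bound hX (const_bound hX (2 * t + 2)) (b := 1) (x := 2 * t + 2)
      (y := X) (by simp))
    simp only [Expr.cost, hf.env_eq]; lia
  · exact pow_bound_mono (a := 1) hX (by simpa [Tm.eval] using hρ v) (by lia)
  · simp [Expr.eval, Tm.eval, hf.env_eq]
  · intro r hr; simp [hr.ne]

lemma Tm.spec_load {e : Tm} {ren : ℕ → ℕ} {t : ℕ} (he : e.Spec ren t) :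
    (Tm.load e).Spec ren t := by
  obtain ⟨C, he⟩ := he
  refine ⟨3 * C + 6 * t + 30,
    fun X len inp ρ s hX hlen hinp hρ hf => ?_⟩
  obtain ⟨s₁, c₁, hx, hc, hv, ht, hm, hr⟩ := he X len inp ρ s hX hlen hinp hρ hf
  have hf₁ := hf.of_frame le_rfl hr hm
  have hX1 : X ≤ X ^ 1 := by simp
  have hval : inp (e.eval inp ρ) ≤ X ^ 1 := by simpa using hinp _
  have hst := size_le_self t
  have hsv := size_le_self (e.eval inp ρ)
  have hsl := size_le_self len
  have hsub := size_le_self (len - e.eval inp ρ)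
  have hbig : c₁ + ((6 * t + 12 + (e.eval inp ρ + e.eval inp ρ + len)) +
      (inp (e.eval inp ρ) + len)) ≤
      X ^ (3 * C + 6 * t + 30) :=
    (add_bound hX hc (add_bound hX (add_bound hX (const_bound hX (6 * t + 12))
      (add_bound hX (add_bound hX hv hv) (hlen.trans hX1)))
      (add_bound hX hval (hlen.trans hX1)))).trans (Nat.pow_le_pow_right (by lia) (by lia))
  have heval : (Expr.sub (.reg 0) (.reg t)).eval s₁ = len - e.eval inp ρ := by
    simp [Expr.eval, ht, hf₁.len_eq]
  have hsi := size_le_self (inp (e.eval inp ρ))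
  have h0 : Nat.size 0 = 0 := Nat.size_zero
  by_cases hlt : e.eval inp ρ < len
  · refine ⟨_, _, .seq hx (.ite_true (by rw [heval]; lia) (.assign t _ s₁)), ?_, ?_, ?_, hm, ?_⟩
    · refine le_trans ?_ hbig
      simp only [Expr.cost, Expr.eval, ht, hf₁.len_eq, hf₁.mem_eq _ hlt]
      lia
    · exact hval.trans (Nat.pow_le_pow_right (by lia) (by lia))
    · simp [Expr.eval, Tm.eval, ht, hf₁.mem_eq _ hlt]
    · intro r hrt; simp [hrt.ne, hr r hrt]
  · refine ⟨_, _, .seq hx (.ite_false (by rw [heval]; lia) (.assign t _ s₁)), ?_, ?_, ?_, hm, ?_⟩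
    · refine le_trans ?_ hbig
      simp only [Expr.cost, Expr.eval, ht, hf₁.len_eq]
      lia
    · exact hval.trans (Nat.pow_le_pow_right (by lia) (by lia))
    · simp [Expr.eval, Tm.eval, hf.inp_eq _ (not_lt.1 hlt)]
    · intro r hrt; simp [hrt.ne, hr r hrt]

lemma Tm.spec_bin (o : Op) {e f : Tm} {ren : ℕ → ℕ} {t : ℕ} (he : e.Spec ren t)
    (hf : f.Spec ren (t + 1)) : (Tm.bin o e f).Spec ren t := by
  obtain ⟨C, he⟩ := he
  obtain ⟨D, hf⟩ := hf
  refine ⟨C + (D + (3 * t + 6 + (C + D + (C + D + 1 + (C + D + 1) + 1) + 1) + 1) + 1) + 1,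
    fun X len inp ρ s hX hlen hinp hρ hfit => ?_⟩
  obtain ⟨s₁, c₁, hx, hc, hv, ht, hm, hr⟩ := he X len inp ρ s hX hlen hinp hρ hfit
  have hf₁ := hfit.of_frame (Nat.le_succ t) hr hm
  obtain ⟨s₂, c₂, hx₂, hc₂, hv₂, ht₂, hm₂, hr₂⟩ := hf X len inp ρ s₁ hX hlen hinp hρ hf₁
  have htt : s₂.reg t = e.eval inp ρ := by rw [hr₂ t (by lia), ht]
  have ho := o.fn_le (e.eval inp ρ) (f.eval inp ρ)
  have hbig : c₁ + (c₂ + (3 * t + 6 + (e.eval inp ρ * f.eval inp ρ +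
      ((e.eval inp ρ + f.eval inp ρ) + (e.eval inp ρ + f.eval inp ρ))))) ≤
      X ^ (C + (D + (3 * t + 6 + (C + D + (C + D + 1 + (C + D + 1) + 1) + 1) + 1) + 1) + 1) :=
    add_bound hX hc (add_bound hX hc₂ (add_bound hX (const_bound hX _) (add_bound hX
      (mul_bound hv hv₂) (add_bound hX (add_bound hX hv hv₂) (add_bound hX hv hv₂)))))
  refine ⟨_, _, .seq hx (.seq hx₂ (.assign t _ s₂)), ?_, ?_, ?_, hm₂.trans hm, ?_⟩
  · refine le_trans ?_ hbig
    have h1 := size_le_self t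
    have h2 := size_le_self (t + 1)
    have h3 := size_le_self (e.eval inp ρ)
    have h4 := size_le_self (f.eval inp ρ)
    have h5 := size_le_self (o.fn (e.eval inp ρ) (f.eval inp ρ))
    simp only [Op.cost_expr, Expr.cost, Expr.eval, htt, ht₂]
    lia
  · exact le_trans (by simp only [Tm.eval]; lia) hbig
  · simp [Op.eval_expr, Expr.eval, Tm.eval, htt, ht₂]
  · intro r hrt; simp [hrt.ne, hr r hrt, hr₂ r (by lia)]

lemma Tm.spec_ite {c e f : Tm} {ren : ℕ → ℕ} {t : ℕ} (hc : c.Spec ren t) (he : e.Spec ren t)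
    (hf : f.Spec ren t) : (Tm.ite c e f).Spec ren t := by
  obtain ⟨A, hc⟩ := hc
  obtain ⟨C, he⟩ := he
  obtain ⟨D, hf⟩ := hf
  refine ⟨A + (A + (t + 3 + (C + D + 1) + 1) + 1) + 1,
    fun X len inp ρ s hX hlen hinp hρ hfit => ?_⟩
  obtain ⟨s₁, c₁, hx, hc₁, hv, ht, hm, hr⟩ := hc X len inp ρ s hX hlen hinp hρ hfit
  have hf₁ := hfit.of_frame le_rfl hr hm
  have h1 := size_le_self t
  have h3 := size_le_self (c.eval inp ρ)
  by_cases h : c.eval inp ρ ≠ 0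
  · obtain ⟨s₂, c₂, hx₂, hc₂, hv₂, ht₂, hm₂, hr₂⟩ := he X len inp ρ s₁ hX hlen hinp hρ hf₁
    refine ⟨s₂, _, .seq hx (.ite_true (by simpa [Expr.eval, ht] using h) hx₂), ?_, ?_, ?_,
      hm₂.trans hm, fun r hrt => (hr₂ r hrt).trans (hr r hrt)⟩
    · refine le_trans ?_ (add_bound hX hc₁ (add_bound hX hv (add_bound hX (const_bound hX (t + 3))
        (pow_bound_mono hX hc₂ (by lia : C ≤ C + D + 1)))))
      simp only [Expr.cost, ht]
      lia
    · simp only [Tm.eval, if_pos h]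
      exact hv₂.trans (Nat.pow_le_pow_right (by lia) (by lia))
    · simp only [Tm.eval, if_pos h, ht₂]
  · obtain ⟨s₂, c₂, hx₂, hc₂, hv₂, ht₂, hm₂, hr₂⟩ := hf X len inp ρ s₁ hX hlen hinp hρ hf₁
    refine ⟨s₂, _, .seq hx (.ite_false (by simpa [Expr.eval, ht] using h) hx₂), ?_, ?_, ?_,
      hm₂.trans hm, fun r hrt => (hr₂ r hrt).trans (hr r hrt)⟩
    · refine le_trans ?_ (add_bound hX hc₁ (add_bound hX hv (add_bound hX (const_bound hX (t + 3))
        (pow_bound_mono hX hc₂ (by lia : D ≤ C + D + 1)))))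
      simp only [Expr.cost, ht]
      lia
    · simp only [Tm.eval, if_neg h]
      exact hv₂.trans (Nat.pow_le_pow_right (by lia) (by lia))
    · simp only [Tm.eval, if_neg h, ht₂]

lemma Tm.spec_letIn (v : ℕ) {e b : Tm} {ren : ℕ → ℕ} {t : ℕ} (he : e.Spec ren t)
    (hb : b.Spec (Function.update ren v t) (t + 1)) : (Tm.letIn v e b).Spec ren t := by
  obtain ⟨C, he⟩ := he
  obtain ⟨D, hb⟩ := hb
  obtain ⟨G, hG⟩ : ∃ G, G = (C + 1) * D := ⟨_, rfl⟩
  refine ⟨C + 3 * G + 2 * t + 20, fun X len inp ρ s hX hlen hinp hρ hfit => ?_⟩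
  obtain ⟨s₁, c₁, hx, hc, hv, ht, hm, hr⟩ := he X len inp ρ s hX hlen hinp hρ hfit
  have hf₁ := (hfit.of_frame (Nat.le_succ t) hr hm).update (v := v) (Nat.lt_succ_self t)
  rw [ht] at hf₁
  have hXY : X ≤ X ^ (C + 1) := Nat.le_self_pow (by lia) X
  obtain ⟨s₂, c₂, hx₂, hc₂, hv₂, ht₂, hm₂, hr₂⟩ := hb (X ^ (C + 1)) len inp _ s₁ (hX.trans hXY)
    (hlen.trans hXY) (fun i => (hinp i).trans hXY) (fun w => by
      simp only [Function.update_apply]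
      split_ifs
      exacts [pow_bound_mono hX hv (by lia), (hρ w).trans hXY]) hf₁
  rw [← pow_mul, ← hG] at hc₂ hv₂
  refine ⟨_, _, .seq hx (.seq hx₂ (.assign t _ s₂)), ?_, ?_, ?_, hm₂.trans hm, ?_⟩
  · refine le_trans ?_ ((add_bound hX hc (add_bound hX hc₂ (add_bound hX
      (const_bound hX (2 * t + 4)) hv₂))).trans (Nat.pow_le_pow_right (by lia) (by lia)))
    have h1 := size_le_self t
    have h2 := size_le_self (t + 1)
    have h3 := size_le_self (b.eval inp (Function.update ρ v (e.eval inp ρ)))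
    simp only [Expr.cost, ht₂]
    lia
  · exact pow_bound_mono hX hv₂ (by lia)
  · simp [Expr.eval, Tm.eval, ht₂]
  · intro r hrt; simp [hrt.ne, hr r hrt, hr₂ r (by lia)]

lemma Tm.spec_fold (v : ℕ) {n i M b : Tm} {ren : ℕ → ℕ} {t : ℕ} (hn : n.Spec ren t)
    (hi : i.Spec ren (t + 1)) (hM : M.Spec ren (t + 2))
    (hb : b.Spec (bind₂ ren v (t + 3) (t + 1)) (t + 4)) : (Tm.fold v n i M b).Spec ren t := by
  obtain ⟨A, hn⟩ := hn
  obtain ⟨B, hi⟩ := hi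
  obtain ⟨C, hM⟩ := hM
  obtain ⟨D, hb⟩ := hb
  -- `Y = X ^ E` bounds all values of the loop variables.
  set E := A + (B + C + 1) + 1 + 1 with hE
  set G := E + (E * D + (14 * t + 50 + (E + E * D + 1 + (E + E + 1) + 1) + 1) + 1) +
    (2 * t + 8 + (E + E + 1) + 1) + 1 with hG
  refine ⟨A + (B + (C + (10 * t + 50 + (E + G + 1) + 1) + 1) + 1) + 1,
    fun X len inp ρ s hX hlen hinp hρ hfit => ?_⟩
  obtain ⟨s₁, c₁, hx₁, hc₁, hv₁, ht₁, hm₁, hr₁⟩ := hn X len inp ρ s hX hlen hinp hρ hfit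
  have hf₁ := hfit.of_frame (Nat.le_succ t) hr₁ hm₁
  obtain ⟨s₂, c₂, hx₂, hc₂, hv₂, ht₂, hm₂, hr₂⟩ := hi X len inp ρ s₁ hX hlen hinp hρ hf₁
  have hf₂ := hf₁.of_frame (Nat.le_succ (t + 1)) hr₂ hm₂
  obtain ⟨s₃, c₃, hx₃, hc₃, hv₃, ht₃, hm₃, hr₃⟩ := hM X len inp ρ s₂ hX hlen hinp hρ hf₂
  have hf₃ := hf₂.of_frame (Nat.le_succ (t + 2)) hr₃ hm₃
  set N := n.eval inp ρ
  set MM := M.eval inp ρ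
  set F : ℕ → ℕ := fun k => Nat.rec (motive := fun _ => ℕ) (i.eval inp ρ)
      (fun j acc => b.eval inp (bind₂ ρ v j acc) % (MM + 1)) k with hF
  have hFs (k : ℕ) : F (k + 1) = b.eval inp (bind₂ ρ v k (F k)) % (MM + 1) := rfl
  have hsum : N + (i.eval inp ρ + MM) ≤ X ^ (A + (B + C + 1) + 1) :=
    add_bound hX hv₁ (add_bound hX hv₂ hv₃)
  have hFle (k : ℕ) : F k ≤ i.eval inp ρ + MM := by
    cases k with
    | zero => exact Nat.le_add_right _ _
    | succ k => rw [hFs]; have := Nat.mod_lt (b.eval inp (bind₂ ρ v k (F k))) MM.succ_pos; lia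
  set Y := X ^ E with hY
  have hpY : 2 * X ^ (A + (B + C + 1) + 1) ≤ Y := by
    rw [hY, hE, pow_succ _ (A + (B + C + 1) + 1), mul_comm]
    exact Nat.mul_le_mul_left _ hX
  have hXY : X ≤ Y := Nat.le_self_pow (by lia) X
  have hpos : 1 ≤ X ^ (A + (B + C + 1) + 1) := Nat.one_le_pow _ _ (by lia)
  have hNY : N + 1 ≤ Y := by lia
  have hFY (k : ℕ) : F k ≤ Y := (hFle k).trans (by lia)
  have hMY : MM + 1 ≤ Y := by lia
  let s₄ : Store := { s₃ with reg := Function.update s₃.reg (t + 3) 0 }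
  have hx₄ : Exec (.assign (t + 3) (.lit 0)) s₃ s₄ _ := .assign (t + 3) (.lit 0) s₃
  -- The loop invariant.
  let I : ℕ → Store → Prop := fun k σ => k ≤ N ∧ σ.mem = s.mem ∧ (∀ r < t, σ.reg r = s.reg r) ∧
    σ.reg t = N ∧ σ.reg (t + 1) = F k ∧ σ.reg (t + 2) = MM ∧ σ.reg (t + 3) = k
  have hI₀ : I 0 s₄ := by
    refine ⟨Nat.zero_le _, ?_, fun r hr => ?_, ?_, ?_, ?_, ?_⟩
    · exact hm₃.trans (hm₂.trans hm₁)
    · simp only [s₄]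
      rw [Function.update_of_ne (by lia), hr₃ r (by lia), hr₂ r (by lia), hr₁ r hr]
    · simp only [s₄]
      rw [Function.update_of_ne (by lia), hr₃ t (by lia), hr₂ t (by lia), ht₁]
    · simp only [s₄]
      rw [Function.update_of_ne (by lia), hr₃ _ (by lia), ht₂]
      rfl
    · simp only [s₄]
      rw [Function.update_of_ne (by lia), ht₃]
    · simp [s₄]
  have hst := size_le_self t
  have hst1 := size_le_self (t + 1)
  have hst2 := size_le_self (t + 2)
  have hst3 := size_le_self (t + 3)
  have hst4 := size_le_self (t + 4)
  have hs1 : Nat.size 1 = 1 := Nat.size_one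
  have hs0 : Nat.size 0 = 0 := Nat.size_zero
  have htest (k : ℕ) (σ : Store) (hσ : I k σ) :
      (Expr.sub (.reg t) (.reg (t + 3))).eval σ = N - k ∧
      (Expr.sub (.reg t) (.reg (t + 3))).cost σ ≤ 2 * t + 8 + (Y + Y) := by
    obtain ⟨hk, -, -, h1, -, -, h2⟩ := hσ
    refine ⟨by simp [Expr.eval, h1, h2], ?_⟩
    have h3 := size_le_self N
    have h4 := size_le_self k
    have h5 := size_le_self (N - k)
    simp only [Expr.cost, Expr.eval, h1, h2]
    lia
  obtain ⟨s₅, c₅, hx₅, hc₅, hI₅⟩ := exec_loop (e := .sub (.reg t) (.reg (t + 3)))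
    (p := .seq (b.compile (bind₂ ren v (t + 3) (t + 1)) (t + 4))
        (.seq (.assign (t + 1) (.mod (.reg (t + 4)) (.add (.reg (t + 2)) (.lit 1))))
          (.assign (t + 3) (.add (.reg (t + 3)) (.lit 1))))) I N
    (Y ^ D + (6 * t + 30 + (Y + Y ^ D + (Y + Y)))) (2 * t + 8 + (Y + Y))
    (by
      intro j hj σ hσ
      refine ⟨by rw [(htest j σ hσ).1]; lia, (htest j σ hσ).2, ?_⟩
      obtain ⟨-, hmem, hreg, h0, h1, h2, h3⟩ := hσ
      have hfσ : Fits len inp ρ ren (t + 4) σ := hfit.of_frame (by lia) hreg hmem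
      have hfb := hfσ.bind₂ (v := v) (r₁ := t + 3) (r₂ := t + 1) (by lia) (by lia)
      rw [h3, h1] at hfb
      obtain ⟨σ₁, d₁, hxb, hdb, hvb, htb, hmb, hrb⟩ := hb Y len inp _ σ (hX.trans hXY)
        (hlen.trans hXY) (fun k => (hinp k).trans hXY)
        (fun w => by
          simp only [RAM.bind₂, Function.update_apply]
          split_ifs
          exacts [hFY j, by lia, (hρ w).trans hXY]) hfb
      refine ⟨_, _, .seq hxb (.seq (.assign _ _ _) (.assign _ _ _)), ?_, ?_⟩
      · have h4 := size_le_self (b.eval inp (bind₂ ρ v j (F j)))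
        have h5 := size_le_self MM
        have h6 := size_le_self (MM + 1)
        have h7 := size_le_self (b.eval inp (bind₂ ρ v j (F j)) % (MM + 1))
        have h8 := Nat.mod_lt (b.eval inp (bind₂ ρ v j (F j))) MM.succ_pos
        have h9 := size_le_self j
        have h10 := size_le_self (j + 1)
        simp only [Expr.cost, Expr.eval, htb, hrb (t + 2) (by lia), h2,
          Function.update_of_ne (show t + 3 ≠ t + 1 by lia), hrb (t + 3) (by lia), h3, hs1]
        lia
      · refine ⟨by lia, hmb.trans hmem, fun r hr => ?_, ?_, ?_, ?_, ?_⟩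
        · simp only
          rw [Function.update_of_ne (by lia), Function.update_of_ne (by lia), hrb r (by lia),
            hreg r hr]
        · simp only
          rw [Function.update_of_ne (by lia), Function.update_of_ne (by lia), hrb _ (by lia), h0]
        · simp only
          rw [Function.update_of_ne (by lia), Function.update_self]
          simp only [Expr.eval, htb, hrb (t + 2) (by lia), h2, hFs]
        · simp only
          rw [Function.update_of_ne (by lia), Function.update_of_ne (by lia), hrb _ (by lia), h2]
        · simp only
          rw [Function.update_self]
          simp only [Expr.eval]
          rw [Function.update_of_ne (by lia), hrb _ (by lia), h3])
    (fun σ hσ => ⟨by rw [(htest N σ hσ).1]; lia, (htest N σ hσ).2⟩) s₄ hI₀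
  obtain ⟨-, hmem, hreg, h0, h1, h2, h3⟩ := hI₅
  have hYE : Y ≤ X ^ E := le_rfl
  have hYD : Y ^ D ≤ X ^ (E * D) := by rw [hY, pow_mul]
  have hloop : N * (Y ^ D + (6 * t + 30 + (Y + Y ^ D + (Y + Y))) + (2 * t + 8 + (Y + Y)) + 1) +
      (2 * t + 8 + (Y + Y)) + 1 ≤ X ^ G := by
    calc _ ≤ Y * (Y ^ D + (14 * t + 50 + (Y + Y ^ D + (Y + Y)))) + Y * (2 * t + 8 + (Y + Y)) := by
          have h1 : N * (Y ^ D + (6 * t + 30 + (Y + Y ^ D + (Y + Y))) + (2 * t + 8 + (Y + Y)) + 1) ≤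
              N * (Y ^ D + (14 * t + 50 + (Y + Y ^ D + (Y + Y))) + (2 * t + 8 + (Y + Y))) :=
            Nat.mul_le_mul_left _ (by lia)
          have h2 : (N + 1) * (Y ^ D + (14 * t + 50 + (Y + Y ^ D + (Y + Y))) +
              (2 * t + 8 + (Y + Y))) ≤ Y * (Y ^ D + (14 * t + 50 + (Y + Y ^ D + (Y + Y))) +
              (2 * t + 8 + (Y + Y))) := Nat.mul_le_mul_right _ hNY
          rw [Nat.succ_mul] at h2
          rw [← mul_add]
          lia
      _ = Y * ((Y ^ D + (14 * t + 50 + (Y + Y ^ D + (Y + Y)))) + (2 * t + 8 + (Y + Y))) := by ring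
      _ ≤ X ^ G := by
        rw [hG]
        refine (mul_bound hYE (add_bound hX (add_bound hX hYD (add_bound hX
          (const_bound hX (14 * t + 50)) (add_bound hX (add_bound hX hYE hYD)
          (add_bound hX hYE hYE)))) (add_bound hX (const_bound hX (2 * t + 8))
          (add_bound hX hYE hYE)))).trans (Nat.pow_le_pow_right (by lia) (by lia))
  have hbig : c₁ + (c₂ + (c₃ + (10 * t + 50 + (Y + X ^ G)))) ≤
      X ^ (A + (B + (C + (10 * t + 50 + (E + G + 1) + 1) + 1) + 1) + 1) :=
    add_bound hX hc₁ (add_bound hX hc₂ (add_bound hX hc₃ (add_bound hX (const_bound hX _)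
      (add_bound hX hYE le_rfl))))
  refine ⟨_, _, .seq hx₁ (.seq hx₂ (.seq hx₃ (.seq hx₄ (.seq hx₅ (.assign t (.reg (t + 1)) s₅))))),
    ?_, ?_, ?_, hmem, ?_⟩
  · refine le_trans ?_ hbig
    have h4 := size_le_self (F N)
    have h5 := hFY N
    simp only [Expr.cost, h1, hs0]
    lia
  · refine le_trans ?_ hbig
    have := hFY N
    change F N ≤ _
    lia
  · simp only [Function.update_self, Expr.eval, h1]
    rfl
  · intro r hr
    simp only [Function.update_of_ne hr.ne, hreg r hr]

/-- Every term is evaluated by its compiled program in polynomial time. -/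
theorem Tm.spec (e : Tm) : ∀ (ren : ℕ → ℕ) (t : ℕ), e.Spec ren t := by
  induction e with
  | lit k => exact Tm.spec_lit k
  | var v => exact Tm.spec_var v
  | load e ih => exact fun ren t => Tm.spec_load (ih ren t)
  | bin o e f ihe ihf => exact fun ren t => Tm.spec_bin o (ihe ren t) (ihf ren (t + 1))
  | ite c e f ihc ihe ihf => exact fun ren t => Tm.spec_ite (ihc ren t) (ihe ren t) (ihf ren t)
  | letIn v e b ihe ihb => exact fun ren t => Tm.spec_letIn v (ihe ren t) (ihb _ (t + 1))
  | fold v n i M b ihn ihi ihM ihb =>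
    exact fun ren t => Tm.spec_fold v (ihn ren t) (ihi ren (t + 1)) (ihM ren (t + 2))
      (ihb _ (t + 4))

end RAM

/-! ### Functions computed by terms -/

namespace RAM

/-- A context: an input array together with finitely many number variables. -/
class Ctx (α : Type) where
  inp : α → ℕ → ℕ
  depth : ℕ
  env : α → ℕ → ℕ

instance : Ctx (ℕ → ℕ) where
  inp x := x
  depth := 0
  env _ _ := 0

instance {α : Type} [Ctx α] : Ctx (α × ℕ) where
  inp x := Ctx.inp x.1
  depth := Ctx.depth α + 1
  env x v := if v < Ctx.depth α then Ctx.env x.1 v else x.2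

/-- `PC f` says that `f` is computed by a term. -/
def PC {α : Type} [Ctx α] (f : α → ℕ) : Prop :=
  ∃ e : Tm, ∀ (x : α) (ρ : ℕ → ℕ), (∀ v < Ctx.depth α, ρ v = Ctx.env x v) →
    e.eval (Ctx.inp x) ρ = f x

/-- `PCP P` says that the truth value of `P` is computed by a term. -/
def PCP {α : Type} [Ctx α] (P : α → Prop) : Prop :=
  ∃ f : α → ℕ, PC f ∧ ∀ x, P x ↔ f x ≠ 0

variable {α : Type} [Ctx α]

namespace PC

lemma congr {f g : α → ℕ} (hf : PC f) (h : ∀ x, g x = f x) : PC g := by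
  obtain ⟨e, he⟩ := hf
  exact ⟨e, fun x ρ hρ => by rw [he x ρ hρ, h x]⟩

lemma const (k : ℕ) : PC (fun _ : α => k) := ⟨.lit k, fun _ _ _ => rfl⟩

lemma wk {f : α → ℕ} (hf : PC f) : PC (fun x : α × ℕ => f x.1) := by
  obtain ⟨e, he⟩ := hf
  refine ⟨e, fun x ρ hρ => he x.1 ρ fun v hv => ?_⟩
  rw [hρ v (Nat.lt_succ_of_lt hv)]
  exact if_pos hv

lemma last : PC (fun x : α × ℕ => x.2) :=
  ⟨.var (Ctx.depth α), fun _ _ hρ => (hρ _ (Nat.lt_succ_self _)).trans (if_neg (lt_irrefl _))⟩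

lemma load {f : α → ℕ} (hf : PC f) : PC (fun x => Ctx.inp x (f x)) := by
  obtain ⟨e, he⟩ := hf
  exact ⟨.load e, fun x ρ hρ => by rw [Tm.eval, he x ρ hρ]⟩

lemma bin (o : Op) {f g : α → ℕ} (hf : PC f) (hg : PC g) : PC (fun x => o.fn (f x) (g x)) := by
  obtain ⟨e, he⟩ := hf
  obtain ⟨d, hd⟩ := hg
  exact ⟨.bin o e d, fun x ρ hρ => by rw [Tm.eval, he x ρ hρ, hd x ρ hρ]⟩

lemma add {f g : α → ℕ} (hf : PC f) (hg : PC g) : PC (fun x => f x + g x) := bin .add hf hg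

lemma sub {f g : α → ℕ} (hf : PC f) (hg : PC g) : PC (fun x => f x - g x) := bin .sub hf hg

lemma mul {f g : α → ℕ} (hf : PC f) (hg : PC g) : PC (fun x => f x * g x) := bin .mul hf hg

lemma div {f g : α → ℕ} (hf : PC f) (hg : PC g) : PC (fun x => f x / g x) := bin .div hf hg

lemma mod {f g : α → ℕ} (hf : PC f) (hg : PC g) : PC (fun x => f x % g x) := bin .mod hf hg

lemma ite {P : α → Prop} [DecidablePred P] {f g : α → ℕ} (hP : PCP P) (hf : PC f) (hg : PC g) :
    PC (fun x => if P x then f x else g x) := by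
  obtain ⟨c, ⟨b, hb⟩, hc⟩ := hP
  obtain ⟨e, he⟩ := hf
  obtain ⟨d, hd⟩ := hg
  refine ⟨.ite b e d, fun x ρ hρ => ?_⟩
  rw [Tm.eval, hb x ρ hρ, he x ρ hρ, hd x ρ hρ]
  simp only [hc x]

/-- Substitution for the last variable. -/
lemma subst {f : α × ℕ → ℕ} {g : α → ℕ} (hf : PC f) (hg : PC g) : PC (fun x => f (x, g x)) := by
  obtain ⟨e, he⟩ := hf
  obtain ⟨d, hd⟩ := hg
  refine ⟨.letIn (Ctx.depth α) d e, fun x ρ hρ => ?_⟩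
  rw [Tm.eval, hd x ρ hρ]
  refine he (x, g x) _ fun v hv => ?_
  have hv' : v < Ctx.depth α + 1 := hv
  change _ = if v < Ctx.depth α then Ctx.env x v else g x
  simp only [Function.update_apply]
  split_ifs <;> first | lia | rfl | exact hρ v ‹_›

/-- Weakening before the last variable. -/
lemma mid {f : α × ℕ → ℕ} (hf : PC f) : PC (fun x : (α × ℕ) × ℕ => f (x.1.1, x.2)) := by
  obtain ⟨e, he⟩ := hf
  obtain ⟨d, hd⟩ := last (α := α × ℕ)
  refine ⟨.letIn (Ctx.depth α) d e, fun x ρ hρ => ?_⟩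
  rw [Tm.eval, hd x ρ hρ]
  refine he (x.1.1, x.2) _ fun v hv => ?_
  have hv' : v < Ctx.depth α + 1 := hv
  change _ = if v < Ctx.depth α then Ctx.env x.1.1 v else x.2
  simp only [Function.update_apply]
  split_ifs with h1 h2 h2
  · lia
  · rfl
  · have h := hρ v (show v < Ctx.depth α + 1 + 1 by lia)
    rw [h]
    change (if v < Ctx.depth α + 1 then (if v < Ctx.depth α then Ctx.env x.1.1 v else x.1.2)
      else x.2) = _
    rw [if_pos hv', if_pos h2]
  · lia

/-- A recursion whose values stay below a computed bound. -/
lemma fold {F : α → ℕ → ℕ} {n i M : α → ℕ} {b : (α × ℕ) × ℕ → ℕ} (hn : PC n) (hi : PC i)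
    (hM : PC M) (hb : PC b) (h0 : ∀ x, F x 0 = i x)
    (hs : ∀ x j, F x (j + 1) = b ((x, j), F x j)) (hle : ∀ x j, F x (j + 1) ≤ M x) :
    PC (fun x => F x (n x)) := by
  obtain ⟨en, hen⟩ := hn
  obtain ⟨ei, hei⟩ := hi
  obtain ⟨eM, heM⟩ := hM
  obtain ⟨eb, heb⟩ := hb
  refine ⟨.fold (Ctx.depth α) en ei eM eb, fun x ρ hρ => ?_⟩
  rw [Tm.eval, hen x ρ hρ, hei x ρ hρ, heM x ρ hρ]
  change _ = F x (n x)
  generalize n x = k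
  induction k with
  | zero => exact (h0 x).symm
  | succ k ih =>
    simp only
    rw [ih]
    have h := heb ((x, k), F x k) (bind₂ ρ (Ctx.depth α) k (F x k)) (fun v hv => by
      have hv' : v < Ctx.depth α + 1 + 1 := hv
      change _ = if v < Ctx.depth α + 1 then (if v < Ctx.depth α then Ctx.env x v else k) else F x k
      simp only [bind₂, Function.update_apply]
      split_ifs <;> first | lia | rfl | exact hρ v ‹_›)
    have h' : Ctx.inp ((x, k), F x k) = Ctx.inp x := rfl
    rw [h'] at h
    rw [h, hs, Nat.mod_eq_of_lt]
    rw [← hs]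
    exact Nat.lt_succ_of_le (hle x k)

end PC

namespace PCP

lemma congr {P Q : α → Prop} (hP : PCP P) (h : ∀ x, Q x ↔ P x) : PCP Q := by
  obtain ⟨f, hf, hP⟩ := hP
  exact ⟨f, hf, fun x => (h x).trans (hP x)⟩

lemma wk {P : α → Prop} (hP : PCP P) : PCP (fun x : α × ℕ => P x.1) := by
  obtain ⟨f, hf, hP⟩ := hP
  exact ⟨_, hf.wk, fun x => hP x.1⟩

lemma lt {f g : α → ℕ} (hf : PC f) (hg : PC g) : PCP (fun x => f x < g x) :=
  ⟨_, hg.sub hf, fun x => by lia⟩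

lemma le {f g : α → ℕ} (hf : PC f) (hg : PC g) : PCP (fun x => f x ≤ g x) :=
  ⟨_, (hg.add (.const 1)).sub hf, fun x => by lia⟩

lemma and {P Q : α → Prop} (hP : PCP P) (hQ : PCP Q) : PCP (fun x => P x ∧ Q x) := by
  obtain ⟨f, hf, hP⟩ := hP
  obtain ⟨g, hg, hQ⟩ := hQ
  exact ⟨_, hf.mul hg, fun x => by simp only [hP, hQ, mul_ne_zero_iff]⟩

lemma or {P Q : α → Prop} (hP : PCP P) (hQ : PCP Q) : PCP (fun x => P x ∨ Q x) := by
  obtain ⟨f, hf, hP⟩ := hP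
  obtain ⟨g, hg, hQ⟩ := hQ
  exact ⟨_, hf.add hg, fun x => by simp only [hP, hQ]; lia⟩

lemma not {P : α → Prop} (hP : PCP P) : PCP (fun x => ¬ P x) := by
  obtain ⟨f, hf, hP⟩ := hP
  exact ⟨_, (PC.const 1).sub hf, fun x => by simp only [hP]; lia⟩

lemma eq {f g : α → ℕ} (hf : PC f) (hg : PC g) : PCP (fun x => f x = g x) :=
  ((le hf hg).and (le hg hf)).congr fun _ => le_antisymm_iff

lemma imp {P Q : α → Prop} (hP : PCP P) (hQ : PCP Q) : PCP (fun x => P x → Q x) :=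
  (hP.not.or hQ).congr fun _ => imp_iff_not_or

lemma ball {n : α → ℕ} {P : α → ℕ → Prop} (hn : PC n) (hP : PCP (fun x : α × ℕ => P x.1 x.2)) :
    PCP (fun x => ∀ i < n x, P x i) := by
  classical
  let F : α → ℕ → ℕ := fun x k => if ∀ i < k, P x i then 1 else 0
  refine ⟨fun x => F x (n x), PC.fold (i := fun _ => 1) (M := fun _ => 1)
    (b := fun y => if P y.1.1 y.1.2 ∧ y.2 ≠ 0 then 1 else 0) hn (.const 1) (.const 1)
    (.ite (hP.wk.and (eq .last (.const 0)).not) (.const 1) (.const 0)) ?_ ?_ ?_, ?_⟩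
  · intro x; simp [F]
  · intro x j
    simp only [F]
    by_cases h1 : ∀ i < j, P x i <;> by_cases h2 : P x j
    · rw [if_pos, if_pos ⟨h2, by simp [if_pos h1]⟩]
      intro i hi
      rcases Nat.lt_succ_iff_lt_or_eq.1 hi with h | rfl
      exacts [h1 i h, h2]
    · rw [if_neg fun h => h2 (h j (Nat.lt_succ_self j)), if_neg fun h => h2 h.1]
    · rw [if_neg fun h => h1 fun i hi => h i (Nat.lt_succ_of_lt hi),
        if_neg fun h => h.2 (if_neg h1)]
    · rw [if_neg fun h => h2 (h j (Nat.lt_succ_self j)), if_neg fun h => h2 h.1]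
  · intro x j; simp only [F]; split_ifs <;> simp
  · intro x; simp only [F]; split_ifs with h <;> simpa using h

end PCP

/-- The least `i < n` satisfying `P`, and `n` if there is none. -/
noncomputable def bfind (P : ℕ → Prop) (n : ℕ) : ℕ :=
  open Classical in Nat.rec (motive := fun _ => ℕ) 0 (fun j acc => if acc < j then acc
    else if P j then j else j + 1) n

open Classical in
lemma bfind_succ (P : ℕ → Prop) (n : ℕ) : bfind P (n + 1) =
    if bfind P n < n then bfind P n else if P n then n else n + 1 := by
  simp only [bfind]
  congr

lemma bfind_spec (P : ℕ → Prop) (n : ℕ) :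
    (bfind P n = n ∧ ∀ i < n, ¬ P i) ∨
      (bfind P n < n ∧ P (bfind P n) ∧ ∀ i < bfind P n, ¬ P i) := by
  classical
  induction n with
  | zero => left; exact ⟨rfl, by simp⟩
  | succ n ih =>
    rw [bfind_succ]
    rcases ih with ⟨h1, h2⟩ | ⟨h1, h2, h3⟩
    · rw [if_neg (by lia)]
      by_cases hP : P n
      · right; rw [if_pos hP]; exact ⟨by lia, hP, h2⟩
      · left; rw [if_neg hP]
        refine ⟨rfl, fun i hi => ?_⟩
        rcases Nat.lt_succ_iff_lt_or_eq.1 hi with h | rfl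
        exacts [h2 i h, hP]
    · right; rw [if_pos h1]; exact ⟨by lia, h2, h3⟩

lemma bfind_of_exists {P : ℕ → Prop} {n : ℕ} (h : ∃ i < n, P i) :
    bfind P n < n ∧ P (bfind P n) ∧ ∀ i < bfind P n, ¬ P i := by
  rcases bfind_spec P n with ⟨-, h2⟩ | h1
  · obtain ⟨i, hi, hP⟩ := h
    exact absurd hP (h2 i hi)
  · exact h1

namespace PC

lemma bfind {n : α → ℕ} {P : α → ℕ → Prop} (hn : PC n)
    (hP : PCP (fun x : α × ℕ => P x.1 x.2)) : PC (fun x => bfind (P x) (n x)) := by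
  classical
  -- The bound on the accumulator has to hold for all `j`, so that the recursion is stopped at `n`.
  let F : α → ℕ → ℕ := fun x j => RAM.bfind (P x) (min j (n x))
  have key : PC (fun x => F x (n x)) := by
    refine PC.fold (i := fun _ => 0) (M := n)
      (b := fun y => if n y.1.1 ≤ y.1.2 then y.2 else if y.2 < y.1.2 then y.2
        else if P y.1.1 y.1.2 then y.1.2 else y.1.2 + 1) hn (.const 0) hn
      (.ite (.le hn.wk.wk PC.last.wk) .last (.ite (.lt .last PC.last.wk) .last
        (.ite hP.wk PC.last.wk (PC.last.wk.add (.const 1))))) ?_ ?_ ?_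
    · intro x; simp [F, RAM.bfind]
    · intro x j
      simp only [F]
      by_cases h : n x ≤ j
      · rw [if_pos h, min_eq_right h, min_eq_right (by lia)]
      · rw [if_neg h, min_eq_left (by lia), min_eq_left (by lia), bfind_succ]
    · intro x j
      simp only [F]
      rcases bfind_spec (P x) (min (j + 1) (n x)) with h | h <;> lia
  exact key.congr fun x => by simp [F]

lemma shiftRight {f g : α → ℕ} (hf : PC f) (hg : PC g) : PC (fun x => f x / 2 ^ g x) := by
  refine PC.fold (F := fun x j => f x / 2 ^ j) (i := f) (M := f)
    (b := fun y => y.2 / 2) hg hf hf (PC.last.div (.const 2)) ?_ ?_ ?_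
  · intro x; simp
  · intro x j; simp only [pow_succ, Nat.div_div_eq_div_mul]
  · intro x j; exact Nat.div_le_self _ _

lemma clog {f : α → ℕ} (hf : PC f) : PC (fun x => Nat.clog 2 (f x)) := by
  refine (PC.bfind (P := fun x i => (f x - 1) / 2 ^ i = 0) (hf.add (.const 1)) (.eq
    (PC.shiftRight (hf.wk.sub (.const 1)) .last) (.const 0))).congr fun x => ?_
  have hP (i : ℕ) : (f x - 1) / 2 ^ i = 0 ↔ f x ≤ 2 ^ i := by
    have := Nat.one_le_two_pow (n := i)
    rw [Nat.div_eq_zero_iff_lt (by positivity)]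
    lia
  simp only [hP]
  obtain ⟨-, h2, h3⟩ := bfind_of_exists (P := fun i => f x ≤ 2 ^ i) (n := f x + 1)
    ⟨f x, Nat.lt_succ_self _, Nat.lt_two_pow_self.le⟩
  refine le_antisymm ((Nat.clog_le_iff_le_pow one_lt_two).2 h2) ?_
  by_contra h
  exact h3 _ (not_le.1 h) (Nat.le_pow_clog one_lt_two _)

/-- Powers of two, reduced modulo a positive number. -/
lemma two_pow_mod {f M : α → ℕ} (hf : PC f) (hM : PC M) :
    PC (fun x => 2 ^ f x % (M x + 1)) := by
  refine PC.fold (F := fun x j => 2 ^ j % (M x + 1)) (i := fun x => 1 % (M x + 1)) (M := M)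
    (b := fun y => y.2 * 2 % (M y.1.1 + 1)) hf ((PC.const 1).mod (hM.add (.const 1))) hM
    ((PC.last.mul (.const 2)).mod (hM.wk.wk.add (.const 1))) ?_ ?_ ?_
  · intro x; simp
  · intro x j; simp only [pow_succ]; rw [Nat.mod_mul_mod]
  · intro x j; exact Nat.le_of_lt_succ (Nat.mod_lt _ (Nat.succ_pos _))

lemma two_pow_clog {f : α → ℕ} (hf : PC f) : PC (fun x => 2 ^ Nat.clog 2 (f x)) := by
  refine (two_pow_mod hf.clog ((hf.mul (.const 2)).add (.const 1))).congr fun x => ?_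
  rw [Nat.mod_eq_of_lt]
  rcases Nat.lt_or_ge 1 (f x) with h | h
  · have h1 := Nat.pow_pred_clog_lt_self one_lt_two h
    have h2 := Nat.clog_pos one_lt_two h
    have h3 : 2 ^ Nat.clog 2 (f x) = 2 ^ (Nat.clog 2 (f x)).pred * 2 := by
      rw [← pow_succ, ← Nat.succ_eq_add_one, Nat.succ_pred_eq_of_pos h2]
    lia
  · rw [Nat.clog_of_right_le_one h]; simp

end PC

lemma PCP.prime {f : α → ℕ} (hf : PC f) : PCP (fun x => (f x).Prime) := by
  refine ((PCP.le (.const 2) hf).and (PCP.ball (P := fun x d => 2 ≤ d → f x % d ≠ 0) hf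
    (.imp (.le (.const 2) .last) (PCP.eq (hf.wk.mod .last) (.const 0)).not))).congr fun x => ?_
  rw [Nat.prime_def_lt']
  refine and_congr_right fun _ => forall_congr' fun d => ?_
  rw [Nat.dvd_iff_mod_eq_zero]
  tauto

/-! ### Residues of integer-valued functions -/

/-- `PCZ p f` says that the residue of the integer `f x` modulo `p x + 1` is computed by a term. The
shift makes the modulus positive. -/
def PCZ (p : α → ℕ) (f : α → ℤ) : Prop := PC (fun x => (f x % (p x + 1 : ℕ)).toNat)

namespace PCZ

variable {p : α → ℕ}

lemma of_nat {f : α → ℕ} (hp : PC p) (hf : PC f) : PCZ p (fun x => (f x : ℤ)) :=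
  (hf.mod (hp.add (.const 1))).congr fun x => by rw [← Int.natCast_mod, Int.toNat_natCast]

lemma congr {f g : α → ℤ} (hf : PCZ p f) (h : ∀ x, g x ≡ f x [ZMOD (p x + 1 : ℕ)]) : PCZ p g :=
  PC.congr hf fun x => by rw [(h x).eq]

lemma wk {f : α → ℤ} (hf : PCZ p f) : PCZ (fun x : α × ℕ => p x.1) (fun x => f x.1) :=
  PC.wk hf

lemma subst {p : α → ℕ} {f : α × ℕ → ℤ} {g : α → ℕ}
    (hf : PCZ (fun x : α × ℕ => p x.1) f) (hg : PC g) : PCZ p (fun x => f (x, g x)) :=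
  PC.subst hf hg

lemma mid {f : α × ℕ → ℤ} (hf : PCZ (fun x : α × ℕ => p x.1) f) :
    PCZ (fun x : (α × ℕ) × ℕ => p x.1.1) (fun x => f (x.1.1, x.2)) :=
  PC.mid hf

/-- The computed residue, as an integer. -/
lemma toNat_modEq (z : ℤ) (p : ℕ) : ((z % (p + 1 : ℕ)).toNat : ℤ) ≡ z [ZMOD (p + 1 : ℕ)] := by
  rw [Int.toNat_of_nonneg (Int.emod_nonneg _ (by positivity))]
  exact Int.mod_modEq _ _

lemma add {f g : α → ℤ} (hp : PC p) (hf : PCZ p f) (hg : PCZ p g) :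
    PCZ p (fun x => f x + g x) :=
  (of_nat hp (PC.add hf hg)).congr fun x => by
    push_cast
    exact ((toNat_modEq _ _).add (toNat_modEq _ _)).symm

lemma mul {f g : α → ℤ} (hp : PC p) (hf : PCZ p f) (hg : PCZ p g) :
    PCZ p (fun x => f x * g x) :=
  (of_nat hp (PC.mul hf hg)).congr fun x => by
    push_cast
    exact ((toNat_modEq _ _).mul (toNat_modEq _ _)).symm

lemma sub {f g : α → ℤ} (hp : PC p) (hf : PCZ p f) (hg : PCZ p g) :
    PCZ p (fun x => f x - g x) :=
  (add hp hf (mul hp (of_nat hp hp) hg)).congr fun x => by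
    have h : ((p x : ℕ) : ℤ) ≡ -1 [ZMOD (p x + 1 : ℕ)] := by
      rw [Int.modEq_iff_dvd]; exact ⟨-1, by push_cast; ring⟩
    have h2 := ((h.mul_right (g x)).add_left (f x)).symm
    rwa [neg_one_mul, ← sub_eq_add_neg] at h2

lemma ite {P : α → Prop} [DecidablePred P] {f g : α → ℤ} (hP : PCP P) (hf : PCZ p f)
    (hg : PCZ p g) : PCZ p (fun x => if P x then f x else g x) :=
  (PC.ite hP hf hg).congr fun x => by dsimp only; split_ifs <;> rfl

lemma fold {F : α → ℕ → ℤ} {n : α → ℕ} {c : α → ℤ} {b : α → ℕ → ℤ → ℤ} (hp : PC p) (hn : PC n)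
    (hc : PCZ p c) (hb : PCZ (fun x : (α × ℕ) × ℕ => p x.1.1) (fun x => b x.1.1 x.1.2 x.2))
    (h0 : ∀ x, F x 0 = c x) (hs : ∀ x j, F x (j + 1) = b x j (F x j))
    (hmod : ∀ x j y z, y ≡ z [ZMOD (p x + 1 : ℕ)] → b x j y ≡ b x j z [ZMOD (p x + 1 : ℕ)]) :
    PCZ p (fun x => F x (n x)) := by
  refine PC.fold (F := fun x j => (F x j % (p x + 1 : ℕ)).toNat) hn hc hp hb ?_ ?_ ?_
  · intro x; simp only [h0]
  · intro x j
    simp only [hs]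
    rw [(hmod x j _ _ (toNat_modEq (F x j) (p x))).eq]
  · intro x j
    have := Int.emod_lt_of_pos (F x (j + 1)) (b := (p x + 1 : ℕ)) (by positivity)
    lia

lemma sum {n : α → ℕ} {f : α → ℕ → ℤ} (hp : PC p) (hn : PC n)
    (hf : PCZ (fun x : α × ℕ => p x.1) (fun x => f x.1 x.2)) :
    PCZ p (fun x => ∑ i ∈ Finset.range (n x), f x i) :=
  fold (F := fun x j => ∑ i ∈ Finset.range j, f x i) (b := fun x j y => y + f x j) (c := fun _ => 0)
    hp hn (of_nat hp (.const 0)) (add hp.wk.wk (of_nat hp.wk.wk .last) hf.wk)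
    (fun x => by simp) (fun x j => Finset.sum_range_succ _ _)
    (fun x j y z h => h.add_right _)

lemma prod {n : α → ℕ} {f : α → ℕ → ℤ} (hp : PC p) (hn : PC n)
    (hf : PCZ (fun x : α × ℕ => p x.1) (fun x => f x.1 x.2)) :
    PCZ p (fun x => ∏ i ∈ Finset.range (n x), f x i) :=
  fold (F := fun x j => ∏ i ∈ Finset.range j, f x i) (b := fun x j y => y * f x j) (c := fun _ => 1)
    hp hn (of_nat hp (.const 1)) (mul hp.wk.wk (of_nat hp.wk.wk .last) hf.wk)
    (fun x => by simp) (fun x j => Finset.prod_range_succ _ _)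
    (fun x j y z h => h.mul_right _)

lemma two_pow {f : α → ℕ} (hp : PC p) (hf : PC f) : PCZ p (fun x => 2 ^ f x) :=
  (prod (f := fun _ _ => 2) hp hf (of_nat hp.wk (.const 2))).congr fun x => by simp

lemma modEq {f g : α → ℤ} (hf : PCZ p f) (hg : PCZ p g) :
    PCP (fun x => f x ≡ g x [ZMOD (p x + 1 : ℕ)]) :=
  (PCP.eq hf hg).congr fun x => by
    have h1 := Int.emod_nonneg (f x) (b := (p x + 1 : ℕ)) (by positivity)
    have h2 := Int.emod_nonneg (g x) (b := (p x + 1 : ℕ)) (by positivity)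
    rw [Int.ModEq]
    lia

end PCZ

/-! ### Programs from terms -/

lemma fits_initStore (l : List ℕ) : Fits l.length (fun i => l.getD i 0) (fun _ => l.length)
    (fun _ => 0) 1 (initStore l) where
  pos := one_pos
  ren_lt _ := one_pos
  len_eq := by simp [initStore]
  mem_eq i _ := rfl
  inp_eq i hi := List.getD_eq_default _ _ hi
  env_eq _ := by simp [initStore]

lemma getD_le {l : List ℕ} {X : ℕ} (h : ∀ x ∈ l, x ≤ X) (i : ℕ) : l.getD i 0 ≤ X := by
  rcases lt_or_ge i l.length with hi | hi
  · rw [List.getD_eq_getElem _ _ hi]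
    exact h _ (List.getElem_mem hi)
  · rw [List.getD_eq_default _ _ hi]
    exact Nat.zero_le _

/-- Values of computed functions are polynomially bounded. -/
lemma PC.exists_bound {f : (ℕ → ℕ) → ℕ} (hf : PC f) :
    ∃ C : ℕ, ∀ (X : ℕ) (l : List ℕ), 2 ≤ X → l.length ≤ X → (∀ x ∈ l, x ≤ X) →
      f (fun i => l.getD i 0) ≤ X ^ C := by
  obtain ⟨e, he⟩ := hf
  obtain ⟨C, hC⟩ := e.spec (fun _ => 0) 1
  refine ⟨C, fun X l hX hlen hl => ?_⟩
  obtain ⟨s', c, -, -, h, -⟩ := hC X l.length _ _ _ hX hlen (getD_le hl) (fun _ => hlen)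
    (fits_initStore l)
  rwa [← he _ (fun _ => l.length) (fun v hv => absurd hv (Nat.not_lt_zero v))]

/-- Lists whose length and entries are computed by terms are output by programs in polynomial
time. The list is first written behind the input, which the terms still have to read, and then
moved to the front. -/
theorem exists_program {g : (ℕ → ℕ) → ℕ} {h : (ℕ → ℕ) × ℕ → ℕ} (hg : PC g) (hh : PC h) :
    ∃ (p : Cmd) (C : ℕ), ∀ (X : ℕ) (inp out : List ℕ), 2 ≤ X → inp ≠ [] → inp.length ≤ X →
      (∀ x ∈ inp, x ≤ X) → out.length = g (fun i => inp.getD i 0) →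
      (∀ i : Fin out.length, out.get i = h (fun i => inp.getD i 0, i)) →
      ComputesWithin p inp out ((X : ℝ) ^ C) := by
  obtain ⟨eg, heg⟩ := hg
  obtain ⟨eh, heh⟩ := hh
  have heg' (x ρ : ℕ → ℕ) : eg.eval x ρ = g x := heg x ρ fun v hv => absurd hv (Nat.not_lt_zero v)
  have heh' (x ρ : ℕ → ℕ) : eh.eval x ρ = h (x, ρ 0) := heh (x, ρ 0) ρ fun v hv => by
    obtain rfl : v = 0 := Nat.lt_one_iff.1 hv
    rfl
  obtain ⟨A, hA⟩ := eg.spec (fun _ => 0) 1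
  obtain ⟨D, hD⟩ := eh.spec (fun v => if v = 0 then 2 else 0) 3
  obtain ⟨B, hB⟩ : ∃ B, B = (A + 1) * D := ⟨_, rfl⟩
  refine ⟨.seq (eg.compile (fun _ => 0) 1) (.seq (.assign 2 (.lit 0))
    (.seq (.loop (.sub (.reg 1) (.reg 2)) (.seq (eh.compile (fun v => if v = 0 then 2 else 0) 3)
      (.seq (.store (.add (.reg 0) (.reg 2)) (.reg 3)) (.assign 2 (.add (.reg 2) (.lit 1))))))
    (.seq (.assign 2 (.lit 0))
    (.seq (.loop (.sub (.reg 1) (.reg 2)) (.seq (.store (.reg 2) (.load (.add (.reg 0) (.reg 2))))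
      (.assign 2 (.add (.reg 2) (.lit 1)))))
    (.assign 0 (.reg 1)))))), 6 * A + 4 * B + 250, fun X inp out hX hne hlen hinp hout hget => ?_⟩
  have hlen0 : 0 < inp.length := List.length_pos_of_ne_nil hne
  obtain ⟨s₁, c₁, hx₁, hc₁, hv₁, ht₁, hm₁, hr₁⟩ := hA X inp.length _ _ _ hX hlen (getD_le hinp)
    (fun _ => hlen) (fits_initStore inp)
  have hf₁ := (fits_initStore inp).of_frame (Nat.le_succ 1) hr₁ hm₁
  rw [heg', ← hout] at hv₁ ht₁
  set L := out.length
  set len := inp.length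
  set f : ℕ → ℕ := fun i => inp.getD i 0 with hf
  set Y := X ^ (A + 1) with hY
  have hXY : X ≤ Y := Nat.le_self_pow (by lia) X
  have hLY : L ≤ Y := hv₁.trans (Nat.pow_le_pow_right (by lia) (Nat.le_succ A))
  have hlenY : len ≤ Y := hlen.trans hXY
  have hZ : Y ^ D = X ^ B := by rw [hY, hB, pow_mul]
  have hY2 : Y ≤ X ^ (A + 1) := le_rfl
  have hs1 : Nat.size 1 = 1 := Nat.size_one
  have hs0 : Nat.size 0 = 0 := Nat.size_zero
  have hs2 : Nat.size 2 = 2 := rfl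
  have hs3 : Nat.size 3 = 2 := rfl
  have htest (k : ℕ) (σ : Store) (h1 : σ.reg 1 = L) (h2 : σ.reg 2 = k) (hk : k ≤ L) :
      (Expr.sub (.reg 1) (.reg 2)).eval σ = L - k ∧
      (Expr.sub (.reg 1) (.reg 2)).cost σ ≤ 3 * Y + 10 := by
    refine ⟨by simp [Expr.eval, h1, h2], ?_⟩
    have h3 := size_le_self L
    have h4 := size_le_self k
    have h5 := size_le_self (L - k)
    simp only [Expr.cost, Expr.eval, h1, h2, hs1, hs2]
    lia
  -- The first loop writes the output behind the input.
  let I : ℕ → Store → Prop := fun k σ => k ≤ L ∧ σ.reg 0 = len ∧ σ.reg 1 = L ∧ σ.reg 2 = k ∧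
    (∀ i < len, σ.mem i = f i) ∧ ∀ i < k, σ.mem (len + i) = h (f, i)
  obtain ⟨s₂, c₂, hx₂, hc₂, hI₂⟩ := exec_loop (e := .sub (.reg 1) (.reg 2))
    (p := .seq (eh.compile (fun v => if v = 0 then 2 else 0) 3)
      (.seq (.store (.add (.reg 0) (.reg 2)) (.reg 3)) (.assign 2 (.add (.reg 2) (.lit 1))))) I L
    (2 * Y ^ D + 10 * Y + 40) (3 * Y + 10)
    (by
      rintro j hj σ ⟨hjL, h0, h1, h2, hmem, hmo⟩
      refine ⟨by rw [(htest j σ h1 h2 hjL).1]; lia, (htest j σ h1 h2 hjL).2, ?_⟩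
      have hfit : Fits len f (fun v => if v = 0 then j else len)
          (fun v => if v = 0 then 2 else 0) 3 σ := by
        refine ⟨by lia, fun v => by split_ifs <;> lia, h0, hmem,
          fun i hi => List.getD_eq_default _ _ hi, fun v => ?_⟩
        by_cases hv : v = 0 <;> simp [hv, h0, h2]
      obtain ⟨σ₁, d₁, hx, hd, hv, ht, hm, hr⟩ := hD Y len f _ σ (hX.trans hXY) hlenY
        (fun i => (getD_le hinp i).trans hXY) (fun v => by split_ifs <;> lia) hfit
      rw [heh'] at hv ht
      simp only [if_true] at hv ht
      have h0' := hr 0 (by lia)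
      have h1' := hr 1 (by lia)
      have h2' := hr 2 (by lia)
      rw [h0] at h0'
      rw [h1] at h1'
      rw [h2] at h2'
      refine ⟨_, _, .seq hx (.seq (.store _ _ _) (.assign _ _ _)), ?_, ?_⟩
      · have h3 := size_le_self (h (f, j))
        have h4 := size_le_self j
        have h5 := size_le_self (j + 1)
        have h6 := size_le_self len
        have h7 := size_le_self (len + j)
        simp only [Expr.cost, Expr.eval, h0', h2', ht, hs0, hs1, hs2, hs3]
        lia
      · refine ⟨by lia, by simpa using h0', by simpa using h1', by simp [Expr.eval, h2'],
          fun i hi => ?_, fun i hi => ?_⟩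
        · simp only [Expr.eval, h0', h2']
          rw [Function.update_of_ne (by lia), hm, hmem i hi]
        · simp only [Expr.eval, h0', h2', ht]
          rcases Nat.lt_succ_iff_lt_or_eq.1 hi with hi | rfl
          · rw [Function.update_of_ne (by lia), hm, hmo i hi]
          · rw [Function.update_self])
    (fun σ hσ => ⟨by rw [(htest L σ hσ.2.2.1 hσ.2.2.2.1 le_rfl).1]; lia,
      (htest L σ hσ.2.2.1 hσ.2.2.2.1 le_rfl).2⟩)
    { s₁ with reg := Function.update s₁.reg 2 0 }
    ⟨Nat.zero_le _, by simpa using hf₁.len_eq, by simpa using ht₁, by simp, hf₁.mem_eq,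
      fun i hi => absurd hi (Nat.not_lt_zero i)⟩
  obtain ⟨-, h0, h1, h2, -, hmo⟩ := hI₂
  have hvY (i : ℕ) (hi : i < L) : h (f, i) ≤ Y ^ D := by
    have hfit : Fits len f (fun v => if v = 0 then i else len)
        (fun v => if v = 0 then 2 else 0) 3
        { reg := fun r => if r = 2 then i else len, mem := f } := by
      refine ⟨by lia, fun v => by split_ifs <;> lia, rfl, fun _ _ => rfl,
        fun i hi => List.getD_eq_default _ _ hi, fun v => ?_⟩
      by_cases hv : v = 0 <;> simp [hv]
    obtain ⟨σ₁, d₁, -, -, hv, -⟩ := hD Y len f _ _ (hX.trans hXY) hlenY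
      (fun i => (getD_le hinp i).trans hXY) (fun v => by split_ifs <;> lia) hfit
    rwa [heh'] at hv
  -- The second loop moves the output to the front.
  let J : ℕ → Store → Prop := fun k σ => k ≤ L ∧ σ.reg 0 = len ∧ σ.reg 1 = L ∧ σ.reg 2 = k ∧
    (∀ i < k, σ.mem i = h (f, i)) ∧ ∀ i < L, k ≤ i → σ.mem (len + i) = h (f, i)
  obtain ⟨s₃, c₃, hx₃, hc₃, hJ₃⟩ := exec_loop (e := .sub (.reg 1) (.reg 2))
    (p := .seq (.store (.reg 2) (.load (.add (.reg 0) (.reg 2))))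
      (.assign 2 (.add (.reg 2) (.lit 1)))) J L
    (2 * Y ^ D + 10 * Y + 40) (3 * Y + 10)
    (by
      rintro j hj σ ⟨hjL, h0, h1, h2, hmo, hmem⟩
      refine ⟨by rw [(htest j σ h1 h2 hjL).1]; lia, (htest j σ h1 h2 hjL).2, ?_⟩
      refine ⟨_, _, .seq (.store _ _ _) (.assign _ _ _), ?_, ?_⟩
      · have h3 := size_le_self (h (f, j))
        have h4 := size_le_self j
        have h5 := size_le_self (j + 1)
        have h6 := size_le_self len
        have h7 := size_le_self (len + j)
        have h8 := hvY j hj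
        simp only [Expr.cost, Expr.eval, h0, h2, hmem j hj le_rfl, hs0, hs1, hs2]
        lia
      · refine ⟨by lia, by simpa using h0, by simpa using h1, by simp [Expr.eval, h2],
          fun i hi => ?_, fun i hi hji => ?_⟩
        · simp only [Expr.eval, h0, h2, hmem j hj le_rfl]
          rcases Nat.lt_succ_iff_lt_or_eq.1 hi with hi | rfl
          · rw [Function.update_of_ne (by lia), hmo i hi]
          · rw [Function.update_self]
        · simp only [Expr.eval, h0, h2, hmem j hj le_rfl]
          rw [Function.update_of_ne (by lia), hmem i hi (by lia)])
    (fun σ hσ => ⟨by rw [(htest L σ hσ.2.2.1 hσ.2.2.2.1 le_rfl).1]; lia,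
      (htest L σ hσ.2.2.1 hσ.2.2.2.1 le_rfl).2⟩)
    { s₂ with reg := Function.update s₂.reg 2 0 }
    ⟨Nat.zero_le _, by simpa using h0, by simpa using h1, by simp,
      fun i hi => absurd hi (Nat.not_lt_zero i), fun i hi _ => hmo i hi⟩
  obtain ⟨-, h0', h1', h2', hmo', -⟩ := hJ₃
  refine ⟨_, _, .seq hx₁ (.seq (.assign _ _ _) (.seq hx₂ (.seq (.assign _ _ _) (.seq hx₃
    (.assign _ _ _))))), ?_, ?_, ?_⟩
  · norm_cast
    have h3 := size_le_self L
    have hloop : L * (2 * Y ^ D + 10 * Y + 40 + (3 * Y + 10) + 1) ≤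
        Y * (2 * Y ^ D + 13 * Y + 51) := Nat.mul_le_mul hLY (by lia)
    have hbig : c₁ + (2 * (Y * (2 * Y ^ D + 13 * Y + 51)) + (7 * Y + 60)) ≤
        X ^ (6 * A + 4 * B + 250) := by
      rw [hZ]
      exact (add_bound hX hc₁ (add_bound hX (mul_bound (const_bound hX 2) (mul_bound hY2
        (add_bound hX (add_bound hX (mul_bound (const_bound hX 2) le_rfl)
        (mul_bound (const_bound hX 13) hY2)) (const_bound hX 51))))
        (add_bound hX (mul_bound (const_bound hX 7) hY2) (const_bound hX 60)))).trans
        (Nat.pow_le_pow_right (by lia) (by lia))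
    refine le_trans ?_ hbig
    simp only [Expr.cost, h1', hs0, hs1, hs2]
    lia
  · simp [Expr.eval, h1', L]
  · intro i
    rw [hget i]
    exact hmo' i i.2

end RAM

/-! ### Counting coin sequences -/

/-- If each of the rounds in `J` has at most `d` bad coin outcomes, which may depend on the earlier
rounds, then at most `d ^ #J * B ^ (n - #J)` of the `B ^ n` coin sequences are bad in all rounds of
`J`. -/
lemma card_bad_le {β : Type} [Fintype β] (d : ℕ) : ∀ (n : ℕ) (Bad : Fin n → (Fin n → β) → β → Prop)
    (_ : ∀ i c e, (∀ j, j < i → c j = e j) → Bad i c = Bad i e)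
    (_ : ∀ i c, Nat.card {x // Bad i c x} ≤ d) (J : Finset (Fin n)),
    Nat.card {c : Fin n → β // ∀ i ∈ J, Bad i c (c i)} * Fintype.card β ^ J.card ≤
      d ^ J.card * Fintype.card β ^ n := by
  classical
  intro n
  induction n with
  | zero =>
    intro Bad _ _ J
    have hJ : J = ∅ := Finset.eq_empty_of_isEmpty J
    subst hJ
    simp
  | succ n ih =>
    intro Bad hcausal hcard J
    set J' : Finset (Fin n) := Finset.univ.filter fun i => i.succ ∈ J with hJ'
    -- For a fixed first outcome, the induction hypothesis bounds the number of continuations.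
    have hih (x : β) : Nat.card {c : Fin n → β // ∀ i ∈ J', Bad i.succ (Fin.cons x c) (c i)} *
        Fintype.card β ^ J'.card ≤ d ^ J'.card * Fintype.card β ^ n := by
      refine ih (fun i c => Bad i.succ (Fin.cons x c)) (fun i c e h => hcausal _ _ _ fun j hj => ?_)
        (fun i c => hcard _ _) J'
      revert hj
      refine Fin.cases (fun _ => rfl) (fun j hj => ?_) j
      simpa only [Fin.cons_succ] using h j (Fin.succ_lt_succ_iff.1 hj)
    have hsplit : Nat.card {c : Fin (n + 1) → β // ∀ i ∈ J, Bad i c (c i)} =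
        ∑ x : β, Nat.card {c : Fin n → β // ∀ i ∈ J, Bad i (Fin.cons x c)
          ((Fin.cons x c : Fin (n + 1) → β) i)} := by
      rw [← Nat.card_sigma]
      refine Nat.card_congr
        { toFun := fun c => ⟨c.1 0, Fin.tail c.1, by
            have h := c.2
            rwa [← Fin.cons_self_tail c.1] at h⟩
          invFun := fun c => ⟨Fin.cons c.1 c.2.1, c.2.2⟩
          left_inv := fun c => Subtype.ext (Fin.cons_self_tail c.1)
          right_inv := fun c => rfl }
    have hcardJ : J.card = J'.card + if (0 : Fin (n + 1)) ∈ J then 1 else 0 := by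
      have h1 : J = J'.map (Fin.succEmb n) ∪ if (0 : Fin (n + 1)) ∈ J then {0} else ∅ := by
        ext i
        refine Fin.cases ?_ (fun i => ?_) i
        · split_ifs with h <;> simp [h, Fin.succ_ne_zero]
        · split_ifs with h <;> simp [hJ', Fin.succ_ne_zero]
      conv_lhs => rw [h1]
      rw [Finset.card_union_of_disjoint, Finset.card_map]
      · split_ifs <;> simp
      · split_ifs <;> simp [Finset.disjoint_singleton_right, Fin.succ_ne_zero]
    have hle (x : β) : Nat.card {c : Fin n → β // ∀ i ∈ J, Bad i (Fin.cons x c)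
        ((Fin.cons x c : Fin (n + 1) → β) i)} ≤
        Nat.card {c : Fin n → β // ∀ i ∈ J', Bad i.succ (Fin.cons x c) (c i)} := by
      refine Nat.card_le_card_of_injective (fun c => ⟨c.1, fun i hi => ?_⟩) ?_
      · simpa using c.2 i.succ (by simpa [hJ'] using hi)
      · intro c e h
        exact Subtype.ext (by simpa using h)
    rw [hsplit]
    by_cases h0 : (0 : Fin (n + 1)) ∈ J
    · -- Only the bad first outcomes have continuations.
      rw [if_pos h0] at hcardJ
      rcases isEmpty_or_nonempty (Fin (n + 1) → β) with hem | ⟨⟨c₀⟩⟩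
      · have : IsEmpty β := by
          by_contra hne
          rw [not_isEmpty_iff] at hne
          exact hem.false fun _ => hne.some
        simp
      set S := Finset.univ.filter fun x => Bad 0 c₀ x with hS
      have hSd : S.card ≤ d := by
        have := hcard 0 c₀
        rwa [Nat.card_eq_fintype_card, Fintype.card_subtype] at this
      have hzero (x : β) (hx : x ∉ S) : Nat.card {c : Fin n → β // ∀ i ∈ J, Bad i (Fin.cons x c)
          ((Fin.cons x c : Fin (n + 1) → β) i)} = 0 := by
        rw [Nat.card_eq_zero]
        left
        refine ⟨fun c => hx ?_⟩
        have h := c.2 0 h0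
        rw [Fin.cons_zero, hcausal 0 _ c₀ (fun j hj => absurd hj (Fin.not_lt_zero j))] at h
        simpa [hS] using h
      rw [← Finset.sum_subset (Finset.subset_univ S) (fun x _ hx => hzero x hx), hcardJ,
        Finset.sum_mul]
      calc _ ≤ ∑ x ∈ S, d ^ J'.card * Fintype.card β ^ n * Fintype.card β := by
            refine Finset.sum_le_sum fun x _ => ?_
            rw [pow_succ, ← mul_assoc]
            exact Nat.mul_le_mul_right _ ((Nat.mul_le_mul_right _ (hle x)).trans (hih x))
        _ = S.card * (d ^ J'.card * Fintype.card β ^ n * Fintype.card β) := by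
            rw [Finset.sum_const, smul_eq_mul]
        _ ≤ d * (d ^ J'.card * Fintype.card β ^ n * Fintype.card β) := Nat.mul_le_mul_right _ hSd
        _ = _ := by ring
    · rw [if_neg h0, add_zero] at hcardJ
      rw [hcardJ, Finset.sum_mul]
      calc _ ≤ ∑ x : β, d ^ J'.card * Fintype.card β ^ n :=
            Finset.sum_le_sum fun x _ => (Nat.mul_le_mul_right _ (hle x)).trans (hih x)
        _ = _ := by rw [Finset.sum_const, Finset.card_univ, smul_eq_mul]; ring

/-- Sequential repetition: there are `r` blocks of `R` rounds each. The coin sequences for which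
each block contains a bad round make up at most the fraction `(R d / B) ^ r`. -/
lemma card_all_blocks_bad_le {β : Type} [Fintype β] (d r R : ℕ)
    (Bad : Fin (r * R) → (Fin (r * R) → β) → β → Prop)
    (hcausal : ∀ i c e, (∀ j, j < i → c j = e j) → Bad i c = Bad i e)
    (hcard : ∀ i c, Nat.card {x // Bad i c x} ≤ d) :
    Nat.card {c : Fin (r * R) → β // ∀ q : Fin r, ∃ j : Fin R, Bad (finProdFinEquiv (q, j)) c
      (c (finProdFinEquiv (q, j)))} * Fintype.card β ^ r ≤
      (R * d) ^ r * Fintype.card β ^ (r * R) := by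
  classical
  set S : (Fin r → Fin R) → Finset (Fin (r * R) → β) := fun j =>
    Finset.univ.filter fun c => ∀ i ∈ Finset.univ.map ⟨fun q => finProdFinEquiv (q, j q),
      fun q q' h => (Prod.ext_iff.1 (finProdFinEquiv.injective h)).1⟩, Bad i c (c i) with hS
  have hSle (j : Fin r → Fin R) : (S j).card * Fintype.card β ^ r ≤
      d ^ r * Fintype.card β ^ (r * R) := by
    have h := card_bad_le d _ Bad hcausal hcard (Finset.univ.map ⟨fun q => finProdFinEquiv (q, j q),
      fun q q' h => (Prod.ext_iff.1 (finProdFinEquiv.injective h)).1⟩)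
    rwa [Nat.card_eq_fintype_card, Fintype.card_subtype, Finset.card_map, Finset.card_univ,
      Fintype.card_fin] at h
  have hunion : Nat.card {c : Fin (r * R) → β // ∀ q : Fin r, ∃ j : Fin R,
      Bad (finProdFinEquiv (q, j)) c (c (finProdFinEquiv (q, j)))} ≤ ∑ j, (S j).card := by
    rw [Nat.card_eq_fintype_card, Fintype.card_subtype]
    refine (Finset.card_le_card fun c hc => ?_).trans Finset.card_biUnion_le
    obtain ⟨j, hj⟩ := Classical.axiomOfChoice (Finset.mem_filter.1 hc).2
    rw [Finset.mem_biUnion]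
    refine ⟨j, Finset.mem_univ _, ?_⟩
    refine Finset.mem_filter.2 ⟨Finset.mem_univ _, fun i hi => ?_⟩
    obtain ⟨q, -, rfl⟩ := Finset.mem_map.1 hi
    exact hj q
  calc _ ≤ (∑ j, (S j).card) * Fintype.card β ^ r := Nat.mul_le_mul_right _ hunion
    _ = ∑ j, (S j).card * Fintype.card β ^ r := Finset.sum_mul _ _ _
    _ ≤ ∑ _j : Fin r → Fin R, d ^ r * Fintype.card β ^ (r * R) :=
        Finset.sum_le_sum fun j _ => hSle j
    _ = _ := by
        rw [Finset.sum_const, Finset.card_univ, Fintype.card_fun, Fintype.card_fin,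
          Fintype.card_fin, smul_eq_mul, mul_pow, mul_assoc]

/-! ### Rounds of the interactive proof -/

/-- How a round combines the values of a function at the two settings `0`, `1` of a coordinate:
by linear interpolation, by disjunction, or by conjunction. -/
inductive Kind where
  | lin | or | and

/-- The arithmetization of a kind. The first argument is the value of the coordinate, which matters
for interpolation only. -/
def Kind.comb {K : Type} [CommRing K] : Kind → K → K → K → K
  | lin, z, a, b => (1 - z) * a + z * b
  | or, _, a, b => a + b - a * b
  | and, _, a, b => a * b

section Rounds

variable {K : Type} [Field K] {R : ℕ} {kind : ℕ → Kind} {x : ℕ → ℕ}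
  {σ : ℕ → (ℕ → K) → ℕ → K} {f : ℕ → (ℕ → K) → K} {q : ℕ → (ℕ → K) → Polynomial K}
  {z : ℕ → ℕ → K} {c : ℕ → K} {g : ℕ → Polynomial K} {cl : ℕ → K}

/-- If Alice accepts a wrong initial claim, then in some round the coin is a root of the difference
between the polynomial sent by Merlin and the true polynomial. -/
lemma exists_bad_round
    (hf : ∀ j < R, ∀ y, f j y = (kind j).comb (y (x j)) ((q j y).eval 0) ((q j y).eval 1))
    (hq : ∀ j < R, ∀ y t, (q j y).eval t = f (j + 1) (σ j (Function.update y (x j) t)))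
    (hz : ∀ j < R, z (j + 1) = σ j (Function.update (z j) (x j) (c j)))
    (hcl : ∀ j < R, cl (j + 1) = (g j).eval (c j))
    (hcheck : ∀ j < R, (kind j).comb (z j (x j)) ((g j).eval 0) ((g j).eval 1) = cl j)
    (hfinal : f R (z R) = cl R) (hne : f 0 (z 0) ≠ cl 0) :
    ∃ j < R, c j ∈ (q j (z j) - g j).roots := by
  by_contra! hno
  have key : ∀ j ≤ R, f j (z j) ≠ cl j := by
    intro j
    induction j with
    | zero => exact fun _ => hne
    | succ j ih =>
      intro hj heq
      have hj' : j < R := hj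
      refine hno j hj' ?_
      rw [hz j hj', ← hq j hj', hcl j hj'] at heq
      rw [Polynomial.mem_roots', Polynomial.IsRoot.def, Polynomial.eval_sub, heq, sub_self]
      refine ⟨fun h0 => ih hj'.le ?_, rfl⟩
      rw [hf j hj', sub_eq_zero.1 h0, hcheck j hj']
  exact key R le_rfl hfinal

end Rounds

/-! ### Low-degree functions -/

section PolyDeg

open Polynomial

variable {K : Type} [Field K]

/-- `φ` is given by a polynomial of degree at most `d`. -/
def PolyDeg (d : ℕ) (φ : K → K) : Prop := ∃ q : K[X], q.natDegree ≤ d ∧ ∀ t, q.eval t = φ t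

namespace PolyDeg

lemma const (a : K) : PolyDeg 0 (fun _ => a) := ⟨C a, by simp, by simp⟩

lemma id : PolyDeg 1 (fun t : K => t) := ⟨X, natDegree_X_le, by simp⟩

lemma mono {d e : ℕ} {φ : K → K} (h : PolyDeg d φ) (hde : d ≤ e) : PolyDeg e φ := by
  obtain ⟨q, hq, h⟩ := h
  exact ⟨q, hq.trans hde, h⟩

lemma add {d : ℕ} {φ ψ : K → K} (hφ : PolyDeg d φ) (hψ : PolyDeg d ψ) :
    PolyDeg d (fun t => φ t + ψ t) := by
  obtain ⟨p, hp, h⟩ := hφ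
  obtain ⟨q, hq, h'⟩ := hψ
  exact ⟨p + q, (natDegree_add_le _ _).trans (max_le hp hq), fun t => by simp [h, h']⟩

lemma sub {d : ℕ} {φ ψ : K → K} (hφ : PolyDeg d φ) (hψ : PolyDeg d ψ) :
    PolyDeg d (fun t => φ t - ψ t) := by
  obtain ⟨p, hp, h⟩ := hφ
  obtain ⟨q, hq, h'⟩ := hψ
  exact ⟨p - q, (natDegree_sub_le _ _).trans (max_le hp hq), fun t => by simp [h, h']⟩

lemma mul {d e : ℕ} {φ ψ : K → K} (hφ : PolyDeg d φ) (hψ : PolyDeg e ψ) :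
    PolyDeg (d + e) (fun t => φ t * ψ t) := by
  obtain ⟨p, hp, h⟩ := hφ
  obtain ⟨q, hq, h'⟩ := hψ
  exact ⟨p * q, natDegree_mul_le.trans (add_le_add hp hq), fun t => by simp [h, h']⟩

end PolyDeg

/-- `g` is affine in the coordinate `x`. -/
def AffineAt (g : (ℕ → K) → K) (x : ℕ) : Prop := ∀ z s,
  g (Function.update z x s) =
    (1 - s) * g (Function.update z x 0) + s * g (Function.update z x 1)

/-- Restricting a multi-affine function to a curve along which the coordinates in `A` are affine
and the other ones are constant gives a polynomial of degree at most `#A`. -/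
lemma AffineAt.polyDeg_comp {g : (ℕ → K) → K} (A : Finset ℕ) :
    (∀ y ∈ A, AffineAt g y) → ∀ γ : K → ℕ → K, (∀ y ∈ A, PolyDeg 1 (fun t => γ t y)) →
    (∀ y, y ∉ A → ∀ t, γ t y = γ 0 y) → PolyDeg A.card (fun t => g (γ t)) := by
  classical
  induction A using Finset.induction_on with
  | empty =>
    intro _ γ _ hc
    have h (t : K) : γ t = γ 0 := funext fun y => hc y (Finset.notMem_empty y) t
    simp only [h]
    exact .const _
  | insert a A ha ih =>
    intro hg γ hγ hc
    have hsub (b : K) : PolyDeg A.card (fun t => g (Function.update (γ t) a b)) := by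
      refine ih (fun y hy => hg y (Finset.mem_insert_of_mem hy)) _ (fun y hy => ?_)
        (fun y hy t => ?_)
      · have hya : y ≠ a := fun h => ha (h ▸ hy)
        simpa only [Function.update_of_ne hya] using hγ y (Finset.mem_insert_of_mem hy)
      · by_cases hya : y = a
        · subst hya; simp
        · rw [Function.update_of_ne hya, Function.update_of_ne hya]
          exact hc y (fun h => (Finset.mem_insert.1 h).elim hya hy) t
    have h (t : K) : g (γ t) = (1 - γ t a) * g (Function.update (γ t) a 0) +
        γ t a * g (Function.update (γ t) a 1) := by
      conv_lhs => rw [← Function.update_eq_self a (γ t)]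
      exact hg a (Finset.mem_insert_self a A) (γ t) (γ t a)
    have h1 := hγ a (Finset.mem_insert_self a A)
    simp only [h, Finset.card_insert_of_notMem ha]
    rw [add_comm A.card 1]
    exact ((((PolyDeg.const 1).mono zero_le_one).sub h1).mul (hsub 0)).add (h1.mul (hsub 1))

lemma AffineAt.polyDeg {g : (ℕ → K) → K} {x : ℕ} (h : AffineAt g x) (z : ℕ → K) :
    PolyDeg 1 (fun t => g (Function.update z x t)) := by
  refine AffineAt.polyDeg_comp {x} (by simpa using h) _ (by simpa using PolyDeg.id) ?_
  intro y hy t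
  have : y ≠ x := by simpa using hy
  simp [this]

lemma polyDeg_update (z : ℕ → K) (x y : ℕ) :
    PolyDeg 1 (fun t => Function.update z x t y) := by
  by_cases h : y = x
  · subst h; simpa using PolyDeg.id
  · simpa [h] using (PolyDeg.const (z y)).mono zero_le_one

/-- Linearization in the coordinate `x`. -/
def linearize (x : ℕ) (g : (ℕ → K) → K) (z : ℕ → K) : K :=
  (1 - z x) * g (Function.update z x 0) + z x * g (Function.update z x 1)

lemma affineAt_linearize_self (x : ℕ) (g : (ℕ → K) → K) : AffineAt (linearize x g) x := by
  intro z s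
  simp only [linearize, Function.update_self, Function.update_idem]
  ring

lemma AffineAt.linearize {x y : ℕ} {g : (ℕ → K) → K} (hxy : y ≠ x) (h : AffineAt g y) :
    AffineAt (linearize x g) y := by
  intro z s
  simp only [_root_.linearize, Function.update_of_ne hxy.symm, Function.update_comm hxy, h _ s]
  ring

lemma PolyDeg.linearize {x y d : ℕ} {g : (ℕ → K) → K} (hxy : y ≠ x)
    (h : ∀ z, PolyDeg d (fun t => g (Function.update z y t))) (z : ℕ → K) :
    PolyDeg d (fun t => linearize x g (Function.update z y t)) := by
  simp only [_root_.linearize, Function.update_of_ne hxy.symm, Function.update_comm hxy]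
  simpa using ((PolyDeg.const (1 - z x)).mul (h _)).add ((PolyDeg.const (z x)).mul (h _))

/-- A chain of linearizations of a function of degree at most `d` in each coordinate: its members
have degree at most `d`, and the first one is multi-affine. -/
lemma linearize_chain {N d : ℕ} (hd : 1 ≤ d) {G : ℕ → (ℕ → K) → K}
    (hG : ∀ i < N, G i = linearize i (G (i + 1)))
    (hN : ∀ y < N, ∀ z, PolyDeg d (fun t => G N (Function.update z y t))) {i : ℕ} (hi : i ≤ N) :
    (∀ y < N, ∀ z, PolyDeg d (fun t => G i (Function.update z y t))) ∧
      ∀ y < N, i ≤ y → AffineAt (G i) y := by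
  refine Nat.decreasingInduction' (P := fun i =>
    (∀ y < N, ∀ z, PolyDeg d (fun t => G i (Function.update z y t))) ∧
      ∀ y < N, i ≤ y → AffineAt (G i) y) (fun k hk _ ih => ?_) hi ⟨hN, fun y hy hy' => by lia⟩
  rw [hG k hk]
  refine ⟨fun y hy z => ?_, fun y hy hky => ?_⟩
  · by_cases h : y = k
    · subst h; exact ((affineAt_linearize_self _ _).polyDeg z).mono hd
    · exact PolyDeg.linearize h (ih.1 y hy) z
  · rcases hky.eq_or_lt with rfl | h
    · exact affineAt_linearize_self _ _
    · exact (ih.2 y hy h).linearize (by lia)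

end PolyDeg

/-! ### The schedule of the protocol -/

section Schedule

variable (m D : ℕ)

/-- Number of variables of a stage: `w` (coordinates `0, …, m - 1`), the end points `u` and `v`
(the following `2 m` coordinates), and the bits of the layer index (the last `D` coordinates). -/
def numVars : ℕ := D + 3 * m

/-- Number of stages: for each of the `D` bits of the layer index, `m` disjunctions over the bits
of a middle node `w`, one conjunction over the two halves, and `m` selection stages. -/
def numStages : ℕ := D * (2 * m + 1)

/-- Each stage consists of one operation and a linearization in all variables. -/
def numRounds : ℕ := numStages m D * (numVars m D + 1)

/-- The kind of the operation of stage `t`. -/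
def opKind (t : ℕ) : Kind :=
  if t % (2 * m + 1) < m then .or else if t % (2 * m + 1) = m then .and else .lin

/-- The variable of the operation of stage `t`: a bit of `w`, or the bit of the layer index that
tells the two halves apart. -/
def opVar (t : ℕ) : ℕ :=
  if t % (2 * m + 1) < m then t % (2 * m + 1) else 3 * m + (D - 1 - t / (2 * m + 1))

variable {K : Type} [CommRing K]

/-- Selection of the `j`-th bits of the end points of a half: `(u, w)` for the first half and
`(w, v)` for the second half; the halves are told apart by the coordinate `h`. -/
def select (h j : ℕ) (z : ℕ → K) : ℕ → K :=
  Function.update (Function.update z (m + j) (z (m + j) + z h * (z j - z (m + j))))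
    (2 * m + j) (z j + z h * (z (2 * m + j) - z j))

/-- The substitution following the operation of stage `t`. -/
def opSubst (t : ℕ) (z : ℕ → K) : ℕ → K :=
  if m < t % (2 * m + 1) then select m (opVar m D t) (t % (2 * m + 1) - m - 1) z else z

/-- The kind of round `ρ`. -/
def roundKind (ρ : ℕ) : Kind :=
  if ρ % (numVars m D + 1) = 0 then opKind m (ρ / (numVars m D + 1)) else .lin

/-- The variable of round `ρ`. -/
def roundVar (ρ : ℕ) : ℕ :=
  if ρ % (numVars m D + 1) = 0 then opVar m D (ρ / (numVars m D + 1))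
  else ρ % (numVars m D + 1) - 1

/-- The substitution following round `ρ`. -/
def roundSubst (ρ : ℕ) (z : ℕ → K) : ℕ → K :=
  if ρ % (numVars m D + 1) = 0 then opSubst m D (ρ / (numVars m D + 1)) z else z

/-- The function about which claims are made when `n` rounds are left. -/
def remFn (base : (ℕ → K) → K) : ℕ → (ℕ → K) → K
  | 0 => base
  | n + 1 => fun z =>
    (roundKind m D (numRounds m D - 1 - n)).comb (z (roundVar m D (numRounds m D - 1 - n)))
      (remFn base n (roundSubst m D (numRounds m D - 1 - n)
        (Function.update z (roundVar m D (numRounds m D - 1 - n)) 0)))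
      (remFn base n (roundSubst m D (numRounds m D - 1 - n)
        (Function.update z (roundVar m D (numRounds m D - 1 - n)) 1)))

/-- The function about which a claim is made before round `ρ`. -/
def roundFn (base : (ℕ → K) → K) (ρ : ℕ) : (ℕ → K) → K := remFn m D base (numRounds m D - ρ)

lemma roundFn_of_lt (base : (ℕ → K) → K) {ρ : ℕ} (h : ρ < numRounds m D) (z : ℕ → K) :
    roundFn m D base ρ z = (roundKind m D ρ).comb (z (roundVar m D ρ))
      (roundFn m D base (ρ + 1) (roundSubst m D ρ (Function.update z (roundVar m D ρ) 0)))
      (roundFn m D base (ρ + 1) (roundSubst m D ρ (Function.update z (roundVar m D ρ) 1))) := by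
  obtain ⟨n, hn⟩ : ∃ n, numRounds m D - ρ = n + 1 := ⟨numRounds m D - ρ - 1, by lia⟩
  have h1 : numRounds m D - (ρ + 1) = n := by lia
  have h2 : numRounds m D - 1 - n = ρ := by lia
  rw [roundFn, roundFn, hn, h1, remFn, h2]

lemma roundFn_last (base : (ℕ → K) → K) : roundFn m D base (numRounds m D) = base := by
  rw [roundFn, Nat.sub_self, remFn]

/-! The rounds of a stage. -/

lemma round_lt {t i : ℕ} (ht : t < numStages m D) (hi : i < numVars m D + 1) :
    t * (numVars m D + 1) + i < numRounds m D := by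
  have h : (t + 1) * (numVars m D + 1) ≤ numRounds m D := Nat.mul_le_mul_right _ ht
  rw [Nat.succ_mul] at h
  lia

lemma round_div {t i : ℕ} (hi : i < numVars m D + 1) :
    (t * (numVars m D + 1) + i) / (numVars m D + 1) = t := by
  rw [add_comm, Nat.add_mul_div_right _ _ (Nat.succ_pos _), Nat.div_eq_of_lt hi, zero_add]

lemma round_mod {t i : ℕ} (hi : i < numVars m D + 1) :
    (t * (numVars m D + 1) + i) % (numVars m D + 1) = i := by
  rw [add_comm, Nat.add_mul_mod_self_right, Nat.mod_eq_of_lt hi]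

lemma roundFn_op (base : (ℕ → K) → K) {t : ℕ} (ht : t < numStages m D) (z : ℕ → K) :
    roundFn m D base (t * (numVars m D + 1)) z = (opKind m t).comb (z (opVar m D t))
      (roundFn m D base (t * (numVars m D + 1) + 1)
        (opSubst m D t (Function.update z (opVar m D t) 0)))
      (roundFn m D base (t * (numVars m D + 1) + 1)
        (opSubst m D t (Function.update z (opVar m D t) 1))) := by
  have h0 : (0 : ℕ) < numVars m D + 1 := Nat.succ_pos _
  have hdiv := round_div m D (t := t) h0
  have hmod := round_mod m D (t := t) h0
  have h := roundFn_of_lt m D base (round_lt m D ht h0) z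
  rw [add_zero] at hdiv hmod h
  simpa only [roundKind, roundVar, roundSubst, hdiv, hmod, if_true] using h

lemma roundFn_linearize {K : Type} [Field K] (base : (ℕ → K) → K) {t i : ℕ}
    (ht : t < numStages m D) (hi : i < numVars m D) :
    roundFn m D base (t * (numVars m D + 1) + (i + 1)) =
      linearize i (roundFn m D base (t * (numVars m D + 1) + (i + 1 + 1))) := by
  have h0 : i + 1 < numVars m D + 1 := Nat.succ_lt_succ hi
  ext z
  have h := roundFn_of_lt m D base (round_lt m D ht h0) z
  simp only [roundKind, roundVar, roundSubst, round_div m D h0, round_mod m D h0, Nat.succ_ne_zero,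
    if_false, Nat.add_sub_cancel] at h
  exact h

lemma opVar_lt {t : ℕ} (ht : t < numStages m D) : opVar m D t < numVars m D := by
  have hD : 0 < D := by
    rcases Nat.eq_zero_or_pos D with rfl | h
    · simp [numStages] at ht
    · exact h
  unfold opVar numVars
  split_ifs <;> lia

lemma opVar_of_lt_mod {t : ℕ} (ht : m < t % (2 * m + 1)) : 3 * m ≤ opVar m D t := by
  rw [opVar, if_neg (by lia)]
  lia

end Schedule

/-! ### Degrees -/

section Degree

variable {K : Type} [Field K] {m D : ℕ}

/-- The functions involved in the operation of a stage have degree at most three: the selection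
makes at most three coordinates vary, in an affine way. -/
lemma polyDeg_opSubst {g : (ℕ → K) → K} (hg : ∀ y < numVars m D, AffineAt g y) {t : ℕ}
    (ht : t < numStages m D) (z : ℕ → K) :
    PolyDeg 3 (fun s => g (opSubst m D t (Function.update z (opVar m D t) s))) := by
  have hx := opVar_lt m D ht
  by_cases hsel : m < t % (2 * m + 1)
  · simp only [opSubst, if_pos hsel]
    have h3 := opVar_of_lt_mod m D hsel
    have hlt := Nat.mod_lt t (Nat.succ_pos (2 * m))
    obtain ⟨j, hj⟩ : ∃ j, t % (2 * m + 1) - m - 1 = j := ⟨_, rfl⟩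
    have hjm : j < m := by lia
    rw [hj]
    set x := opVar m D t
    refine (AffineAt.polyDeg_comp {x, m + j, 2 * m + j} ?_ _ ?_ ?_).mono Finset.card_le_three
    · intro y hy
      refine hg y ?_
      simp only [Finset.mem_insert, Finset.mem_singleton] at hy
      unfold numVars at *
      lia
    · intro y _
      simp only [select, Function.update_self, Function.update_of_ne (show m + j ≠ x by lia),
        Function.update_of_ne (show j ≠ x by lia),
        Function.update_of_ne (show 2 * m + j ≠ x by lia)]
      simp only [Function.update_apply]
      have hc (a : K) : PolyDeg 1 (fun _ : K => a) := (PolyDeg.const a).mono zero_le_one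
      have hs (a : K) : PolyDeg 1 (fun t : K => t * a) := PolyDeg.id.mul (PolyDeg.const a)
      split_ifs
      exacts [(hc _).add (hs _), (hc _).add (hs _), PolyDeg.id, hc _]
    · intro y hy s
      simp only [Finset.mem_insert, Finset.mem_singleton, not_or] at hy
      simp [select, hy.1, hy.2.1, hy.2.2]
  · simp only [opSubst, if_neg hsel]
    exact ((hg _ hx).polyDeg z).mono (by lia)

/-- An operation leads from a multi-affine function to one of degree at most three in each
variable. -/
lemma polyDeg_op {g : (ℕ → K) → K} (hg : ∀ y < numVars m D, AffineAt g y) {t : ℕ} {y : ℕ}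
    (hy : y < numVars m D) (z : ℕ → K) :
    PolyDeg 3 (fun s => (opKind m t).comb (Function.update z y s (opVar m D t))
      (g (opSubst m D t (Function.update (Function.update z y s) (opVar m D t) 0)))
      (g (opSubst m D t (Function.update (Function.update z y s) (opVar m D t) 1)))) := by
  have hc (a : K) : PolyDeg 1 (fun _ : K => a) := (PolyDeg.const a).mono zero_le_one
  by_cases hyx : y = opVar m D t
  · simp only [← hyx, Function.update_idem, Function.update_self]
    generalize g (opSubst m D t (Function.update z y 0)) = a
    generalize g (opSubst m D t (Function.update z y 1)) = b
    refine PolyDeg.mono (d := 1) ?_ (by lia)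
    cases opKind m t
    · exact (((hc 1).sub .id).mul (.const a)).add (PolyDeg.id.mul (.const b))
    · exact hc _
    · exact hc _
  have hxy : opVar m D t ≠ y := Ne.symm hyx
  simp only [Function.update_of_ne hxy]
  by_cases hsel : m < t % (2 * m + 1)
  · have hkind : opKind m t = .lin := by
      rw [opKind, if_neg (by lia), if_neg (by lia)]
    rw [hkind]
    simp only [opSubst, if_pos hsel]
    have h3 := opVar_of_lt_mod m D hsel
    have hlt := Nat.mod_lt t (Nat.succ_pos (2 * m))
    obtain ⟨j, hj⟩ : ∃ j, t % (2 * m + 1) - m - 1 = j := ⟨_, rfl⟩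
    have hjm : j < m := by lia
    rw [hj]
    set x := opVar m D t
    have key (b : K) : PolyDeg 3
        (fun s => g (select m x j (Function.update (Function.update z y s) x b))) := by
      refine (AffineAt.polyDeg_comp {y, m + j, 2 * m + j} ?_ _ ?_ ?_).mono Finset.card_le_three
      · intro y' hy'
        refine hg y' ?_
        simp only [Finset.mem_insert, Finset.mem_singleton] at hy'
        unfold numVars at *
        lia
      · intro y' _
        have hu (i : ℕ) : PolyDeg 1
            (fun s => Function.update (Function.update z y s) x b i) := by
          by_cases hi : i = x
          · subst hi; simpa using hc b
          · simpa [hi] using polyDeg_update z y i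
        have hb (φ : K → K) (hφ : PolyDeg 1 φ) : PolyDeg 1 (fun s => b * φ s) := by
          simpa using (PolyDeg.const b).mul hφ
        simp only [select, Function.update_apply _ (2 * m + j), Function.update_apply _ (m + j),
          Function.update_self]
        split_ifs
        exacts [(hu _).add (hb _ ((hu _).sub (hu _))), (hu _).add (hb _ ((hu _).sub (hu _))), hu _]
      · intro y' hy' s
        simp only [Finset.mem_insert, Finset.mem_singleton, not_or] at hy'
        by_cases hi : y' = x
        · subst hi; simp [select, hy'.2.1, hy'.2.2]
        · simp [select, hy'.1, hy'.2.1, hy'.2.2, hi]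
    simpa [Kind.comb] using ((PolyDeg.const (1 - z x)).mul (key 0)).add
      ((PolyDeg.const (z x)).mul (key 1))
  · simp only [opSubst, if_neg hsel, Function.update_comm hyx]
    have h0 := (hg y hy).polyDeg (Function.update z (opVar m D t) 0)
    have h1 := (hg y hy).polyDeg (Function.update z (opVar m D t) 1)
    refine PolyDeg.mono (d := 2) ?_ (by lia)
    cases opKind m t
    · simpa [Kind.comb] using ((((PolyDeg.const (1 - z (opVar m D t))).mul h0).add
        ((PolyDeg.const (z (opVar m D t))).mul h1)).mono (show 0 + 1 ≤ 2 by lia))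
    · exact ((h0.add h1).mono one_le_two).sub (h0.mul h1)
    · exact h0.mul h1

variable {base : (ℕ → K) → K}

/-- At the beginning of each stage, the function of the claim has degree at most three in each
variable, since it results by one operation from a linearized function. -/
lemma polyDeg_stage (hbase : ∀ y < numVars m D, AffineAt base y) {t : ℕ}
    (ht : t ≤ numStages m D) : ∀ y < numVars m D, ∀ z,
      PolyDeg 3 (fun s => roundFn m D base (t * (numVars m D + 1)) (Function.update z y s)) := by
  refine Nat.decreasingInduction' (P := fun t => ∀ y < numVars m D, ∀ z,
      PolyDeg 3 (fun s => roundFn m D base (t * (numVars m D + 1)) (Function.update z y s)))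
    (fun k hk _ ih y hy z => ?_) ht ?_
  · have hN : ∀ y < numVars m D, ∀ z, PolyDeg 3 (fun s => roundFn m D base
        (k * (numVars m D + 1) + (numVars m D + 1)) (Function.update z y s)) := by
      simpa only [Nat.succ_mul] using ih
    have := (linearize_chain (by lia) (G := fun i => roundFn m D base
      (k * (numVars m D + 1) + (i + 1))) (fun i hi => roundFn_linearize m D base hk hi) hN
      (Nat.zero_le _)).2
    simp only [roundFn_op m D base hk]
    exact polyDeg_op (fun y hy => this y hy (Nat.zero_le _)) hy z
  · intro y hy z
    change PolyDeg 3 (fun s => roundFn m D base (numRounds m D) _)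
    rw [roundFn_last]
    exact ((hbase y hy).polyDeg z).mono (by lia)

/-- The polynomials to be sent by Merlin have degree at most three. -/
theorem polyDeg_round (hbase : ∀ y < numVars m D, AffineAt base y) {ρ : ℕ}
    (hρ : ρ < numRounds m D) (z : ℕ → K) : PolyDeg 3 (fun s =>
      roundFn m D base (ρ + 1) (roundSubst m D ρ (Function.update z (roundVar m D ρ) s))) := by
  obtain ⟨t, i, hi, rfl⟩ : ∃ t i, i < numVars m D + 1 ∧ ρ = t * (numVars m D + 1) + i :=
    ⟨ρ / (numVars m D + 1), ρ % (numVars m D + 1), Nat.mod_lt _ (Nat.succ_pos _), by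
      rw [mul_comm]; exact (Nat.div_add_mod _ _).symm⟩
  have ht : t < numStages m D := by
    by_contra h
    have := Nat.mul_le_mul_right (numVars m D + 1) (not_lt.1 h)
    unfold numRounds at hρ
    lia
  have hN : ∀ y < numVars m D, ∀ z, PolyDeg 3 (fun s => roundFn m D base
      (t * (numVars m D + 1) + (numVars m D + 1)) (Function.update z y s)) := by
    simpa only [Nat.succ_mul] using polyDeg_stage hbase ht
  have hchain := fun {i : ℕ} (hi : i ≤ numVars m D) => linearize_chain (by lia)
    (G := fun i => roundFn m D base (t * (numVars m D + 1) + (i + 1)))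
    (fun i hi => roundFn_linearize m D base ht hi) hN hi
  simp only [roundVar, roundSubst, round_div m D hi, round_mod m D hi]
  cases i with
  | zero =>
    simp only [if_true]
    exact polyDeg_opSubst (fun y hy => (hchain (Nat.zero_le _)).2 y hy (Nat.zero_le _)) ht z
  | succ i =>
    simp only [Nat.succ_ne_zero, if_false, Nat.add_sub_cancel]
    exact (hchain (i := i + 1) (by lia)).1 i (by lia) z

end Degree

/-! ### Multilinear extensions -/

section Multilinear

variable {K : Type} [CommRing K]

/-- The multilinear polynomial that indicates on Boolean points whether `y` lists the bits of
`i`. -/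
def bitsIndicator (n i : ℕ) (y : ℕ → K) : K :=
  ∏ b ∈ Finset.range n, if i / 2 ^ b % 2 = 1 then y b else 1 - y b

/-- The multilinear extension of the relation `G` between a layer index with `D` bits, and two nodes
with `m` bits. -/
def layerExt (m D : ℕ) (G : ℕ → ℕ → ℕ → K) (z : ℕ → K) : K :=
  ∑ i ∈ Finset.range (2 ^ D), ∑ u ∈ Finset.range (2 ^ m), ∑ v ∈ Finset.range (2 ^ m),
    bitsIndicator D i (fun b => z (3 * m + b)) * bitsIndicator m u (fun b => z (m + b)) *
      bitsIndicator m v (fun b => z (2 * m + b)) * G i u v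

/-- The multilinear extension is additive, which allows to split it between the parties. -/
lemma layerExt_add (m D : ℕ) (G H : ℕ → ℕ → ℕ → K) (z : ℕ → K) :
    layerExt m D (fun i u v => G i u v + H i u v) z = layerExt m D G z + layerExt m D H z := by
  simp only [layerExt, mul_add, Finset.sum_add_distrib]

lemma map_layerExt {L : Type} [CommRing L] (φ : K →+* L) (m D : ℕ) (G : ℕ → ℕ → ℕ → K)
    (z : ℕ → K) : φ (layerExt m D G z) =
      layerExt m D (fun i u v => φ (G i u v)) (fun x => φ (z x)) := by
  simp only [layerExt, bitsIndicator, map_sum, map_mul, map_prod, apply_ite φ, map_sub, map_one]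

/-- The number with the given binary digits. -/
def bitsNum (n : ℕ) (y : ℕ → Bool) : ℕ := ∑ b ∈ Finset.range n, (y b).toNat * 2 ^ b

lemma bitsNum_lt (n : ℕ) (y : ℕ → Bool) : bitsNum n y < 2 ^ n := by
  induction n with
  | zero => simp [bitsNum]
  | succ n ih =>
    rw [bitsNum, Finset.sum_range_succ, pow_succ]
    change bitsNum n y + _ < _
    cases y n <;> simp <;> lia

lemma bitsNum_succ (n : ℕ) (y : ℕ → Bool) :
    bitsNum (n + 1) y = 2 ^ n * (y n).toNat + bitsNum n y := by
  rw [bitsNum, Finset.sum_range_succ, add_comm, mul_comm]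
  rfl

lemma testBit_bitsNum {n : ℕ} (y : ℕ → Bool) {b : ℕ} (hb : b < n) :
    (bitsNum n y).testBit b = y b := by
  induction n with
  | zero => exact absurd hb (Nat.not_lt_zero b)
  | succ n ih =>
    rw [bitsNum_succ, Nat.testBit_two_pow_mul_add _ (bitsNum_lt n y)]
    split_ifs with h
    · exact ih h
    · obtain rfl : b = n := by lia
      cases h : y b <;> simp

lemma bitsNum_testBit {n i : ℕ} (hi : i < 2 ^ n) : bitsNum n (fun b => i.testBit b) = i := by
  refine Nat.eq_of_testBit_eq fun b => ?_
  by_cases hb : b < n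
  · exact testBit_bitsNum _ hb
  · have h2 : 2 ^ n ≤ 2 ^ b := Nat.pow_le_pow_right two_pos (not_lt.1 hb)
    rw [Nat.testBit_lt_two_pow ((bitsNum_lt n _).trans_le h2),
      Nat.testBit_lt_two_pow (hi.trans_le h2)]

lemma bitsNum_congr {n : ℕ} {y y' : ℕ → Bool} (h : ∀ b < n, y b = y' b) :
    bitsNum n y = bitsNum n y' :=
  Finset.sum_congr rfl fun b hb => by rw [h b (Finset.mem_range.1 hb)]

/-- A Boolean point. -/
def boolPt (y : ℕ → Bool) (x : ℕ) : K := if y x then 1 else 0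

lemma bitsIndicator_boolPt {n i : ℕ} (hi : i < 2 ^ n) (y : ℕ → Bool) :
    bitsIndicator n i (boolPt y : ℕ → K) = if i = bitsNum n y then 1 else 0 := by
  have hfac (b : ℕ) : (if i / 2 ^ b % 2 = 1 then boolPt y b else 1 - boolPt y b : K) =
      if i.testBit b = y b then 1 else 0 := by
    rw [Nat.testBit_eq_decide_div_mod_eq]
    unfold boolPt
    cases y b <;> by_cases h : i / 2 ^ b % 2 = 1 <;> simp [h]
  simp only [bitsIndicator, hfac]
  split_ifs with h
  · exact Finset.prod_eq_one fun b hb => by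
      rw [h, testBit_bitsNum y (Finset.mem_range.1 hb), if_pos rfl]
  · by_contra hne
    refine h ?_
    rw [← bitsNum_testBit hi]
    refine bitsNum_congr fun b hb => ?_
    by_contra hb'
    exact hne (Finset.prod_eq_zero (Finset.mem_range.2 hb) (if_neg hb'))

lemma layerExt_boolPt (m D : ℕ) (G : ℕ → ℕ → ℕ → K) (y : ℕ → Bool) :
    layerExt m D G (boolPt y) = G (bitsNum D fun b => y (3 * m + b))
      (bitsNum m fun b => y (m + b)) (bitsNum m fun b => y (2 * m + b)) := by
  have h (off : ℕ) : (fun b => (boolPt y (off + b) : K)) = boolPt fun b => y (off + b) := rfl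
  simp only [layerExt, h]
  rw [Finset.sum_eq_single_of_mem _ (Finset.mem_range.2 (bitsNum_lt D fun b => y (3 * m + b))),
    Finset.sum_eq_single_of_mem _ (Finset.mem_range.2 (bitsNum_lt m fun b => y (m + b))),
    Finset.sum_eq_single_of_mem _ (Finset.mem_range.2 (bitsNum_lt m fun b => y (2 * m + b)))]
  · rw [bitsIndicator_boolPt (bitsNum_lt _ _), bitsIndicator_boolPt (bitsNum_lt _ _),
      bitsIndicator_boolPt (bitsNum_lt _ _)]
    simp
  · intro v hv hne
    rw [bitsIndicator_boolPt (Finset.mem_range.1 hv), if_neg hne]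
    simp
  · intro u hu hne
    refine Finset.sum_eq_zero fun v _ => ?_
    rw [bitsIndicator_boolPt (Finset.mem_range.1 hu), if_neg hne]
    simp
  · intro i hi hne
    refine Finset.sum_eq_zero fun u _ => Finset.sum_eq_zero fun v _ => ?_
    rw [bitsIndicator_boolPt (Finset.mem_range.1 hi), if_neg hne]
    simp

end Multilinear

section Affine

variable {K : Type} [Field K]

lemma AffineAt.sum {ι : Type} {s : Finset ι} {g : ι → (ℕ → K) → K} {x : ℕ}
    (h : ∀ i ∈ s, AffineAt (g i) x) : AffineAt (fun z => ∑ i ∈ s, g i z) x := by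
  intro z t
  simp only [Finset.mul_sum, ← Finset.sum_add_distrib]
  exact Finset.sum_congr rfl fun i hi => h i hi z t

lemma AffineAt.mul_indep {g k : (ℕ → K) → K} {x : ℕ} (h : AffineAt g x)
    (hk : ∀ z s, k (Function.update z x s) = k z) : AffineAt (fun z => g z * k z) x := by
  intro z t
  simp only [hk, h z t]
  ring

lemma bitsIndicator_indep {n i off x : ℕ} (hx : x < off ∨ off + n ≤ x) (z : ℕ → K) (s : K) :
    bitsIndicator n i (fun b => Function.update z x s (off + b)) =
      bitsIndicator n i (fun b => z (off + b)) := by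
  refine Finset.prod_congr rfl fun b hb => ?_
  have hb := Finset.mem_range.1 hb
  dsimp only
  rw [Function.update_of_ne (by lia)]

lemma affineAt_bitsIndicator (n i off x : ℕ) :
    AffineAt (fun z : ℕ → K => bitsIndicator n i (fun b => z (off + b))) x := by
  by_cases hx : x < off ∨ off + n ≤ x
  · intro z s
    simp only [bitsIndicator_indep hx]
    ring
  · obtain ⟨b₀, rfl⟩ : ∃ b₀, x = off + b₀ := ⟨x - off, by lia⟩
    have hb₀ : b₀ ∈ Finset.range n := Finset.mem_range.2 (by lia)
    have h : (fun z : ℕ → K => bitsIndicator n i (fun b => z (off + b))) = fun z =>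
        (if i / 2 ^ b₀ % 2 = 1 then z (off + b₀) else 1 - z (off + b₀)) *
        ∏ b ∈ (Finset.range n).erase b₀,
          if i / 2 ^ b % 2 = 1 then z (off + b) else 1 - z (off + b) := by
      ext z
      exact (Finset.mul_prod_erase _ _ hb₀).symm
    rw [h]
    refine AffineAt.mul_indep (fun z s => ?_) fun z s => ?_
    · simp only [Function.update_self]
      split_ifs <;> ring
    · refine Finset.prod_congr rfl fun b hb => ?_
      rw [Function.update_of_ne (by have := Finset.ne_of_mem_erase hb; lia)]

lemma affineAt_layerExt (m D : ℕ) (G : ℕ → ℕ → ℕ → K) (x : ℕ) : AffineAt (layerExt m D G) x := by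
  refine AffineAt.sum fun i _ => AffineAt.sum fun u _ => AffineAt.sum fun v _ => ?_
  refine AffineAt.mul_indep ?_ fun _ _ => rfl
  have e1 := affineAt_bitsIndicator (K := K) D i (3 * m) x
  have e2 := affineAt_bitsIndicator (K := K) m u m x
  have e3 := affineAt_bitsIndicator (K := K) m v (2 * m) x
  -- The three groups of coordinates are disjoint: only one factor depends on `x`.
  rcases lt_or_ge x (3 * m) with h1 | h1
  · have i1 (z s) := bitsIndicator_indep (K := K) (n := D) (i := i) (Or.inl h1) z s
    rcases lt_or_ge x (2 * m) with h2 | h2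
    · have i3 (z s) := bitsIndicator_indep (K := K) (n := m) (i := v) (Or.inl h2) z s
      refine AffineAt.mul_indep ?_ i3
      simpa only [mul_comm] using e2.mul_indep
        (k := fun z => bitsIndicator D i fun b => z (3 * m + b)) i1
    · have i2 (z s) := bitsIndicator_indep (K := K) (n := m) (i := u) (off := m) (x := x)
        (Or.inr (by lia)) z s
      simpa only [mul_comm] using e3.mul_indep (k := fun z =>
        bitsIndicator D i (fun b => z (3 * m + b)) * bitsIndicator m u (fun b => z (m + b)))
        fun z s => by rw [i1, i2]
  · exact (e1.mul_indep fun z s => bitsIndicator_indep (Or.inr (by lia)) z s).mul_indep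
      fun z s => bitsIndicator_indep (Or.inr (by lia)) z s

end Affine

/-! ### Walks through the layers -/

/-- There is a walk of `n` steps from the node `u` of layer `i` to the node `v` of layer `i + n`. -/
def Walk (G : ℕ → ℕ → ℕ → Prop) (i n u v : ℕ) : Prop :=
  ∃ f : ℕ → ℕ, f 0 = u ∧ f n = v ∧ ∀ j < n, G (i + j) (f j) (f (j + 1))

lemma walk_one {G : ℕ → ℕ → ℕ → Prop} {i u v : ℕ} : Walk G i 1 u v ↔ G i u v := by
  constructor
  · rintro ⟨f, rfl, rfl, h⟩
    exact h 0 one_pos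
  · intro h
    refine ⟨fun j => if j = 0 then u else v, rfl, rfl, fun j hj => ?_⟩
    obtain rfl : j = 0 := by lia
    simpa using h

lemma walk_add {G : ℕ → ℕ → ℕ → Prop} {i n n' u v : ℕ} :
    Walk G i (n + n') u v ↔ ∃ w, Walk G i n u w ∧ Walk G (i + n) n' w v := by
  constructor
  · rintro ⟨f, h0, h1, h⟩
    refine ⟨f n, ⟨f, h0, rfl, fun j hj => h j (by lia)⟩, fun j => f (n + j), rfl, h1,
      fun j hj => ?_⟩
    simpa only [add_assoc] using h (n + j) (by lia)
  · rintro ⟨w, ⟨f, hf0, hf1, hf⟩, f', hf0', hf1', hf'⟩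
    refine ⟨fun j => if j ≤ n then f j else f' (j - n), by simpa using hf0, ?_, fun j hj => ?_⟩
    all_goals dsimp only
    · by_cases hn : n' = 0
      · subst hn
        simp [hf1, ← hf0', hf1']
      · rw [if_neg (show ¬ n + n' ≤ n by lia), Nat.add_sub_cancel_left, hf1']
    · rcases lt_trichotomy j n with hlt | rfl | hgt
      · rw [if_pos hlt.le, if_pos (show j + 1 ≤ n from hlt)]
        exact hf j hlt
      · rw [if_pos le_rfl, if_neg (show ¬ j + 1 ≤ j by lia), Nat.add_sub_cancel_left, hf1, ← hf0']
        simpa using hf' 0 (by lia)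
      · have h := hf' (j - n) (by lia)
        have e1 : i + n + (j - n) = i + j := by lia
        have e2 : j + 1 - n = j - n + 1 := by lia
        rw [if_neg (show ¬ j ≤ n by lia), if_neg (show ¬ j + 1 ≤ n by lia), e2, ← e1]
        exact h

lemma Walk.last_lt {G : ℕ → ℕ → ℕ → Prop} {B i n u v : ℕ} (hG : ∀ i u v, G i u v → v < B)
    (hn : 0 < n) (h : Walk G i n u v) : v < B := by
  obtain ⟨f, -, rfl, hf⟩ := h
  have := hG _ _ _ (hf (n - 1) (by lia))
  rwa [Nat.sub_add_cancel hn] at this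

/-- A walk through padding layers stays at its node. -/
lemma walk_padding {G : ℕ → ℕ → ℕ → Prop} {i n u v W : ℕ}
    (hG : ∀ j, i ≤ j → ∀ u v, G j u v ↔ u < W ∧ u = v) (hu : u < W) :
    Walk G i n u v ↔ u = v := by
  constructor
  · rintro ⟨f, rfl, rfl, hf⟩
    have h : ∀ j ≤ n, f 0 = f j := by
      intro j
      induction j with
      | zero => exact fun _ => rfl
      | succ j ih =>
        intro hj
        rw [ih (by lia)]
        exact ((hG _ (by lia) _ _).1 (hf j hj)).2
    exact h n le_rfl
  · rintro rfl
    exact ⟨fun _ => u, rfl, rfl, fun j _ => (hG _ (by lia) _ _).2 ⟨hu, rfl⟩⟩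

/-! ### Boolean values of the claimed functions -/

section Semantics

variable {K : Type} [Field K] {m D : ℕ}

lemma update_boolPt (y : ℕ → Bool) (x : ℕ) (c : Bool) :
    Function.update (boolPt y : ℕ → K) x (if c then 1 else 0) =
      boolPt (Function.update y x c) := by
  ext x'
  by_cases h : x' = x
  · subst h; simp [boolPt]
  · simp [boolPt, h]

lemma linearize_boolPt (x : ℕ) (g : (ℕ → K) → K) (y : ℕ → Bool) :
    linearize x g (boolPt y) = g (boolPt y) := by
  have h0 := update_boolPt (K := K) y x false
  have h1 := update_boolPt (K := K) y x true
  have h := Function.update_eq_self x y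
  have hb : (boolPt y x : K) = if y x then 1 else 0 := rfl
  rw [linearize, hb]
  cases hx : y x <;> rw [hx] at h
  · rw [h] at h0
    simpa using congrArg g h0
  · rw [h] at h1
    simpa using congrArg g h1

/-- The Boolean version of `select`. -/
def selectBool (m h j : ℕ) (y : ℕ → Bool) : ℕ → Bool :=
  Function.update (Function.update y (m + j) (if y h then y j else y (m + j)))
    (2 * m + j) (if y h then y (2 * m + j) else y j)

lemma select_boolPt (h j : ℕ) (y : ℕ → Bool) :
    select m h j (boolPt y : ℕ → K) = boolPt (selectBool m h j y) := by
  rw [select, selectBool, ← update_boolPt, ← update_boolPt]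
  congr 1
  · congr 1
    simp only [boolPt]
    cases y h <;> simp
  · simp only [boolPt]
    cases y h <;> simp

lemma opSubst_boolPt (t : ℕ) (y : ℕ → Bool) : opSubst m D t (boolPt y : ℕ → K) =
    boolPt (if m < t % (2 * m + 1) then
      selectBool m (opVar m D t) (t % (2 * m + 1) - m - 1) y else y) := by
  rw [opSubst]
  split_ifs
  · exact select_boolPt _ _ _
  · rfl

variable {base : (ℕ → K) → K}

/-- The linearizations of a stage do not change Boolean values. -/
lemma roundFn_linearize_boolPt {t : ℕ} (ht : t < numStages m D) (y : ℕ → Bool) :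
    roundFn m D base (t * (numVars m D + 1) + 1) (boolPt y) =
      roundFn m D base ((t + 1) * (numVars m D + 1)) (boolPt y) := by
  have h : ∀ i ≤ numVars m D, roundFn m D base (t * (numVars m D + 1) + 1) (boolPt y) =
      roundFn m D base (t * (numVars m D + 1) + (i + 1)) (boolPt y) := by
    intro i
    induction i with
    | zero => exact fun _ => rfl
    | succ i ih =>
      intro hi
      rw [ih (by lia), roundFn_linearize m D base ht hi, linearize_boolPt]
  rw [h _ le_rfl, Nat.succ_mul]

/-- Truth of the claim before stage `t` at a Boolean point. -/
def StageTrue (m D : ℕ) (base : (ℕ → K) → K) (t : ℕ) (y : ℕ → Bool) : Prop :=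
  roundFn m D base (t * (numVars m D + 1)) (boolPt y) = 1

lemma roundFn_boolPt_op {t : ℕ} (ht : t < numStages m D) (y : ℕ → Bool) :
    roundFn m D base (t * (numVars m D + 1)) (boolPt y) =
      (opKind m t).comb (boolPt y (opVar m D t))
        (roundFn m D base ((t + 1) * (numVars m D + 1)) (opSubst m D t (boolPt
          (Function.update y (opVar m D t) false))))
        (roundFn m D base ((t + 1) * (numVars m D + 1)) (opSubst m D t (boolPt
          (Function.update y (opVar m D t) true)))) := by
  have h0 := update_boolPt (K := K) y (opVar m D t) false
  have h1 := update_boolPt (K := K) y (opVar m D t) true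
  simp only [if_true, Bool.false_eq_true, if_false] at h0 h1
  rw [roundFn_op m D base ht, h0, h1, opSubst_boolPt, opSubst_boolPt, roundFn_linearize_boolPt ht,
    roundFn_linearize_boolPt ht]

/-- At Boolean points all values are `0` or `1`. -/
lemma roundFn_boolPt_mem (hbase : ∀ y : ℕ → Bool, base (boolPt y) = 0 ∨ base (boolPt y) = 1)
    {t : ℕ} (ht : t ≤ numStages m D) : ∀ y : ℕ → Bool,
      roundFn m D base (t * (numVars m D + 1)) (boolPt y) = 0 ∨
      roundFn m D base (t * (numVars m D + 1)) (boolPt y) = 1 := by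
  refine Nat.decreasingInduction' (P := fun t => ∀ y : ℕ → Bool,
      roundFn m D base (t * (numVars m D + 1)) (boolPt y) = 0 ∨
      roundFn m D base (t * (numVars m D + 1)) (boolPt y) = 1) (fun k hk _ ih y => ?_) ht ?_
  · rw [roundFn_boolPt_op hk, opSubst_boolPt, opSubst_boolPt]
    have hy : (boolPt y (opVar m D k) : K) = 0 ∨ (boolPt y (opVar m D k) : K) = 1 := by
      rw [boolPt]; split_ifs <;> simp
    generalize (boolPt y (opVar m D k) : K) = b at hy
    generalize hA : roundFn m D base ((k + 1) * (numVars m D + 1)) (boolPt _) = A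
    have hA' := hA ▸ ih _
    generalize hB : roundFn m D base ((k + 1) * (numVars m D + 1)) (boolPt _) = B
    have hB' := hB ▸ ih _
    rcases hy with rfl | rfl <;> rcases hA' with rfl | rfl <;> rcases hB' with rfl | rfl <;>
      cases opKind m k <;> simp [Kind.comb]
  · intro y
    change roundFn m D base (numRounds m D) _ = 0 ∨ roundFn m D base (numRounds m D) _ = 1
    rw [roundFn_last]
    exact hbase y

lemma stageTrue_or (hbase : ∀ y : ℕ → Bool, base (boolPt y) = 0 ∨ base (boolPt y) = 1)
    {t : ℕ} (ht : t < numStages m D) (hm : t % (2 * m + 1) < m) (y : ℕ → Bool) :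
    StageTrue m D base t y ↔
      StageTrue m D base (t + 1) (Function.update y (t % (2 * m + 1)) false) ∨
      StageTrue m D base (t + 1) (Function.update y (t % (2 * m + 1)) true) := by
  have hk : opKind m t = .or := by rw [opKind, if_pos hm]
  have hv : opVar m D t = t % (2 * m + 1) := by rw [opVar, if_pos hm]
  have hn : ¬ m < t % (2 * m + 1) := by lia
  rw [StageTrue, StageTrue, StageTrue, roundFn_boolPt_op ht, opSubst_boolPt, opSubst_boolPt, hk, hv,
    if_neg hn, if_neg hn]
  rcases roundFn_boolPt_mem hbase (t := t + 1) ht (Function.update y (t % (2 * m + 1)) false)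
    with h0 | h0 <;>
  rcases roundFn_boolPt_mem hbase (t := t + 1) ht (Function.update y (t % (2 * m + 1)) true)
    with h1 | h1 <;> simp [h0, h1, Kind.comb]

lemma stageTrue_and (hbase : ∀ y : ℕ → Bool, base (boolPt y) = 0 ∨ base (boolPt y) = 1)
    {t : ℕ} (ht : t < numStages m D) (hm : t % (2 * m + 1) = m) (y : ℕ → Bool) :
    StageTrue m D base t y ↔
      ∀ c, StageTrue m D base (t + 1) (Function.update y (opVar m D t) c) := by
  have hk : opKind m t = .and := by rw [opKind, if_neg (by lia), if_pos hm]
  have hn : ¬ m < t % (2 * m + 1) := by lia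
  rw [Bool.forall_bool, StageTrue, StageTrue, StageTrue, roundFn_boolPt_op ht, opSubst_boolPt,
    opSubst_boolPt, hk, if_neg hn, if_neg hn]
  rcases roundFn_boolPt_mem hbase (t := t + 1) ht (Function.update y (opVar m D t) false)
    with h0 | h0 <;>
  rcases roundFn_boolPt_mem hbase (t := t + 1) ht (Function.update y (opVar m D t) true)
    with h1 | h1 <;> simp [h0, h1, Kind.comb]

lemma stageTrue_select {t : ℕ} (ht : t < numStages m D) (hm : m < t % (2 * m + 1))
    (y : ℕ → Bool) : StageTrue m D base t y ↔ StageTrue m D base (t + 1)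
      (selectBool m (opVar m D t) (t % (2 * m + 1) - m - 1) y) := by
  have hk : opKind m t = .lin := by rw [opKind, if_neg (by lia), if_neg (by lia)]
  have h := Function.update_eq_self (opVar m D t) y
  rw [StageTrue, StageTrue, roundFn_boolPt_op ht, opSubst_boolPt, opSubst_boolPt, hk,
    if_pos hm, if_pos hm]
  cases hx : y (opVar m D t) <;> rw [hx] at h <;> simp [h, boolPt, hx, Kind.comb]

/-- The disjunctions of a level together quantify over all `w`. -/
lemma or_chain {P : ℕ → (ℕ → Bool) → Prop} (hP : ∀ i < m, ∀ y, P i y ↔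
    P (i + 1) (Function.update y i false) ∨ P (i + 1) (Function.update y i true)) (y : ℕ → Bool) :
    P 0 y ↔ ∃ w : ℕ → Bool, P m (fun x => if x < m then w x else y x) := by
  have key := Nat.decreasingInduction' (m := 0) (n := m) (P := fun i => ∀ y, P i y ↔
    ∃ w : ℕ → Bool, P m (fun x => if i ≤ x ∧ x < m then w x else y x)) (fun k hk _ ih y => ?_)
    (Nat.zero_le m) (fun y => by simp [show ∀ x, ¬ (m ≤ x ∧ x < m) by lia])
  · simpa using key y
  · rw [hP k hk, ih, ih]
    constructor
    · rintro (⟨w, h⟩ | ⟨w, h⟩)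
      · refine ⟨Function.update w k false, ?_⟩
        convert h using 2 with x
        by_cases hx : x = k
        · subst hx; simp [hk]
        · simp only [Function.update_of_ne hx]
          split_ifs <;> first | rfl | lia
      · refine ⟨Function.update w k true, ?_⟩
        convert h using 2 with x
        by_cases hx : x = k
        · subst hx; simp [hk]
        · simp only [Function.update_of_ne hx]
          split_ifs <;> first | rfl | lia
    · rintro ⟨w, h⟩
      have h' (c : Bool) (hc : w k = c) : P m fun x => if k + 1 ≤ x ∧ x < m then w x
          else Function.update y k c x := by
        convert h using 2 with x
        by_cases hx : x = k
        · subst hx; simp [hk, hc]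
        · simp only [Function.update_of_ne hx]
          split_ifs <;> first | rfl | lia
      cases hw : w k
      exacts [.inl ⟨w, h' _ hw⟩, .inr ⟨w, h' _ hw⟩]

/-- The selections of a level together replace the end points by those of a half. -/
lemma select_chain {Q : ℕ → (ℕ → Bool) → Prop} {h : ℕ} (hh : 3 * m ≤ h)
    (hQ : ∀ j < m, ∀ y, Q j y ↔ Q (j + 1) (selectBool m h j y)) (y : ℕ → Bool) :
    Q 0 y ↔ Q m (fun x => if m ≤ x ∧ x < 2 * m then (if y h then y (x - m) else y x)
      else if 2 * m ≤ x ∧ x < 3 * m then (if y h then y x else y (x - 2 * m)) else y x) := by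
  have key := Nat.decreasingInduction' (m := 0) (n := m) (P := fun j => ∀ y, Q j y ↔
    Q m (fun x => if m + j ≤ x ∧ x < 2 * m then (if y h then y (x - m) else y x)
      else if 2 * m + j ≤ x ∧ x < 3 * m then (if y h then y x else y (x - 2 * m)) else y x))
    (fun k hk _ ih y => ?_) (Nat.zero_le m) (fun y => by
      simp [show ∀ x, ¬ (m + m ≤ x ∧ x < 2 * m) by lia,
        show ∀ x, ¬ (2 * m + m ≤ x ∧ x < 3 * m) by lia])
  · simpa using key y
  · rw [hQ k hk, ih]
    refine iff_of_eq (congrArg (Q m) (funext fun x => ?_))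
    have hyh : selectBool m h k y h = y h := by
      rw [selectBool, Function.update_of_ne (by lia), Function.update_of_ne (by lia)]
    rw [hyh]
    have hw {x : ℕ} (h1 : x ≠ m + k) (h2 : x ≠ 2 * m + k) : selectBool m h k y x = y x := by
      rw [selectBool, Function.update_of_ne h2, Function.update_of_ne h1]
    by_cases h1 : x = m + k
    · subst h1
      rw [if_neg (show ¬ (m + (k + 1) ≤ m + k ∧ m + k < 2 * m) by lia),
        if_neg (show ¬ (2 * m + (k + 1) ≤ m + k ∧ m + k < 3 * m) by lia),
        if_pos (show m + k ≤ m + k ∧ m + k < 2 * m by lia), selectBool,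
        Function.update_of_ne (by lia), Function.update_self, Nat.add_sub_cancel_left]
    by_cases h2 : x = 2 * m + k
    · subst h2
      rw [if_neg (show ¬ (m + (k + 1) ≤ 2 * m + k ∧ 2 * m + k < 2 * m) by lia),
        if_neg (show ¬ (2 * m + (k + 1) ≤ 2 * m + k ∧ 2 * m + k < 3 * m) by lia),
        if_neg (show ¬ (m + k ≤ 2 * m + k ∧ 2 * m + k < 2 * m) by lia),
        if_pos (show 2 * m + k ≤ 2 * m + k ∧ 2 * m + k < 3 * m by lia), selectBool,
        Function.update_self, Nat.add_sub_cancel_left]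
    rw [hw h1 h2]
    by_cases h3 : m + (k + 1) ≤ x ∧ x < 2 * m
    · rw [if_pos h3, if_pos (show m + k ≤ x ∧ x < 2 * m by lia), hw (by lia) (by lia)]
    by_cases h4 : 2 * m + (k + 1) ≤ x ∧ x < 3 * m
    · rw [if_neg h3, if_pos h4, if_neg (show ¬ (m + k ≤ x ∧ x < 2 * m) by lia),
        if_pos (show 2 * m + k ≤ x ∧ x < 3 * m by lia), hw (by lia) (by lia)]
    · rw [if_neg h3, if_neg h4, if_neg (show ¬ (m + k ≤ x ∧ x < 2 * m) by lia),
        if_neg (show ¬ (2 * m + k ≤ x ∧ x < 3 * m) by lia)]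

/-- The effect of a whole level: there is a middle node such that the claim of the next level holds
for both halves. -/
lemma stageTrue_level (hbase : ∀ y : ℕ → Bool, base (boolPt y) = 0 ∨ base (boolPt y) = 1)
    {l : ℕ} (hl : l < D) (y : ℕ → Bool) :
    StageTrue m D base (l * (2 * m + 1)) y ↔ ∃ w : ℕ → Bool, ∀ c : Bool,
      StageTrue m D base ((l + 1) * (2 * m + 1)) (fun x =>
        if x < m then w x
        else if x < 2 * m then (if c then w (x - m) else y x)
        else if x < 3 * m then (if c then y x else w (x - 2 * m))
        else if x = 3 * m + (D - 1 - l) then c else y x) := by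
  have hlt {i : ℕ} (hi : i < 2 * m + 1) : l * (2 * m + 1) + i < numStages m D := by
    have h : (l + 1) * (2 * m + 1) ≤ numStages m D := Nat.mul_le_mul_right _ hl
    rw [Nat.succ_mul] at h
    lia
  have hmod {i : ℕ} (hi : i < 2 * m + 1) : (l * (2 * m + 1) + i) % (2 * m + 1) = i := by
    rw [add_comm, Nat.add_mul_mod_self_right, Nat.mod_eq_of_lt hi]
  have hvar {i : ℕ} (hi : i < 2 * m + 1) (hmi : m ≤ i) :
      opVar m D (l * (2 * m + 1) + i) = 3 * m + (D - 1 - l) := by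
    rw [opVar, hmod hi, if_neg (by lia), add_comm (l * _), Nat.add_mul_div_right _ _ (by lia),
      Nat.div_eq_of_lt hi, zero_add]
  have h1 := or_chain (m := m) (P := fun i => StageTrue m D base (l * (2 * m + 1) + i))
    (fun i hi y => by
      have := stageTrue_or hbase (hlt (i := i) (by lia)) (by rw [hmod (by lia)]; exact hi) y
      rwa [hmod (by lia)] at this) y
  rw [add_zero] at h1
  rw [h1]
  refine exists_congr fun w => ?_
  rw [stageTrue_and hbase (hlt (by lia)) (hmod (by lia)), hvar (by lia) le_rfl]
  refine forall_congr' fun c => ?_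
  have h2 := select_chain (m := m) (h := 3 * m + (D - 1 - l))
    (Q := fun j => StageTrue m D base (l * (2 * m + 1) + m + 1 + j)) (by lia)
    (fun j hj y => by
      have e : l * (2 * m + 1) + m + 1 + j = l * (2 * m + 1) + (m + 1 + j) := by lia
      have := stageTrue_select (base := base) (hlt (i := m + 1 + j) (by lia))
        (by rw [hmod (by lia)]; lia) y
      rw [hmod (by lia), hvar (by lia) (by lia), show m + 1 + j - m - 1 = j by lia] at this
      rw [e, this, show l * (2 * m + 1) + (m + 1 + j) + 1 =
        l * (2 * m + 1) + m + 1 + (j + 1) by lia]) (Function.update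
          (fun x => if x < m then w x else y x) (3 * m + (D - 1 - l)) c)
  rw [add_zero] at h2
  rw [h2]
  have e : l * (2 * m + 1) + m + 1 + m = (l + 1) * (2 * m + 1) := by ring
  rw [e]
  refine iff_of_eq (congrArg _ (funext fun x => ?_))
  simp only [Function.update_self]
  by_cases hx0 : x = 3 * m + (D - 1 - l)
  · rw [if_neg (show ¬ (m ≤ x ∧ x < 2 * m) by lia), if_neg (show ¬ (2 * m ≤ x ∧ x < 3 * m) by lia),
      if_neg (show ¬ x < m by lia), if_neg (show ¬ x < 2 * m by lia),
      if_neg (show ¬ x < 3 * m by lia), if_pos hx0, hx0, Function.update_self]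
  rw [Function.update_of_ne hx0]
  by_cases hx1 : x < m
  · rw [if_neg (show ¬ (m ≤ x ∧ x < 2 * m) by lia), if_neg (show ¬ (2 * m ≤ x ∧ x < 3 * m) by lia),
      if_pos hx1, if_pos hx1]
  by_cases hx2 : x < 2 * m
  · rw [if_pos (show m ≤ x ∧ x < 2 * m by lia), if_neg hx1, if_neg hx1, if_pos hx2,
      Function.update_of_ne (by lia), if_pos (show x - m < m by lia)]
  by_cases hx3 : x < 3 * m
  · rw [if_neg (show ¬ (m ≤ x ∧ x < 2 * m) by lia), if_pos (show 2 * m ≤ x ∧ x < 3 * m by lia),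
      if_neg hx1, if_neg hx1, if_neg hx2, if_pos hx3, Function.update_of_ne (by lia),
      if_pos (show x - 2 * m < m by lia)]
  · rw [if_neg (show ¬ (m ≤ x ∧ x < 2 * m) by lia), if_neg (show ¬ (2 * m ≤ x ∧ x < 3 * m) by lia),
      if_neg hx1, if_neg hx1, if_neg hx2, if_neg hx3, if_neg hx0]

open Classical in
/-- The claim before level `l` is that there is a walk through the layers whose index starts with
the given bits. -/
theorem stageTrue_iff_walk {G : ℕ → ℕ → ℕ → Prop} (hG : ∀ i u v, G i u v → v < 2 ^ m) {l : ℕ}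
    (hl : l ≤ D) : ∀ y : ℕ → Bool,
      StageTrue m D (layerExt m D fun i u v => if G i u v then (1 : K) else 0)
        (l * (2 * m + 1)) y ↔
      Walk G (∑ b ∈ Finset.Ico (D - l) D, (y (3 * m + b)).toNat * 2 ^ b) (2 ^ (D - l))
        (bitsNum m fun b => y (m + b)) (bitsNum m fun b => y (2 * m + b)) := by
  have hbase (y : ℕ → Bool) :
      layerExt m D (fun i u v => if G i u v then (1 : K) else 0) (boolPt y) = 0 ∨
      layerExt m D (fun i u v => if G i u v then (1 : K) else 0) (boolPt y) = 1 := by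
    rw [layerExt_boolPt]
    split_ifs <;> simp
  refine Nat.decreasingInduction' (P := fun l => ∀ y : ℕ → Bool,
      StageTrue m D (layerExt m D fun i u v => if G i u v then (1 : K) else 0)
        (l * (2 * m + 1)) y ↔
      Walk G (∑ b ∈ Finset.Ico (D - l) D, (y (3 * m + b)).toNat * 2 ^ b) (2 ^ (D - l))
        (bitsNum m fun b => y (m + b)) (bitsNum m fun b => y (2 * m + b)))
    (fun l hl _ ih y => ?_) hl (fun y => ?_)
  · rw [stageTrue_level hbase hl]
    have hpow : 2 ^ (D - l) = 2 ^ (D - (l + 1)) + 2 ^ (D - (l + 1)) := by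
      rw [← two_mul, ← pow_succ', show D - (l + 1) + 1 = D - l by lia]
    rw [hpow, walk_add]
    have hsum (c : Bool) (w : ℕ → Bool) : ∑ b ∈ Finset.Ico (D - (l + 1)) D,
        ((if 3 * m + b < m then w (3 * m + b)
        else if 3 * m + b < 2 * m then (if c then w (3 * m + b - m) else y (3 * m + b))
        else if 3 * m + b < 3 * m then (if c then y (3 * m + b) else w (3 * m + b - 2 * m))
        else if 3 * m + b = 3 * m + (D - 1 - l) then c else y (3 * m + b)) : Bool).toNat * 2 ^ b =
        c.toNat * 2 ^ (D - (l + 1)) +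
          ∑ b ∈ Finset.Ico (D - l) D, (y (3 * m + b)).toNat * 2 ^ b := by
      rw [Finset.sum_eq_sum_Ico_succ_bot (by lia), show D - (l + 1) + 1 = D - l by lia]
      congr 1
      · rw [if_neg (by lia), if_neg (by lia), if_neg (by lia), if_pos (by lia)]
      · refine Finset.sum_congr rfl fun b hb => ?_
        have := Finset.mem_Ico.1 hb
        rw [if_neg (by lia), if_neg (by lia), if_neg (by lia), if_neg (by lia)]
    have hend (c : Bool) (w : ℕ → Bool) :
        bitsNum m (fun b => if m + b < m then w (m + b)
          else if m + b < 2 * m then (if c then w (m + b - m) else y (m + b))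
          else if m + b < 3 * m then (if c then y (m + b) else w (m + b - 2 * m))
          else if m + b = 3 * m + (D - 1 - l) then c else y (m + b)) =
        (if c then bitsNum m w else bitsNum m fun b => y (m + b)) := by
      cases c
      all_goals
        refine bitsNum_congr fun b hb => ?_
        rw [if_neg (by lia), if_pos (by lia)]
        simp
    have hend' (c : Bool) (w : ℕ → Bool) :
        bitsNum m (fun b => if 2 * m + b < m then w (2 * m + b)
          else if 2 * m + b < 2 * m then (if c then w (2 * m + b - m) else y (2 * m + b))
          else if 2 * m + b < 3 * m then (if c then y (2 * m + b) else w (2 * m + b - 2 * m))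
          else if 2 * m + b = 3 * m + (D - 1 - l) then c else y (2 * m + b)) =
        (if c then bitsNum m fun b => y (2 * m + b) else bitsNum m w) := by
      cases c
      all_goals
        refine bitsNum_congr fun b hb => ?_
        rw [if_neg (by lia), if_neg (by lia), if_pos (by lia)]
        simp
    simp only [ih, hsum, hend, hend', Bool.forall_bool, Bool.toNat_false, Bool.toNat_true,
      zero_mul, one_mul, zero_add, if_true, Bool.false_eq_true, if_false]
    constructor
    · rintro ⟨w, h1, h2⟩
      exact ⟨_, h1, by rwa [add_comm]⟩
    · rintro ⟨w, h1, h2⟩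
      have hw : w < 2 ^ m := h1.last_lt hG (by positivity)
      refine ⟨fun b => w.testBit b, ?_⟩
      rw [bitsNum_testBit hw]
      exact ⟨h1, by rwa [add_comm] at h2⟩
  · rw [Nat.sub_self, pow_zero, walk_one, StageTrue]
    change roundFn m D _ (numRounds m D) _ = 1 ↔ _
    rw [roundFn_last, layerExt_boolPt]
    have e : ∑ b ∈ Finset.Ico 0 D, (y (3 * m + b)).toNat * 2 ^ b =
        bitsNum D fun b => y (3 * m + b) := by
      rw [bitsNum, Finset.range_eq_Ico]
    rw [e]
    split_ifs with h <;> simp [h]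

end Semantics

/-! ### Points, claims and checks -/

section Points

variable {K : Type} [CommRing K] (m D : ℕ) (c : ℕ → K)

/-- The point at the beginning of stage `t`, when `c` lists the coins: the coins of the
linearizations of the previous stage. -/
def startPt (t x : ℕ) : K :=
  if t = 0 ∨ numVars m D ≤ x then 0 else c ((t - 1) * (numVars m D + 1) + (x + 1))

/-- The point after the operation of stage `t`. -/
def midPt (t : ℕ) : ℕ → K :=
  opSubst m D t (Function.update (startPt m D c t) (opVar m D t) (c (t * (numVars m D + 1))))

/-- The point before round `ρ`. -/
def roundPt (ρ x : ℕ) : K :=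
  if ρ % (numVars m D + 1) = 0 then startPt m D c (ρ / (numVars m D + 1)) x
  else if x + 1 < ρ % (numVars m D + 1) then
    c (ρ / (numVars m D + 1) * (numVars m D + 1) + (x + 1))
  else midPt m D c (ρ / (numVars m D + 1)) x

lemma roundPt_zero : roundPt m D c 0 = fun _ => 0 := by
  ext x; simp [roundPt, startPt]

lemma midPt_of_le {t x : ℕ} (ht : t < numStages m D) (hx : numVars m D ≤ x) :
    midPt m D c t x = 0 := by
  have h := opVar_lt m D ht
  have h2 := Nat.mod_lt t (Nat.succ_pos (2 * m))
  have h0 : startPt m D c t x = 0 := if_pos (.inr hx)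
  have hx' : 3 * m ≤ x := by unfold numVars at hx; lia
  rw [midPt, opSubst]
  split_ifs with hsel
  · rw [select, Function.update_of_ne (by lia), Function.update_of_ne (by lia),
      Function.update_of_ne (by lia), h0]
  · rw [Function.update_of_ne (by lia), h0]

/-- The points follow the rule of the interactive proof. -/
lemma roundPt_succ {ρ : ℕ} (hρ : ρ < numRounds m D) : roundPt m D c (ρ + 1) =
    roundSubst m D ρ (Function.update (roundPt m D c ρ) (roundVar m D ρ) (c ρ)) := by
  obtain ⟨t, i, hi, rfl⟩ : ∃ t i, i < numVars m D + 1 ∧ ρ = t * (numVars m D + 1) + i :=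
    ⟨ρ / (numVars m D + 1), ρ % (numVars m D + 1), Nat.mod_lt _ (Nat.succ_pos _), by
      rw [mul_comm]; exact (Nat.div_add_mod _ _).symm⟩
  have ht : t < numStages m D := by
    by_contra h
    have := Nat.mul_le_mul_right (numVars m D + 1) (not_lt.1 h)
    unfold numRounds at hρ
    lia
  ext x
  have hcur : roundPt m D c (t * (numVars m D + 1) + i) = fun x =>
      if i = 0 then startPt m D c t x else if x + 1 < i then c (t * (numVars m D + 1) + (x + 1))
      else midPt m D c t x := by
    ext x; rw [roundPt, round_div m D hi, round_mod m D hi]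
  simp only [roundVar, roundSubst, round_div m D hi, round_mod m D hi, hcur]
  -- The value at `x` before the last linearization, for `i = numVars`.
  have hnext : roundPt m D c (t * (numVars m D + 1) + i + 1) x =
      if x < i then (if numVars m D ≤ x then 0 else c (t * (numVars m D + 1) + (x + 1)))
      else midPt m D c t x := by
    rcases Nat.lt_succ_iff_lt_or_eq.1 hi with hlt | heq
    · rw [add_assoc, roundPt, round_div m D (Nat.succ_lt_succ hlt),
        round_mod m D (Nat.succ_lt_succ hlt), if_neg (Nat.succ_ne_zero i)]
      by_cases hx : x < i
      · rw [if_pos (Nat.succ_lt_succ hx), if_pos hx, if_neg (by lia)]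
      · rw [if_neg (fun h => hx (Nat.lt_of_succ_lt_succ h)), if_neg hx]
    · have e : t * (numVars m D + 1) + i + 1 = (t + 1) * (numVars m D + 1) := by
        rw [heq, Nat.succ_mul, add_assoc]
      rw [e, roundPt, Nat.mul_mod_left, if_pos rfl, Nat.mul_div_cancel _ (Nat.succ_pos _), startPt,
        Nat.add_sub_cancel]
      by_cases hx : x < i
      · rw [if_pos hx, if_neg (by lia), if_neg (by lia)]
      · rw [if_neg hx, if_pos (by lia), midPt_of_le m D c ht (by lia)]
  rw [hnext]
  cases i with
  | zero =>
    simp only [Nat.not_lt_zero, if_false, if_true, add_zero]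
    rfl
  | succ i =>
    simp only [Nat.succ_ne_zero, if_false, Nat.add_sub_cancel]
    rcases lt_trichotomy x i with hx | rfl | hx
    · rw [if_pos (by lia), if_neg (by lia), Function.update_of_ne (by lia), if_pos (by lia)]
    · rw [if_pos (by lia), if_neg (by lia), Function.update_self]
    · rw [if_neg (by lia), Function.update_of_ne (by lia), if_neg (by lia)]

variable {L : Type} [CommRing L] (φ : K →+* L)

lemma map_comb (k : Kind) (z a b : K) : φ (k.comb z a b) = k.comb (φ z) (φ a) (φ b) := by
  cases k <;> simp [Kind.comb]

lemma map_roundPt (ρ x : ℕ) :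
    φ (roundPt m D c ρ x) = roundPt m D (fun i => φ (c i)) ρ x := by
  have hstart (t x : ℕ) : φ (startPt m D c t x) = startPt m D (fun i => φ (c i)) t x := by
    simp only [startPt, apply_ite φ, map_zero]
  have hupd (t x : ℕ) : φ (Function.update (startPt m D c t) (opVar m D t)
      (c (t * (numVars m D + 1))) x) = Function.update (startPt m D (fun i => φ (c i)) t)
      (opVar m D t) (φ (c (t * (numVars m D + 1)))) x := by
    simp only [Function.update_apply, apply_ite φ, hstart]
  have hmid (t x : ℕ) : φ (midPt m D c t x) = midPt m D (fun i => φ (c i)) t x := by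
    simp only [midPt, opSubst]
    split_ifs
    · simp only [select, Function.update_apply (Function.update (Function.update _ _ _) _ _),
        Function.update_apply (Function.update (startPt m D _ t) _ _),
        apply_ite φ, map_add, map_mul, map_sub, hupd]
    · exact hupd t x
  simp only [roundPt, apply_ite φ, hstart, hmid]

/-- Evaluation of a cubic polynomial given by its coefficients. -/
def evalCubic (g : ℕ → K) (s : K) : K := g 0 + g 1 * s + g 2 * s ^ 2 + g 3 * s ^ 3

/-- The claim before round `ρ`, when `g` lists Merlin's polynomials. -/
def claim (g : ℕ → ℕ → K) (ρ : ℕ) : K :=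
  if ρ = 0 then 1 else evalCubic (g (ρ - 1)) (c (ρ - 1))

end Points

/-- Alice's checks modulo `M`, where `B` is the value of the base function at the last point. -/
def Checks (m D M : ℕ) (c : ℕ → ℤ) (g : ℕ → ℕ → ℤ) (B : ℤ) : Prop :=
  (∀ ρ < numRounds m D, (roundKind m D ρ).comb (roundPt m D c ρ (roundVar m D ρ))
    (evalCubic (g ρ) 0) (evalCubic (g ρ) 1) ≡ claim c g ρ [ZMOD M]) ∧
  B ≡ claim c g (numRounds m D) [ZMOD M]

/-! ### Computability of the checks -/

namespace RAM

variable {α : Type} [Ctx α] {m D : α → ℕ}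

namespace PC

lemma numVars (hm : PC m) (hD : PC D) : PC (fun x => numVars (m x) (D x)) :=
  hD.add ((const 3).mul hm)

lemma numStages (hm : PC m) (hD : PC D) : PC (fun x => numStages (m x) (D x)) :=
  hD.mul (((const 2).mul hm).add (const 1))

lemma numRounds (hm : PC m) (hD : PC D) : PC (fun x => numRounds (m x) (D x)) :=
  (numStages hm hD).mul ((numVars hm hD).add (const 1))

lemma stageMod {t : α → ℕ} (hm : PC m) (ht : PC t) : PC (fun x => t x % (2 * m x + 1)) :=
  ht.mod (((const 2).mul hm).add (const 1))

lemma opVar {t : α → ℕ} (hm : PC m) (hD : PC D) (ht : PC t) :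
    PC (fun x => opVar (m x) (D x) (t x)) :=
  .ite (.lt (stageMod hm ht) hm) (stageMod hm ht) (((const 3).mul hm).add
    ((hD.sub (const 1)).sub (ht.div (((const 2).mul hm).add (const 1)))))

lemma roundMod {ρ : α → ℕ} (hm : PC m) (hD : PC D) (hρ : PC ρ) :
    PC (fun x => ρ x % (_root_.numVars (m x) (D x) + 1)) :=
  hρ.mod ((numVars hm hD).add (const 1))

lemma roundDiv {ρ : α → ℕ} (hm : PC m) (hD : PC D) (hρ : PC ρ) :
    PC (fun x => ρ x / (_root_.numVars (m x) (D x) + 1)) :=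
  hρ.div ((numVars hm hD).add (const 1))

lemma roundVar {ρ : α → ℕ} (hm : PC m) (hD : PC D) (hρ : PC ρ) :
    PC (fun x => roundVar (m x) (D x) (ρ x)) :=
  .ite (.eq (roundMod hm hD hρ) (const 0)) (opVar hm hD (roundDiv hm hD hρ))
    ((roundMod hm hD hρ).sub (const 1))

end PC

/-- `PCF p z` says that the residues of all entries of the sequence `z x` modulo `p x + 1` are
computed by a term. -/
def PCF (p : α → ℕ) (z : α → ℕ → ℤ) : Prop :=
  PCZ (fun x : α × ℕ => p x.1) (fun x => z x.1 x.2)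

namespace PCF

variable {p : α → ℕ} {z : α → ℕ → ℤ}

lemma entry (hz : PCF p z) {g : α → ℕ} (hg : PC g) : PCZ p (fun x => z x (g x)) :=
  PCZ.subst (f := fun x : α × ℕ => z x.1 x.2) hz hg

lemma wk (hz : PCF p z) : PCF (fun x : α × ℕ => p x.1) (fun x => z x.1) :=
  PCZ.mid (f := fun x : α × ℕ => z x.1 x.2) hz

lemma update {x : α → ℕ} {v : α → ℤ} (hx : PC x) (hv : PCZ p v) (hz : PCF p z) :
    PCF p (fun y => Function.update (z y) (x y) (v y)) := by
  simp only [PCF, Function.update_apply]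
  exact .ite (.eq .last hx.wk) hv.wk hz

lemma opSubst {t : α → ℕ} (hp : PC p) (hm : PC m) (hD : PC D) (ht : PC t) (hz : PCF p z) :
    PCF p (fun y => opSubst (m y) (D y) (t y) (z y)) := by
  have hq := PC.stageMod hm ht
  have hj : PC (fun x => t x % (2 * m x + 1) - m x - 1) := (hq.sub hm).sub (.const 1)
  have hu := hm.add hj
  have hv := ((PC.const 2).mul hm).add hj
  have hh := hz.entry (PC.opVar hm hD ht)
  have hzj := hz.entry hj
  have hzu := hz.entry hu
  have hzv := hz.entry hv
  have h1 := update hv (.add hp hzj (.mul hp hh (.sub hp hzv hzj)))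
    (update hu (.add hp hzu (.mul hp hh (.sub hp hzj hzu))) hz)
  refine (PCZ.ite (PCP.lt hm hq).wk h1 hz).congr fun x => ?_
  simp only [_root_.opSubst, select]
  split_ifs <;> exact Int.ModEq.refl _

variable {c : α → ℕ → ℤ}

lemma startPt {t : α → ℕ} (hp : PC p) (hm : PC m) (hD : PC D) (ht : PC t) (hc : PCF p c) :
    PCF p (fun y => startPt (m y) (D y) (c y) (t y)) := by
  have hN := PC.numVars hm hD
  have h1 := hc.wk.entry (((ht.sub (.const 1)).mul (hN.add (.const 1))).wk.add
      (PC.last.add (.const 1)))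
  exact .ite (.or (.eq ht.wk (.const 0)) (.le hN.wk .last)) (.of_nat hp.wk (.const 0)) h1

lemma midPt {t : α → ℕ} (hp : PC p) (hm : PC m) (hD : PC D) (ht : PC t) (hc : PCF p c) :
    PCF p (fun y => midPt (m y) (D y) (c y) (t y)) :=
  opSubst hp hm hD ht (update (PC.opVar hm hD ht)
    (hc.entry (ht.mul ((PC.numVars hm hD).add (.const 1)))) (startPt hp hm hD ht hc))

lemma roundPt {ρ : α → ℕ} (hp : PC p) (hm : PC m) (hD : PC D) (hρ : PC ρ) (hc : PCF p c) :
    PCF p (fun y => roundPt (m y) (D y) (c y) (ρ y)) := by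
  have hmod := PC.roundMod hm hD hρ
  have hdiv := PC.roundDiv hm hD hρ
  have h1 := hc.wk.entry
      ((hdiv.mul ((PC.numVars hm hD).add (.const 1))).wk.add (PC.last.add (.const 1)))
  exact .ite (PCP.eq hmod (.const 0)).wk (startPt hp hm hD hdiv hc)
    (.ite (.lt (PC.last.add (.const 1)) hmod.wk) h1 (midPt hp hm hD hdiv hc))

end PCF

namespace PCZ

variable {p : α → ℕ}

lemma bitsIndicator {n i off : α → ℕ} {z : α → ℕ → ℤ} (hp : PC p) (hn : PC n) (hi : PC i)
    (hoff : PC off) (hz : PCF p z) :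
    PCZ p (fun x => bitsIndicator (n x) (i x) (fun b => z x (off x + b))) := by
  have hzb := hz.wk.entry (hoff.wk.add .last)
  exact prod hp hn (ite (.eq ((PC.shiftRight hi.wk .last).mod (.const 2)) (.const 1)) hzb
    (sub hp.wk (of_nat hp.wk (.const 1)) hzb))

lemma layerExt {G : α → ℕ → ℕ → ℕ → ℤ} {z : α → ℕ → ℤ} (hp : PC p) (hm : PC m) (hD : PC D)
    (hm2 : PC (fun x => 2 ^ m x)) (hD2 : PC (fun x => 2 ^ D x))
    (hG : PCZ (fun x : ((α × ℕ) × ℕ) × ℕ => p x.1.1.1)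
      (fun x => G x.1.1.1 x.1.1.2 x.1.2 x.2))
    (hz : PCF p z) :
    PCZ p (fun x => layerExt (m x) (D x) (G x) (z x)) := by
  have hz3 := hz.wk.wk.wk
  have hp3 := hp.wk.wk.wk
  have hm3 := hm.wk.wk.wk
  have h1 := bitsIndicator hp3 hD.wk.wk.wk PC.last.wk.wk ((PC.const 3).mul hm3) hz3
  have h2 := bitsIndicator hp3 hm3 PC.last.wk hm3 hz3
  have h3 := bitsIndicator hp3 hm3 PC.last ((PC.const 2).mul hm3) hz3
  exact sum hp hD2 (sum hp.wk hm2.wk (sum hp.wk.wk hm2.wk.wk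
    (mul hp3 (mul hp3 (mul hp3 h1 h2) h3) hG)))

lemma comb_roundKind {ρ : α → ℕ} {z a b : α → ℤ} (hp : PC p) (hm : PC m) (hD : PC D) (hρ : PC ρ)
    (hz : PCZ p z) (ha : PCZ p a) (hb : PCZ p b) :
    PCZ p (fun x => (roundKind (m x) (D x) (ρ x)).comb (z x) (a x) (b x)) := by
  have hlin : PCZ p (fun x => (1 - z x) * a x + z x * b x) :=
    add hp (mul hp (sub hp (of_nat hp (.const 1)) hz) ha) (mul hp hz hb)
  have hor : PCZ p (fun x => a x + b x - a x * b x) := sub hp (add hp ha hb) (mul hp ha hb)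
  have hmod := PC.stageMod hm (PC.roundDiv hm hD hρ)
  refine (ite (.eq (PC.roundMod hm hD hρ) (.const 0)) (ite (.lt hmod hm) hor
    (ite (.eq hmod hm) (mul hp ha hb) hlin)) hlin).congr fun x => ?_
  simp only [roundKind, opKind]
  split_ifs <;> exact Int.ModEq.refl _

lemma evalCubic {g : α → ℕ → ℤ} {s : α → ℤ} (hp : PC p) (hg : ∀ k, PCZ p (fun x => g x k))
    (hs : PCZ p s) : PCZ p (fun x => evalCubic (g x) (s x)) := by
  simp only [_root_.evalCubic, pow_succ, pow_zero, one_mul]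
  exact add hp (add hp (add hp (hg 0) (mul hp (hg 1) hs)) (mul hp (hg 2) (mul hp hs hs)))
    (mul hp (hg 3) (mul hp (mul hp hs hs) hs))

lemma claim {ρ : α → ℕ} (hp : PC p) (hρ : PC ρ)
    {c : α → ℕ → ℤ} {g : α → ℕ → ℕ → ℤ} (hc : PCF p c)
    (hg : ∀ k, PCF p (fun x i => g x i k)) :
    PCZ p (fun x => claim (c x) (g x) (ρ x)) :=
  ite (.eq hρ (.const 0)) (of_nat hp (.const 1))
    (evalCubic hp (fun k => (hg k).entry (hρ.sub (.const 1))) (hc.entry (hρ.sub (.const 1))))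

end PCZ

lemma PCP.checks {p : α → ℕ} {c : α → ℕ → ℤ} {g : α → ℕ → ℕ → ℤ} {B : α → ℤ} (hp : PC p)
    (hm : PC m) (hD : PC D) (hc : PCF p c) (hg : ∀ k, PCF p (fun x i => g x i k))
    (hB : PCZ p B) :
    PCP (fun x => Checks (m x) (D x) (p x + 1) (c x) (g x) (B x)) := by
  have h1 := (PCF.roundPt hp.wk hm.wk hD.wk .last hc.wk).entry (PC.roundVar hm.wk hD.wk .last)
  have hg' : ∀ k, PCZ (fun x : α × ℕ => p x.1) (fun x => g x.1 x.2 k) := hg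
  have h2 := PCZ.evalCubic (g := fun x : α × ℕ => g x.1 x.2) hp.wk hg'
    (PCZ.of_nat hp.wk (.const 0))
  have h3 := PCZ.evalCubic (g := fun x : α × ℕ => g x.1 x.2) hp.wk hg'
    (PCZ.of_nat hp.wk (.const 1))
  have h4 := PCZ.claim (g := fun x : α × ℕ => g x.1) hp.wk .last hc.wk fun k => (hg k).wk
  exact .and (.ball (PC.numRounds hm hD)
    (PCZ.modEq (PCZ.comb_roundKind hp.wk hm.wk hD.wk .last h1 h2 h3) h4))
    (PCZ.modEq hB (PCZ.claim hp (PC.numRounds hm hD) hc hg))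

end RAM

/-! ### The parties as functions of the memory contents -/

section Params

variable (m D k : ℕ)

/-- Half of the number of coins per round. Its exponential is at least three times the number of
rounds, which bounds the number of bad coin outcomes. -/
def halfLen : ℕ := Nat.clog 2 (3 * numRounds m D + 2)

/-- The number of coins per round; they name an element of the field. -/
def fieldBits : ℕ := 2 * halfLen m D

/-- The predecessor of the least prime above `2 ^ fieldBits`. -/
noncomputable def fieldPred : ℕ :=
  RAM.bfind (fun q => 2 ^ fieldBits m D < q + 1 ∧ (q + 1).Prime) (2 * 2 ^ fieldBits m D)

/-- The number of independent repetitions of the interactive proof. -/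
def repetitions : ℕ := k / halfLen m D + 1

lemma halfLen_pos : 0 < halfLen m D := Nat.clog_pos one_lt_two (by lia)

lemma fieldPred_spec : fieldPred m D < 2 * 2 ^ fieldBits m D ∧
    2 ^ fieldBits m D < fieldPred m D + 1 ∧ (fieldPred m D + 1).Prime := by
  have h := RAM.bfind_of_exists (P := fun q => 2 ^ fieldBits m D < q + 1 ∧ (q + 1).Prime)
    (n := 2 * 2 ^ fieldBits m D) (by
      obtain ⟨p, hp, h1, h2⟩ := Nat.exists_prime_lt_and_le_two_mul (2 ^ fieldBits m D)
        (by positivity)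
      refine ⟨p - 1, ?_, ?_⟩
      · have := hp.pos; lia
      · rw [Nat.sub_add_cancel hp.pos]; exact ⟨h1, hp⟩)
  exact ⟨h.1, h.2.1.1, h.2.1.2⟩

end Params

/-! The memory contents are a sequence `I`, which begins with the common input. -/

section Memory

variable (I : ℕ → ℕ)

/-- The number of bits of a node. -/
def widthLog : ℕ := Nat.clog 2 (I 2)

/-- The number of bits of a layer index. -/
def lengthLog : ℕ := Nat.clog 2 (I 3)

/-- The number of rounds of one repetition. -/
def repRounds : ℕ := numRounds (widthLog I) (lengthLog I)

/-- The number of coins per round. Merlin and Bob send field elements with one bit more. -/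
def wordLen : ℕ := fieldBits (widthLog I) (lengthLog I)

/-- The predecessor of the prime modulus. -/
noncomputable def modPred : ℕ := fieldPred (widthLog I) (lengthLog I)

/-- The number of repetitions. -/
def repCount : ℕ := repetitions (widthLog I) (lengthLog I) (I 4)

/-- The length of the common input. -/
def commonLen : ℕ := 5 + (I 3 - 1) + (I 3 - 1) * I 2 * I 2 * 2

/-- Whether there is an edge marked `c` from node `u` of layer `i` to node `v`. -/
def HasEdge (i u v c : ℕ) : Prop :=
  I (5 + (I 3 - 1) + (((i * I 2 + u) * I 2 + v) * 2 + c)) = 1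

/-- The usable edges of the layers with a variable of Alice. Beyond the last layer there are loops,
which are assigned to Alice as well. -/
def AliceEdge (i u v : ℕ) : Prop :=
  (i < I 3 - 1 ∧ u < I 2 ∧ v < I 2 ∧ I (5 + i) < I 0 ∧
    HasEdge I i u v (I (commonLen I + I (5 + i)))) ∨ (I 3 - 1 ≤ i ∧ u < I 2 ∧ u = v)

/-- The usable edges of the layers with a variable of Bob. -/
def BobEdge (i u v : ℕ) : Prop :=
  i < I 3 - 1 ∧ u < I 2 ∧ v < I 2 ∧ I 0 ≤ I (5 + i) ∧
    HasEdge I i u v (I (commonLen I + (I (5 + i) - I 0)))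

/-- The number whose binary digits, the lowest one first, are in `n` consecutive cells. -/
def bitVal (off n : ℕ) : ℤ := ∑ j ∈ Finset.range n, (I (off + j) : ℤ) * 2 ^ j

/-- The coins, when they begin at the cell `off`, as field elements. -/
def coinVal (off q ρ : ℕ) : ℤ := bitVal I (off + (q * repRounds I + ρ) * wordLen I) (wordLen I)

/-- The coefficients of Merlin's polynomials. -/
def coefVal (q ρ i : ℕ) : ℤ :=
  bitVal I (commonLen I + I 0 + (q * repRounds I + ρ) * (4 * (wordLen I + 1)) + i * (wordLen I + 1))
    (wordLen I + 1)

/-- The first cell with coins in Alice's input. -/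
def aliceCoinOff : ℕ := commonLen I + I 0 + repCount I * repRounds I * (4 * (wordLen I + 1))

/-- Bob's answers, as Alice reads them. -/
def answerVal (q : ℕ) : ℤ :=
  bitVal I (aliceCoinOff I + repCount I * repRounds I * wordLen I + q * (wordLen I + 1))
    (wordLen I + 1)

open Classical in
/-- Alice accepts iff all repetitions pass the checks. The base function at the last point is the
sum of the contribution of her layers, and of the contribution of Bob's layers. -/
def AliceAccepts : Prop :=
  ∀ q < repCount I, Checks (widthLog I) (lengthLog I) (modPred I + 1)
    (coinVal I (aliceCoinOff I) q) (coefVal I q)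
    (layerExt (widthLog I) (lengthLog I) (fun i u v => if AliceEdge I i u v then 1 else 0)
      (roundPt (widthLog I) (lengthLog I) (coinVal I (aliceCoinOff I) q) (repRounds I)) +
      answerVal I q)

open Classical in
/-- The contribution of Bob's layers to the base function at the last point. -/
noncomputable def bobVal (q : ℕ) : ℤ :=
  layerExt (widthLog I) (lengthLog I) (fun i u v => if BobEdge I i u v then 1 else 0)
    (roundPt (widthLog I) (lengthLog I) (coinVal I (commonLen I + I 1) q) (repRounds I))

/-- The `i`-th bit of Bob's message. -/
noncomputable def bobBit (i : ℕ) : ℕ :=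
  (bobVal I (i / (wordLen I + 1)) % (modPred I + 1 : ℕ)).toNat / 2 ^ (i % (wordLen I + 1)) % 2

end Memory

namespace RAM

variable {α : Type} [Ctx α]

namespace PC

lemma cell (i : ℕ) : PC (fun x : α => Ctx.inp x i) := load (const i)

lemma widthLog : PC (fun x : α => widthLog (Ctx.inp x)) := (cell 2).clog

lemma lengthLog : PC (fun x : α => lengthLog (Ctx.inp x)) := (cell 3).clog

lemma repRounds : PC (fun x : α => repRounds (Ctx.inp x)) := numRounds widthLog lengthLog

lemma clogArg : PC (fun x : α => 3 * _root_.repRounds (Ctx.inp x) + 2) :=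
  ((const 3).mul repRounds).add (const 2)

lemma halfLen :
    PC (fun x : α => halfLen (_root_.widthLog (Ctx.inp x)) (_root_.lengthLog (Ctx.inp x))) :=
  clogArg.clog

lemma wordLen : PC (fun x : α => wordLen (Ctx.inp x)) := (const 2).mul halfLen

lemma two_pow_wordLen : PC (fun x : α => 2 ^ _root_.wordLen (Ctx.inp x)) :=
  (clogArg.two_pow_clog.mul clogArg.two_pow_clog).congr fun x => by
    rw [← pow_add, ← two_mul]; rfl

lemma modPred : PC (fun x : α => modPred (Ctx.inp x)) :=
  bfind ((const 2).mul two_pow_wordLen) (.and (.lt two_pow_wordLen.wk (last.add (const 1)))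
    (.prime (last.add (const 1))))

lemma repCount : PC (fun x : α => repCount (Ctx.inp x)) := ((cell 4).div halfLen).add (const 1)

lemma commonLen : PC (fun x : α => commonLen (Ctx.inp x)) :=
  ((const 5).add ((cell 3).sub (const 1))).add
    (((((cell 3).sub (const 1)).mul (cell 2)).mul (cell 2)).mul (const 2))

lemma globalRound {q ρ : α → ℕ} (hq : PC q) (hρ : PC ρ) :
    PC (fun x => q x * _root_.repRounds (Ctx.inp x) + ρ x) := (hq.mul repRounds).add hρ

lemma aliceCoinOff : PC (fun x : α => aliceCoinOff (Ctx.inp x)) :=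
  (commonLen.add (cell 0)).add ((repCount.mul repRounds).mul
    ((const 4).mul (wordLen.add (const 1))))

end PC

namespace PCP

variable {i u v : α → ℕ}

lemma hasEdge {c : α → ℕ} (hi : PC i) (hu : PC u) (hv : PC v) (hc : PC c) :
    PCP (fun x => HasEdge (Ctx.inp x) (i x) (u x) (v x) (c x)) :=
  .eq (.load (((PC.const 5).add ((PC.cell 3).sub (.const 1))).add
    ((((((hi.mul (.cell 2)).add hu).mul (.cell 2)).add hv).mul (.const 2)).add hc))) (.const 1)

lemma aliceEdge (hi : PC i) (hu : PC u) (hv : PC v) :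
    PCP (fun x => AliceEdge (Ctx.inp x) (i x) (u x) (v x)) := by
  have hvar := PC.load ((PC.const 5).add hi)
  have hT := (PC.cell (α := α) 3).sub (.const 1)
  exact .or (.and (.lt hi hT) (.and (.lt hu (.cell 2)) (.and (.lt hv (.cell 2))
    (.and (.lt hvar (.cell 0)) (hasEdge hi hu hv (.load (.add .commonLen hvar)))))))
    (.and (.le hT hi) (.and (.lt hu (.cell 2)) (.eq hu hv)))

lemma bobEdge (hi : PC i) (hu : PC u) (hv : PC v) :
    PCP (fun x => BobEdge (Ctx.inp x) (i x) (u x) (v x)) := by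
  have hvar := PC.load ((PC.const 5).add hi)
  have hT := (PC.cell (α := α) 3).sub (.const 1)
  exact .and (.lt hi hT) (.and (.lt hu (.cell 2)) (.and (.lt hv (.cell 2))
    (.and (.le (.cell 0) hvar) (hasEdge hi hu hv (.load (.add .commonLen
      (.sub hvar (.cell 0))))))))

end PCP

namespace PCZ

variable {p : α → ℕ}

lemma bitVal {off n : α → ℕ} (hp : PC p) (hoff : PC off) (hn : PC n) :
    PCZ p (fun x => bitVal (Ctx.inp x) (off x) (n x)) :=
  sum hp hn (mul hp.wk (of_nat hp.wk (.load (hoff.wk.add .last))) (two_pow hp.wk .last))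

lemma answerVal {q : α → ℕ} (hp : PC p) (hq : PC q) :
    PCZ p (fun x => answerVal (Ctx.inp x) (q x)) :=
  bitVal hp ((PC.aliceCoinOff.add ((PC.repCount.mul .repRounds).mul .wordLen)).add
    (hq.mul (PC.wordLen.add (.const 1)))) (PC.wordLen.add (.const 1))

end PCZ

namespace PCF

variable {p : α → ℕ}

lemma coinVal {off q : α → ℕ} (hp : PC p) (hoff : PC off) (hq : PC q) :
    PCF p (fun x => coinVal (Ctx.inp x) (off x) (q x)) :=
  PCZ.bitVal (α := α × ℕ) hp.wk (hoff.wk.add ((PC.globalRound hq.wk .last).mul .wordLen)) .wordLen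

lemma coefVal {q : α → ℕ} (hp : PC p) (hq : PC q) (k : ℕ) :
    PCF p (fun x ρ => coefVal (Ctx.inp x) (q x) ρ k) :=
  PCZ.bitVal (α := α × ℕ) hp.wk (((PC.commonLen.add (.cell 0)).add
    ((PC.globalRound hq.wk .last).mul ((PC.const 4).mul (PC.wordLen.add (.const 1))))).add
    ((PC.const k).mul (PC.wordLen.add (.const 1)))) (PC.wordLen.add (.const 1))

end PCF

lemma PC.two_pow_widthLog : PC (fun x : α => 2 ^ _root_.widthLog (Ctx.inp x)) :=
  (PC.cell 2).two_pow_clog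

lemma PC.two_pow_lengthLog : PC (fun x : α => 2 ^ _root_.lengthLog (Ctx.inp x)) :=
  (PC.cell 3).two_pow_clog

open Classical in
lemma PCZ.layerExt_roundPt {E : (ℕ → ℕ) → ℕ → ℕ → ℕ → Prop} {off q : α → ℕ}
    (hE : PCP (fun x : ((α × ℕ) × ℕ) × ℕ => E (Ctx.inp x) x.1.1.2 x.1.2 x.2)) (hoff : PC off)
    (hq : PC q) : PCZ (fun x => _root_.modPred (Ctx.inp x)) (fun x =>
      _root_.layerExt (_root_.widthLog (Ctx.inp x)) (_root_.lengthLog (Ctx.inp x))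
        (fun i u v => if E (Ctx.inp x) i u v then 1 else 0)
        (_root_.roundPt (_root_.widthLog (Ctx.inp x)) (_root_.lengthLog (Ctx.inp x))
          (_root_.coinVal (Ctx.inp x) (off x) (q x)) (_root_.repRounds (Ctx.inp x)))) := by
  have hp := PC.modPred (α := α)
  have hG : PCZ (fun x : ((α × ℕ) × ℕ) × ℕ => _root_.modPred (Ctx.inp x.1.1.1))
      (fun x => if E (Ctx.inp x) x.1.1.2 x.1.2 x.2 then 1 else 0) :=
    .ite hE (.of_nat hp.wk.wk.wk (.const 1)) (.of_nat hp.wk.wk.wk (.const 0))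
  exact PCZ.layerExt hp .widthLog .lengthLog .two_pow_widthLog .two_pow_lengthLog hG
    (PCF.roundPt hp .widthLog .lengthLog .repRounds (PCF.coinVal hp hoff hq))

lemma PCP.aliceAccepts : PCP (fun x : α => AliceAccepts (Ctx.inp x)) := by
  have hp := PC.modPred (α := α × ℕ)
  have h := PCZ.layerExt_roundPt (α := α × ℕ) (E := AliceEdge)
    (.aliceEdge PC.last.wk.wk PC.last.wk .last) .aliceCoinOff .last
  exact .ball .repCount (PCP.checks hp .widthLog .lengthLog (PCF.coinVal hp .aliceCoinOff .last)
    (PCF.coefVal hp .last) (.add hp h (.answerVal hp .last)))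

lemma PC.bobBit {i : α → ℕ} (hi : PC i) : PC (fun x => bobBit (Ctx.inp x) (i x)) := by
  have hs := PC.wordLen (α := α) |>.add (.const 1)
  have h := PCZ.layerExt_roundPt (α := α) (E := BobEdge)
    (.bobEdge PC.last.wk.wk PC.last.wk .last) (PC.commonLen.add (.cell 1)) (hi.div hs)
  exact (PC.shiftRight h (hi.mod hs)).mod (.const 2)

end RAM

/-! ### Completeness and soundness of one repetition -/

section Repetition

open Polynomial

variable {K : Type} [Field K] {m D : ℕ}

/-- Alice's checks over a field. -/
def FieldChecks (m D : ℕ) (c : ℕ → K) (g : ℕ → ℕ → K) (B : K) : Prop :=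
  (∀ ρ < numRounds m D, (roundKind m D ρ).comb (roundPt m D c ρ (roundVar m D ρ))
    (evalCubic (g ρ) 0) (evalCubic (g ρ) 1) = claim c g ρ) ∧
  B = claim c g (numRounds m D)

lemma checks_iff {p : ℕ} [Fact p.Prime] {c : ℕ → ℤ} {g : ℕ → ℕ → ℤ} {B : ℤ} :
    Checks m D p c g B ↔
      FieldChecks m D (fun ρ => (c ρ : ZMod p)) (fun ρ i => (g ρ i : ZMod p)) (B : ZMod p) := by
  have hpt (ρ x : ℕ) := map_roundPt m D c (Int.castRingHom (ZMod p)) ρ x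
  have hcomb (k : Kind) (z a b : ℤ) := map_comb (Int.castRingHom (ZMod p)) k z a b
  simp only [Int.coe_castRingHom] at hpt hcomb
  have heval (ρ : ℕ) (s : ℤ) : ((evalCubic (g ρ) s : ℤ) : ZMod p) =
      evalCubic (fun i => (g ρ i : ZMod p)) (s : ZMod p) := by
    simp only [evalCubic]; push_cast; rfl
  have hclaim (ρ : ℕ) : ((claim c g ρ : ℤ) : ZMod p) =
      claim (fun ρ => (c ρ : ZMod p)) (fun ρ i => (g ρ i : ZMod p)) ρ := by
    simp only [claim]
    split_ifs
    · simp
    · exact heval _ _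
  simp only [Checks, FieldChecks, ← ZMod.intCast_eq_intCast_iff, hcomb, hpt, heval, hclaim,
    Int.cast_zero, Int.cast_one]

/-- A point depends on the coins of the earlier rounds only. -/
lemma roundPt_congr {c c' : ℕ → K} {ρ : ℕ} (hρ : ρ ≤ numRounds m D) (h : ∀ j < ρ, c j = c' j) :
    roundPt m D c ρ = roundPt m D c' ρ := by
  induction ρ with
  | zero => rw [roundPt_zero, roundPt_zero]
  | succ ρ ih =>
    rw [roundPt_succ m D c hρ, roundPt_succ m D c' hρ, ih (by lia) fun j hj => h j (by lia),
      h ρ (Nat.lt_succ_self ρ)]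

lemma evalCubic_congr {g g' : ℕ → K} (h : ∀ i < 4, g i = g' i) : evalCubic g = evalCubic g' := by
  ext s
  simp only [evalCubic, h 0 (by norm_num), h 1 (by norm_num), h 2 (by norm_num), h 3 (by norm_num)]

lemma FieldChecks.congr {c c' : ℕ → K} {g g' : ℕ → ℕ → K} {B : K} (H : FieldChecks m D c g B)
    (hc : ∀ ρ < numRounds m D, c' ρ = c ρ) (hg : ∀ ρ < numRounds m D, ∀ i < 4, g' ρ i = g ρ i) :
    FieldChecks m D c' g' B := by
  have hclaim (ρ : ℕ) (hρ : ρ ≤ numRounds m D) : claim c' g' ρ = claim c g ρ := by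
    simp only [claim]
    split_ifs with h
    · rfl
    · rw [evalCubic_congr (hg _ (by lia)), hc _ (by lia)]
  refine ⟨fun ρ hρ => ?_, ?_⟩
  · rw [hclaim ρ hρ.le, roundPt_congr hρ.le fun j hj => hc j (by lia), evalCubic_congr (hg ρ hρ)]
    exact H.1 ρ hρ
  · rw [hclaim _ le_rfl]
    exact H.2

open Classical in
/-- The polynomial that describes the next function as the variable of round `ρ` varies. -/
noncomputable def truePoly (m D : ℕ) (base : (ℕ → K) → K) (ρ : ℕ) (z : ℕ → K) : K[X] :=
  if h : PolyDeg 3 fun t => roundFn m D base (ρ + 1)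
    (roundSubst m D ρ (Function.update z (roundVar m D ρ) t)) then h.choose else 0

lemma natDegree_truePoly (base : (ℕ → K) → K) (ρ : ℕ) (z : ℕ → K) :
    (truePoly m D base ρ z).natDegree ≤ 3 := by
  rw [truePoly]
  split_ifs with h
  · exact h.choose_spec.1
  · simp

lemma eval_truePoly {base : (ℕ → K) → K} (hbase : ∀ y < numVars m D, AffineAt base y) {ρ : ℕ}
    (hρ : ρ < numRounds m D) (z : ℕ → K) (t : K) : (truePoly m D base ρ z).eval t =
      roundFn m D base (ρ + 1) (roundSubst m D ρ (Function.update z (roundVar m D ρ) t)) := by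
  have h := polyDeg_round hbase hρ z
  rw [truePoly, dif_pos h]
  exact h.choose_spec.2 t

/-- The cubic polynomial with the given coefficients. -/
noncomputable def cubic (g : ℕ → K) : K[X] :=
  C (g 0) + C (g 1) * X + C (g 2) * X ^ 2 + C (g 3) * X ^ 3

lemma eval_cubic (g : ℕ → K) (s : K) : (cubic g).eval s = evalCubic g s := by
  simp [cubic, evalCubic]

lemma natDegree_cubic (g : ℕ → K) : (cubic g).natDegree ≤ 3 := by
  unfold cubic; compute_degree

lemma cubic_coeff {q : K[X]} (hq : q.natDegree ≤ 3) : cubic q.coeff = q := by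
  conv_rhs => rw [q.as_sum_range_C_mul_X_pow' (Nat.lt_succ_of_le hq)]
  simp [cubic, Finset.sum_range_succ]

/-- The coin `t` in round `ρ` makes Merlin's wrong polynomial agree with the true one. -/
def BadCoin (m D : ℕ) (base : (ℕ → K) → K) (c : ℕ → K) (g : ℕ → ℕ → K) (ρ : ℕ) (t : K) : Prop :=
  t ∈ (truePoly m D base ρ (roundPt m D c ρ) - cubic (g ρ)).roots

lemma FieldChecks.exists_badCoin {base : (ℕ → K) → K}
    (hbase : ∀ y < numVars m D, AffineAt base y) {c : ℕ → K} {g : ℕ → ℕ → K}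
    (H : FieldChecks m D c g (base (roundPt m D c (numRounds m D))))
    (h0 : roundFn m D base 0 (fun _ => 0) ≠ 1) :
    ∃ ρ < numRounds m D, BadCoin m D base c g ρ (c ρ) := by
  refine exists_bad_round (f := roundFn m D base) (q := truePoly m D base)
    (z := roundPt m D c) (g := fun ρ => cubic (g ρ)) (cl := claim c g) (x := roundVar m D)
    (σ := roundSubst m D) (kind := roundKind m D) ?_ ?_ ?_ ?_ ?_ ?_ ?_
  · intro j hj y
    rw [eval_truePoly hbase hj, eval_truePoly hbase hj, roundFn_of_lt m D base hj]
  · exact fun j hj y t => eval_truePoly hbase hj y t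
  · exact fun j hj => roundPt_succ m D c hj
  · intro j hj
    rw [eval_cubic, claim, if_neg (Nat.succ_ne_zero j), Nat.add_sub_cancel]
  · intro j hj
    rw [eval_cubic, eval_cubic]
    exact H.1 j hj
  · rw [roundFn_last]; exact H.2
  · rw [roundPt_zero, claim, if_pos rfl]; exact h0

/-- The checks succeed if Merlin sends the true polynomials of a true claim. -/
lemma fieldChecks_true {base : (ℕ → K) → K} (hbase : ∀ y < numVars m D, AffineAt base y)
    (c : ℕ → K) (h0 : roundFn m D base 0 (fun _ => 0) = 1) :
    FieldChecks m D c (fun ρ => (truePoly m D base ρ (roundPt m D c ρ)).coeff)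
      (base (roundPt m D c (numRounds m D))) := by
  have heval (ρ : ℕ) (s : K) : evalCubic (truePoly m D base ρ (roundPt m D c ρ)).coeff s =
      (truePoly m D base ρ (roundPt m D c ρ)).eval s := by
    rw [← eval_cubic, cubic_coeff (natDegree_truePoly _ _ _)]
  have hclaim (ρ : ℕ) (hρ : ρ ≤ numRounds m D) :
      claim c (fun ρ => (truePoly m D base ρ (roundPt m D c ρ)).coeff) ρ =
        roundFn m D base ρ (roundPt m D c ρ) := by
    cases ρ with
    | zero => rw [claim, if_pos rfl, roundPt_zero, h0]
    | succ ρ => rw [claim, if_neg (Nat.succ_ne_zero ρ), Nat.add_sub_cancel, heval,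
        eval_truePoly hbase hρ, ← roundPt_succ m D c hρ]
  refine ⟨fun ρ hρ => ?_, ?_⟩
  · rw [hclaim ρ hρ.le, heval, heval, eval_truePoly hbase hρ, eval_truePoly hbase hρ,
      roundFn_of_lt m D base hρ]
  · rw [hclaim _ le_rfl, roundFn_last]

open Classical in
/-- The initial claim. -/
lemma roundFn_zero_eq_one_iff {G : ℕ → ℕ → ℕ → Prop} (hG : ∀ i u v, G i u v → v < 2 ^ m) :
    roundFn m D (layerExt m D fun i u v => if G i u v then (1 : K) else 0) 0 (fun _ => 0) = 1 ↔
      Walk G 0 (2 ^ D) 0 0 := by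
  have h := stageTrue_iff_walk (K := K) (D := D) hG (Nat.zero_le D) fun _ => false
  have h0 : (boolPt (fun _ => false) : ℕ → K) = fun _ => 0 := by ext; simp [boolPt]
  simpa [StageTrue, h0, bitsNum] using h

end Repetition

/-! ### The relation of a branching program -/

namespace BranchingProgram

variable {n W T : ℕ} (P : BranchingProgram n W T) (x : Fin n → Bool)

/-- The usable edges, with loops beyond the last layer. -/
def Step (i u v : ℕ) : Prop :=
  (∃ (hi : i < T - 1) (hu : u < W) (hv : v < W),
    P.edge ⟨i, hi⟩ ⟨u, hu⟩ ⟨v, hv⟩ (x (P.var ⟨i, hi⟩)) = true) ∨ (T - 1 ≤ i ∧ u < W ∧ u = v)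

lemma Step.lt {P : BranchingProgram n W T} {x : Fin n → Bool} {i u v : ℕ} (h : P.Step x i u v) :
    v < W := by
  rcases h with ⟨_, _, hv, _⟩ | ⟨_, hu, rfl⟩
  exacts [hv, hu]

lemma walk_step_iff_accepts [NeZero W] [NeZero T] {D : ℕ} (hD : T ≤ 2 ^ D) :
    Walk (P.Step x) 0 (2 ^ D) 0 0 ↔ P.Accepts x := by
  have hT := NeZero.pos T
  have hW := NeZero.pos W
  have hpad (u v : ℕ) (hu : u < W) :
      Walk (P.Step x) (0 + (T - 1)) (2 ^ D - (T - 1)) u v ↔ u = v := by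
    refine walk_padding (W := W) (fun j hj u v => ⟨?_, fun h => .inr ⟨by lia, h.1, h.2⟩⟩) hu
    rintro (⟨hi, _⟩ | h)
    · lia
    · exact h.2
  have hsplit : 2 ^ D = (T - 1) + (2 ^ D - (T - 1)) := by lia
  rw [hsplit, walk_add]
  constructor
  · rintro ⟨w, h1, h2⟩
    have hw : w < W := by
      rcases Nat.eq_zero_or_pos (T - 1) with h | h
      · obtain ⟨f, h0, hw, -⟩ := h1
        rw [h] at hw
        lia
      · exact h1.last_lt (fun _ _ _ h => h.lt) h
    obtain rfl := (hpad w 0 hw).1 h2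
    obtain ⟨f, h0, hl, hf⟩ := h1
    have hlt : ∀ j, f j < W ∨ T - 1 < j := by
      intro j
      by_cases hj : T - 1 < j
      · exact .inr hj
      rcases Nat.lt_or_ge j (T - 1) with h | h
      · rcases hf j h with ⟨_, hu, _⟩ | ⟨_, hu, _⟩
        exacts [.inl hu, .inl hu]
      · obtain rfl : j = T - 1 := by lia
        left; lia
    refine ⟨fun j => ⟨f j, (hlt j).resolve_right (by lia)⟩, Fin.ext (by simpa using h0),
      Fin.ext (by simpa using hl), fun i => ?_⟩
    rcases hf i i.2 with ⟨_, _, _, h⟩ | ⟨h, -⟩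
    · simpa only [zero_add] using h
    · have := i.2; lia
  · rintro ⟨path, h0, hl, h⟩
    refine ⟨0, ⟨fun j => if hj : j < T then path ⟨j, hj⟩ else 0, ?_, ?_, fun j hj => .inl ?_⟩,
      (hpad 0 0 hW).2 rfl⟩
    · simp [hT, h0]
    · simp [show T - 1 < T by lia, hl]
    · refine ⟨by lia, ?_, ?_, ?_⟩
      · simp [show j < T by lia]
      · simp [show j + 1 < T by lia]
      · have := h ⟨j, hj⟩
        simpa [show j < T by lia, show j + 1 < T by lia] using this

end BranchingProgram

/-! ### Memory contents -/

/-- The memory holding a list. -/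
def cells (l : List ℕ) (i : ℕ) : ℕ := l.getD i 0

lemma cells_append_left {l l' : List ℕ} {i : ℕ} (h : i < l.length) :
    cells (l ++ l') i = cells l i := List.getD_append _ _ _ _ h

lemma cells_append_right (l l' : List ℕ) (i : ℕ) : cells (l ++ l') (l.length + i) = cells l' i := by
  rw [cells, List.getD_append_right _ _ _ _ (by lia), Nat.add_sub_cancel_left, cells]

lemma cells_ofFn {n : ℕ} (f : Fin n → ℕ) (i : Fin n) : cells (List.ofFn f) i = f i := by
  rw [cells, List.getD_eq_getElem _ _ (by simp)]
  simp

lemma length_flatten_ofFn {r m : ℕ} {f : Fin r → List ℕ} (hf : ∀ i, (f i).length = m) :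
    (List.ofFn f).flatten.length = r * m := by
  induction r with
  | zero => simp
  | succ r ih =>
    rw [List.ofFn_succ, List.flatten_cons, List.length_append, ih fun i => hf _, hf]
    ring

lemma cells_flatten_ofFn {r m : ℕ} {f : Fin r → List ℕ} (hf : ∀ i, (f i).length = m) (i : Fin r)
    {j : ℕ} (hj : j < m) : cells (List.ofFn f).flatten (i * m + j) = cells (f i) j := by
  induction r with
  | zero => exact i.elim0
  | succ r ih =>
    rw [List.ofFn_succ, List.flatten_cons]
    refine Fin.cases ?_ (fun i => ?_) i
    · rw [Fin.val_zero, zero_mul, zero_add, cells_append_left (by rw [hf]; exact hj)]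
    · have e : (i.succ : ℕ) * m + j = (f 0).length + (i * m + j) := by
        rw [Fin.val_succ, hf]; ring
      rw [e, cells_append_right, ih (fun i => hf _) i]

/-- The bit `j` of the block `i`. -/
def blockBit {n l : ℕ} (x : Fin n → Fin l → Bool) (i j : ℕ) : Bool :=
  if h : i < n ∧ j < l then x ⟨i, h.1⟩ ⟨j, h.2⟩ else false

lemma blockBit_eq {n l : ℕ} (x : Fin n → Fin l → Bool) {i j : ℕ} (hi : i < n) (hj : j < l) :
    blockBit x i j = x ⟨i, hi⟩ ⟨j, hj⟩ := dif_pos ⟨hi, hj⟩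

lemma length_bitList {n : ℕ} (x : Fin n → Bool) : (bitList x).length = n := List.length_ofFn

lemma length_blockList {n l : ℕ} (x : Fin n → Fin l → Bool) : (blockList x).length = n * l :=
  length_flatten_ofFn fun _ => length_bitList _

lemma cells_bitList {n : ℕ} (x : Fin n → Bool) {i : ℕ} (hi : i < n) :
    cells (bitList x) i = (x ⟨i, hi⟩).toNat := cells_ofFn _ ⟨i, hi⟩

lemma cells_blockList {n l : ℕ} (x : Fin n → Fin l → Bool) {i j : ℕ} (hi : i < n) (hj : j < l) :
    cells (blockList x) (i * l + j) = (blockBit x i j).toNat := by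
  rw [blockList, cells_flatten_ofFn (fun _ => length_bitList _) ⟨i, hi⟩ hj, cells_bitList _ hj,
    blockBit_eq x hi hj]

lemma bitVal_eq {I : ℕ → ℕ} {off n : ℕ} {y : ℕ → Bool} (h : ∀ j < n, I (off + j) = (y j).toNat) :
    bitVal I off n = bitsNum n y := by
  rw [bitVal, bitsNum, Nat.cast_sum]
  refine Finset.sum_congr rfl fun j hj => ?_
  rw [h j (Finset.mem_range.1 hj)]
  push_cast
  rfl

section Encoding

variable {a b W T : ℕ} (P : BranchingProgram (a + b) W T) (k : ℕ)

lemma length_commonInput (l : List ℕ) :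
    (commonInput P k).length = commonLen (cells (commonInput P k ++ l)) := by
  have h : (commonInput P k).length = 5 + ((T - 1) + (T - 1) * (W * (W * 2))) := by
    rw [commonInput, List.length_append, BranchingProgram.encode, List.length_append,
      List.length_ofFn]
    congr 2
    exact length_flatten_ofFn fun i => length_flatten_ofFn fun u => length_flatten_ofFn fun v => rfl
  rw [h]
  change _ = 5 + (T - 1) + (T - 1) * W * W * 2
  ring

lemma cells_common_add (l : List ℕ) (i : ℕ) : cells (commonInput P k ++ l)
    (commonLen (cells (commonInput P k ++ l)) + i) = cells l i := by
  rw [← length_commonInput, cells_append_right]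

lemma cells_var (l : List ℕ) (i : Fin (T - 1)) :
    cells (commonInput P k ++ l) (5 + i) = P.var i := by
  rw [commonInput, BranchingProgram.encode, List.append_assoc, List.append_assoc]
  have h := cells_append_right [a, b, W, T, k] ((List.ofFn fun i => (P.var i : ℕ)) ++
    ((List.ofFn fun i => (List.ofFn fun u => (List.ofFn fun v =>
      [(P.edge i u v false).toNat, (P.edge i u v true).toNat]).flatten).flatten).flatten ++ l)) i
  rw [cells_append_left (l := List.ofFn fun i => (P.var i : ℕ)) (by simp),
    cells_ofFn (fun i => (P.var i : ℕ))] at h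
  exact h

lemma hasEdge_cells (l : List ℕ) (i : Fin (T - 1)) (u v : Fin W) (c : Bool) :
    HasEdge (cells (commonInput P k ++ l)) i u v c.toNat ↔ P.edge i u v c = true := by
  change cells (commonInput P k ++ l) (5 + (T - 1) + (((i * W + u) * W + v) * 2 + c.toNat)) = 1 ↔ _
  have h := cells_append_right ([a, b, W, T, k] ++ (List.ofFn fun i => (P.var i : ℕ)))
    ((List.ofFn fun i => (List.ofFn fun u => (List.ofFn fun v =>
      [(P.edge i u v false).toNat, (P.edge i u v true).toNat]).flatten).flatten).flatten ++ l)
    (((i * W + u) * W + v) * 2 + c.toNat)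
  rw [List.length_append, List.length_ofFn, List.append_assoc] at h
  rw [commonInput, BranchingProgram.encode, List.append_assoc, List.append_assoc]
  refine (Eq.congr_left h).trans ?_
  have hc : c.toNat < 2 := by cases c <;> simp
  have hlt {w r e : ℕ} (v : Fin w) (he : e < r) : (v : ℕ) * r + e < w * r := by
    have := Nat.mul_le_mul_right r (Nat.succ_le_of_lt v.2)
    rw [Nat.succ_mul] at this
    lia
  have e : ((i * W + u) * W + v) * 2 + c.toNat =
      i * (W * (W * 2)) + (u * (W * 2) + (v * 2 + c.toNat)) := by ring
  have h1 (i : Fin (T - 1)) (u v : Fin W) :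
      [(P.edge i u v false).toNat, (P.edge i u v true).toNat].length = 2 := rfl
  have h2 (i : Fin (T - 1)) (u : Fin W) := length_flatten_ofFn (h1 i u)
  have h3 (i : Fin (T - 1)) := length_flatten_ofFn (h2 i)
  rw [cells_append_left, e, cells_flatten_ofFn h3 i (hlt u (hlt v hc)),
    cells_flatten_ofFn (h2 i) u (hlt v hc), cells_flatten_ofFn (h1 i u) v hc]
  · cases c <;> simp [cells]
  · rw [length_flatten_ofFn h3, e]
    exact hlt i (hlt u (hlt v hc))

variable (xA : Fin a → Bool) (xB : Fin b → Bool) (l l' : List ℕ)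

/-- Each usable edge is known to exactly one of the parties. -/
lemma edges_add {K : Type} [CommRing K] (i u v : ℕ) :
    (open Classical in
      (if AliceEdge (cells (commonInput P k ++ (bitList xA ++ l))) i u v then (1 : K) else 0) +
      (if BobEdge (cells (commonInput P k ++ (bitList xB ++ l'))) i u v then 1 else 0)) =
    open Classical in if P.Step (Fin.append xA xB) i u v then 1 else 0 := by
  classical
  set I := cells (commonInput P k ++ (bitList xA ++ l)) with hI
  set J := cells (commonInput P k ++ (bitList xB ++ l')) with hJ
  have hA : AliceEdge I i u v ↔ (i < T - 1 ∧ u < W ∧ v < W ∧ I (5 + i) < a ∧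
      HasEdge I i u v (I (commonLen I + I (5 + i)))) ∨ (T - 1 ≤ i ∧ u < W ∧ u = v) := Iff.rfl
  have hB : BobEdge J i u v ↔ i < T - 1 ∧ u < W ∧ v < W ∧ a ≤ J (5 + i) ∧
      HasEdge J i u v (J (commonLen J + (J (5 + i) - a))) := Iff.rfl
  by_cases h : i < T - 1 ∧ u < W ∧ v < W
  · obtain ⟨hi, hu, hv⟩ := h
    have hIv : I (5 + i) = P.var ⟨i, hi⟩ := cells_var P k _ ⟨i, hi⟩
    have hJv : J (5 + i) = P.var ⟨i, hi⟩ := cells_var P k _ ⟨i, hi⟩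
    have hS : P.Step (Fin.append xA xB) i u v ↔ P.edge ⟨i, hi⟩ ⟨u, hu⟩ ⟨v, hv⟩
        (Fin.append xA xB (P.var ⟨i, hi⟩)) = true := by
      refine ⟨?_, fun h => .inl ⟨hi, hu, hv, h⟩⟩
      rintro (⟨_, _, _, h⟩ | h)
      · exact h
      · lia
    rcases Nat.lt_or_ge (P.var ⟨i, hi⟩) a with hlt | hge
    · have hx : Fin.append xA xB (P.var ⟨i, hi⟩) = xA ⟨P.var ⟨i, hi⟩, hlt⟩ :=
        Fin.append_left xA xB ⟨P.var ⟨i, hi⟩, hlt⟩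
      have hA' : AliceEdge I i u v ↔ P.Step (Fin.append xA xB) i u v := by
        have h1 : I (commonLen I + I (5 + i)) = (xA ⟨P.var ⟨i, hi⟩, hlt⟩).toNat := by
          rw [hIv, hI, cells_common_add, cells_append_left (by rw [length_bitList]; exact hlt),
            cells_bitList xA hlt]
        rw [hA, hS, hx, h1, hIv]
        have h2 := hasEdge_cells P k (bitList xA ++ l) ⟨i, hi⟩ ⟨u, hu⟩ ⟨v, hv⟩
          (xA ⟨P.var ⟨i, hi⟩, hlt⟩)
        rw [← h2]
        refine ⟨?_, fun h => .inl ⟨hi, hu, hv, hlt, h⟩⟩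
        rintro (h | h)
        · exact h.2.2.2.2
        · lia
      have hB' : ¬ BobEdge J i u v := by
        rw [hB, hJv]; lia
      rw [if_neg hB', add_zero]
      exact if_congr hA' rfl rfl
    · have hx : Fin.append xA xB (P.var ⟨i, hi⟩) =
          xB ⟨P.var ⟨i, hi⟩ - a, by have := (P.var ⟨i, hi⟩).2; lia⟩ := by
        rw [← Fin.append_right xA xB]
        congr 1
        ext
        simp
        lia
      have hB' : BobEdge J i u v ↔ P.Step (Fin.append xA xB) i u v := by
        have hlt : (P.var ⟨i, hi⟩ : ℕ) - a < b := by have := (P.var ⟨i, hi⟩).2; lia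
        have h1 : J (commonLen J + (J (5 + i) - a)) = (xB ⟨P.var ⟨i, hi⟩ - a, hlt⟩).toNat := by
          rw [hJv, hJ, cells_common_add, cells_append_left (by rw [length_bitList]; exact hlt),
            cells_bitList xB hlt]
        rw [hB, hS, hx, h1, hJv]
        have h2 := hasEdge_cells P k (bitList xB ++ l') ⟨i, hi⟩ ⟨u, hu⟩ ⟨v, hv⟩
          (xB ⟨P.var ⟨i, hi⟩ - a, hlt⟩)
        rw [← h2]
        exact ⟨fun h => h.2.2.2.2, fun h => ⟨hi, hu, hv, hge, h⟩⟩
      have hA' : ¬ AliceEdge I i u v := by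
        rw [hA, hIv]; lia
      rw [if_neg hA', zero_add]
      exact if_congr hB' rfl rfl
  · have hB' : ¬ BobEdge J i u v := by rw [hB]; tauto
    have hAS : AliceEdge I i u v ↔ P.Step (Fin.append xA xB) i u v := by
      rw [hA, BranchingProgram.Step]
      constructor
      · rintro (h' | h')
        · tauto
        · exact .inr h'
      · rintro (⟨h1, h2, h3, -⟩ | h')
        · tauto
        · exact .inr h'
    rw [if_neg hB', add_zero]
    exact if_congr hAS rfl rfl

end Encoding

/-! ### The protocol -/

section Protocol

variable {a b W T : ℕ}

/-- The number of repetitions, for width `W` and length `T`. -/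
abbrev numRep (W T k : ℕ) : ℕ := repetitions (Nat.clog 2 W) (Nat.clog 2 T) k

/-- The number of rounds of a repetition, for width `W` and length `T`. -/
abbrev repLen (W T : ℕ) : ℕ := numRounds (Nat.clog 2 W) (Nat.clog 2 T)

/-- The number of coins per round, for width `W` and length `T`. -/
abbrev coinSize (W T : ℕ) : ℕ := fieldBits (Nat.clog 2 W) (Nat.clog 2 T)

/-- The predecessor of the characteristic, for width `W` and length `T`. -/
noncomputable abbrev charPred (W T : ℕ) : ℕ := fieldPred (Nat.clog 2 W) (Nat.clog 2 T)

/-- The field of the arithmetization, for width `W` and length `T`. -/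
abbrev CoinField (W T : ℕ) : Type := ZMod (charPred W T + 1)

instance (m D : ℕ) : Fact (fieldPred m D + 1).Prime := ⟨(fieldPred_spec m D).2.2⟩

/-- The coins from round `off` on, as field elements. -/
def coinSeq (K : Type) [CommRing K] {n l : ℕ} (c : Fin n → Fin l → Bool) (off ρ : ℕ) : K :=
  (bitsNum l (blockBit c (off + ρ)) : ℕ)

/-- The coefficients, of `s` bits each, of the polynomials which Merlin sends from round `off` on.
    -/
def coefSeq (K : Type) [CommRing K] {n l : ℕ} (s : ℕ) (msg : Fin n → Fin l → Bool) (off ρ i : ℕ) : K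
    :=
  (bitsNum s (fun j => blockBit msg (off + ρ) (i * s + j)) : ℕ)

lemma mul_add_lt {r R q ρ : ℕ} (hq : q < r) (hρ : ρ < R) : q * R + ρ < r * R := by
  have := Nat.mul_le_mul_right R (Nat.succ_le_of_lt hq)
  rw [Nat.succ_mul] at this
  lia

lemma cells_append_right' {l : List ℕ} {n : ℕ} (h : l.length = n) (l' : List ℕ) (i : ℕ) :
    cells (l ++ l') (n + i) = cells l' i := by
  rw [← h, cells_append_right]

variable (P : BranchingProgram (a + b) W T) (k : ℕ) (xA : Fin a → Bool) (xB : Fin b → Bool)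

variable (msg : Fin (numRep W T k * repLen W T) → Fin (4 * (coinSize W T + 1)) → Bool)
    (c : Fin (numRep W T k * repLen W T) → Fin (coinSize W T) → Bool)
  (y : Fin (numRep W T k * (coinSize W T + 1)) → Bool)

/-- Alice's input. -/
def aliceCells : ℕ → ℕ :=
  cells (commonInput P k ++ (bitList xA ++ (blockList msg ++ (blockList c ++ bitList y))))

/-- Bob's input. -/
def bobCells : ℕ → ℕ := cells (commonInput P k ++ (bitList xB ++ blockList c))

/-- Bob's message: for each repetition the residue of his contribution to the base function. -/
noncomputable def bobMessage (i : Fin (numRep W T k * (coinSize W T + 1))) : Bool :=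
  decide (bobBit (bobCells P k xB c) i = 1)

open Classical in
/-- The protocol in which the parties compute their messages and decisions from their inputs as they
are given to their programs. -/
noncomputable def BranchingProgram.protocol : IPProtocol a b where
  rounds := numRep W T k * repLen W T
  msgLen := 4 * (coinSize W T + 1)
  coinLen := coinSize W T
  bobLen := numRep W T k * (coinSize W T + 1)
  bob xB c := bobMessage P k xB c
  alice xA msg c y := decide (AliceAccepts (aliceCells P k xA msg c y))

lemma coinVal_alice {q ρ : ℕ} (hq : q < numRep W T k) (hρ : ρ < repLen W T) :
    coinVal (aliceCells P k xA msg c y) (aliceCoinOff (aliceCells P k xA msg c y)) q ρ =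
      bitsNum (coinSize W T) (blockBit c (q * repLen W T + ρ)) := by
  refine bitVal_eq fun j (hj : j < coinSize W T) => ?_
  change cells _ (commonLen (cells (commonInput P k ++ (bitList xA ++ (blockList msg ++
    (blockList c ++ bitList y))))) + a + numRep W T k * repLen W T * (4 * (coinSize W T + 1)) +
        (q * repLen W T + ρ) * coinSize W T + j) = _
  have hlt := mul_add_lt (mul_add_lt hq hρ) hj
  rw [add_assoc _ _ j, add_assoc, add_assoc, cells_common_add,
    cells_append_right' (length_bitList xA), cells_append_right' (length_blockList msg),
    cells_append_left (by rw [length_blockList]; exact hlt),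
    cells_blockList c (mul_add_lt hq hρ) hj]

lemma coefVal_alice {q ρ i : ℕ} (hq : q < numRep W T k) (hρ : ρ < repLen W T) (hi : i < 4) :
    coefVal (aliceCells P k xA msg c y) q ρ i =
      bitsNum (coinSize W T + 1) (fun j => blockBit msg (q * repLen W T + ρ)
          (i * (coinSize W T + 1) + j)) := by
  refine bitVal_eq fun j (hj : j < coinSize W T + 1) => ?_
  change cells _ (commonLen (cells (commonInput P k ++ (bitList xA ++ (blockList msg ++
    (blockList c ++ bitList y))))) + a + (q * repLen W T + ρ) * (4 * (coinSize W T + 1)) + i *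
        (coinSize W T + 1) + j) = _
  have hlt := mul_add_lt (mul_add_lt hq hρ) (mul_add_lt hi hj)
  rw [add_assoc _ _ j, add_assoc, add_assoc, cells_common_add,
    cells_append_right' (length_bitList xA),
    cells_append_left (by rw [length_blockList]; exact hlt),
    cells_blockList msg (mul_add_lt hq hρ) (mul_add_lt hi hj)]

lemma coinVal_bob {q ρ : ℕ} (hq : q < numRep W T k) (hρ : ρ < repLen W T) :
    coinVal (bobCells P k xB c) (commonLen (bobCells P k xB c) + b) q ρ =
      bitsNum (coinSize W T) (blockBit c (q * repLen W T + ρ)) := by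
  refine bitVal_eq fun j (hj : j < coinSize W T) => ?_
  change cells _ (commonLen (cells (commonInput P k ++ (bitList xB ++ blockList c))) + b +
    (q * repLen W T + ρ) * coinSize W T + j) = _
  rw [add_assoc _ _ j, add_assoc, cells_common_add, cells_append_right' (length_bitList xB),
    cells_blockList c (mul_add_lt hq hρ) hj]

lemma answerVal_alice {q : ℕ} (hq : q < numRep W T k) : answerVal (aliceCells P k xA msg c y) q =
    bitsNum (coinSize W T + 1) (fun j => if h : q * (coinSize W T + 1) + j < numRep W T k *
        (coinSize W T + 1) then y ⟨_, h⟩ else false) := by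
  refine bitVal_eq fun j (hj : j < coinSize W T + 1) => ?_
  change cells _ (commonLen (cells (commonInput P k ++ (bitList xA ++ (blockList msg ++
    (blockList c ++ bitList y))))) + a + numRep W T k * repLen W T * (4 * (coinSize W T + 1)) +
        numRep W T k * repLen W T * coinSize W T + q * (coinSize W T + 1) + j) = _
  have hlt := mul_add_lt hq hj
  rw [add_assoc _ _ j, add_assoc, add_assoc, add_assoc, cells_common_add,
    cells_append_right' (length_bitList xA), cells_append_right' (length_blockList msg),
    cells_append_right' (length_blockList c), cells_bitList y hlt, dif_pos hlt]

lemma bobBit_mul_add (I : ℕ → ℕ) (q : ℕ) {j : ℕ} (hj : j < wordLen I + 1) :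
    bobBit I (q * (wordLen I + 1) + j) =
      (bobVal I q % (modPred I + 1 : ℕ)).toNat / 2 ^ j % 2 := by
  rw [bobBit, mul_comm q, Nat.mul_add_div (Nat.succ_pos _), Nat.div_eq_of_lt hj, add_zero,
    Nat.mul_add_mod, Nat.mod_eq_of_lt hj]

/-- Alice reads the residue which Bob has computed. -/
lemma answerVal_bob {q : ℕ} (hq : q < numRep W T k) :
    ((answerVal (aliceCells P k xA msg c (bobMessage P k xB c)) q : ℤ) : CoinField W T) =
      ((bobVal (bobCells P k xB c) q : ℤ) : CoinField W T) := by
  set N := (bobVal (bobCells P k xB c) q % (charPred W T + 1 : ℕ)).toNat with hN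
  have hlt : N < 2 ^ (coinSize W T + 1) := by
    have h1 := Int.emod_lt_of_pos (bobVal (bobCells P k xB c) q) (b := (charPred W T + 1 : ℕ))
      (by positivity)
    have h2 := (fieldPred_spec (Nat.clog 2 W) (Nat.clog 2 T)).1
    rw [pow_succ]
    lia
  rw [answerVal_alice P k xA msg c _ hq, bitsNum_congr (y' := fun j => N.testBit j),
    bitsNum_testBit hlt, ZMod.intCast_eq_intCast_iff]
  · exact RAM.PCZ.toNat_modEq _ _
  · intro j hj
    rw [dif_pos (mul_add_lt hq hj)]
    change decide (bobBit (bobCells P k xB c) (q * (coinSize W T + 1) + j) = 1) = _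
    have h : bobBit (bobCells P k xB c) (q * (coinSize W T + 1) + j) = N / 2 ^ j % 2 :=
      bobBit_mul_add _ q hj
    rw [Nat.testBit_eq_decide_div_mod_eq, h]

open Classical in
/-- The base function of the interactive proof: the multilinear extension of the step relation of
`P`. -/
noncomputable def BranchingProgram.base : (ℕ → CoinField W T) → CoinField W T :=
  layerExt (Nat.clog 2 W) (Nat.clog 2 T) fun i u v => if P.Step (Fin.append xA xB) i u v then 1 else
      0

/-- Alice's decision, in terms of the field. -/
lemma verdict_iff (M : (P.protocol k).Merlin)
    (c : Fin (numRep W T k * repLen W T) → Fin (coinSize W T) → Bool) :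
    (P.protocol k).verdict xA xB M c = true ↔ ∀ q < numRep W T k, FieldChecks (Nat.clog 2 W)
        (Nat.clog 2 T)
      (coinSeq (CoinField W T) c (q * repLen W T)) (coefSeq (CoinField W T)
          (n := numRep W T k * repLen W T) (l := 4 * (coinSize W T + 1)) (coinSize W T + 1)
          (M.msg c) (q * repLen W T))
      (P.base xA xB (roundPt (Nat.clog 2 W) (Nat.clog 2 T)
          (coinSeq (CoinField W T) c (q * repLen W T)) (repLen W T))) := by
  classical
  set y := bobMessage P k xB c with hy
  set msg : Fin (numRep W T k * repLen W T) → Fin (4 * (coinSize W T + 1)) → Bool := M.msg c with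
      hmsg
  have h1 : (P.protocol k).verdict xA xB M c = true ↔ AliceAccepts (aliceCells P k xA msg c y) :=
    decide_eq_true_iff
  rw [h1]
  refine forall₂_congr fun q hq => ?_
  have hq : q < numRep W T k := hq
  change Checks (Nat.clog 2 W) (Nat.clog 2 T) (charPred W T + 1) _ _ _ ↔ _
  refine checks_iff.trans ?_
  set I := aliceCells P k xA msg c y with hI
  set J := bobCells P k xB c with hJ
  have hcA : ∀ ρ < repLen W T, ((coinVal I (aliceCoinOff I) q ρ : ℤ) : CoinField W T) = coinSeq
      (CoinField W T) c (q * repLen W T) ρ :=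
    fun ρ hρ => by rw [hI, coinVal_alice P k xA msg c y hq hρ, coinSeq, Int.cast_natCast]
  have hcB : ∀ ρ < repLen W T, ((coinVal J (commonLen J + b) q ρ : ℤ) : CoinField W T) =
      coinSeq (CoinField W T) c (q * repLen W T) ρ :=
    fun ρ hρ => by rw [hJ, coinVal_bob P k xB c hq hρ, coinSeq, Int.cast_natCast]
  have hg : ∀ ρ < repLen W T, ∀ i < 4, ((coefVal I q ρ i : ℤ) : CoinField W T) =
      coefSeq (CoinField W T) (l := 4 * (coinSize W T + 1)) (coinSize W T + 1) msg (q * repLen W T)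
          ρ i :=
    fun ρ hρ i hi => by
      rw [hI, coefVal_alice P k xA msg c y hq hρ hi, coefSeq, Int.cast_natCast]
  have hpt (z : ℕ → ℤ) (hz : ∀ ρ < repLen W T, ((z ρ : ℤ) : CoinField W T) = coinSeq (CoinField W T)
      c (q * repLen W T) ρ) :
      (fun x => Int.castRingHom (CoinField W T) (roundPt (Nat.clog 2 W) (Nat.clog 2 T) z
          (repLen W T) x)) =
        roundPt (Nat.clog 2 W) (Nat.clog 2 T) (coinSeq (CoinField W T) c (q * repLen W T))
            (repLen W T) := by
    rw [← roundPt_congr le_rfl hz]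
    ext x
    exact map_roundPt (Nat.clog 2 W) (Nat.clog 2 T) z (Int.castRingHom (CoinField W T)) (repLen W T)
        x
  have hB : ((layerExt (Nat.clog 2 W) (Nat.clog 2 T)
      (fun i u v => if AliceEdge I i u v then 1 else 0)
      (roundPt (Nat.clog 2 W) (Nat.clog 2 T) (coinVal I (aliceCoinOff I) q) (repLen W T)) +
          answerVal I q : ℤ) : CoinField W T) =
      P.base xA xB (roundPt (Nat.clog 2 W) (Nat.clog 2 T)
          (coinSeq (CoinField W T) c (q * repLen W T)) (repLen W T)) := by
    rw [Int.cast_add, hI, hy, answerVal_bob P k xA xB msg c hq, ← hy, ← hI, ← hJ]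
    have e1 := map_layerExt (Int.castRingHom (CoinField W T)) (Nat.clog 2 W) (Nat.clog 2 T)
      (fun i u v => if AliceEdge I i u v then 1 else 0)
      (roundPt (Nat.clog 2 W) (Nat.clog 2 T) (coinVal I (aliceCoinOff I) q) (repLen W T))
    have e2 := map_layerExt (Int.castRingHom (CoinField W T)) (Nat.clog 2 W) (Nat.clog 2 T)
      (fun i u v => if BobEdge J i u v then 1 else 0)
      (roundPt (Nat.clog 2 W) (Nat.clog 2 T) (coinVal J (commonLen J + b) q) (repLen W T))
    rw [hpt _ hcA] at e1
    rw [hpt _ hcB] at e2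
    have e3 : ((bobVal J q : ℤ) : CoinField W T) = _ := e2
    rw [e3]
    refine (congrArg (· + _) e1).trans ?_
    rw [← layerExt_add, BranchingProgram.base]
    congr 1
    ext i u v
    simp only [apply_ite (Int.castRingHom (CoinField W T)), map_one, map_zero]
    exact edges_add P k xA xB _ _ i u v
  constructor
  · intro H
    have H' := H.congr (c' := coinSeq (CoinField W T) c (q * repLen W T))
      (g' := coefSeq (CoinField W T) (l := 4 * (coinSize W T + 1)) (coinSize W T + 1) msg
          (q * repLen W T)) (fun ρ hρ => (hcA ρ hρ).symm)
      (fun ρ hρ i hi => (hg ρ hρ i hi).symm)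
    rw [← hB]
    exact H'
  · intro H
    rw [← hB] at H
    exact H.congr hcA hg

end Protocol

/-! ### Completeness -/

section Correctness

variable {a b W T : ℕ}

section General

variable {K : Type} [CommRing K] {n l : ℕ}

lemma blockBit_congr {c d : Fin n → Fin l → Bool} {i : ℕ}
    (h : ∀ hi : i < n, c ⟨i, hi⟩ = d ⟨i, hi⟩) : blockBit c i = blockBit d i := by
  ext j
  simp only [blockBit]
  split_ifs with hij
  · rw [h hij.1]
  · rfl

lemma coinSeq_congr {c d : Fin n → Fin l → Bool} {off ρ : ℕ}
    (h : ∀ hi : off + ρ < n, c ⟨off + ρ, hi⟩ = d ⟨off + ρ, hi⟩) :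
    coinSeq K c off ρ = coinSeq K d off ρ := by
  rw [coinSeq, coinSeq, blockBit_congr h]

lemma coefSeq_congr {s : ℕ} {c d : Fin n → Fin l → Bool} {off ρ : ℕ}
    (h : ∀ hi : off + ρ < n, c ⟨off + ρ, hi⟩ = d ⟨off + ρ, hi⟩) :
    coefSeq K s c off ρ = coefSeq K s d off ρ := by
  ext i
  rw [coefSeq, coefSeq, blockBit_congr h]

end General

variable (P : BranchingProgram (a + b) W T) (k : ℕ) (xA : Fin a → Bool) (xB : Fin b → Bool)

lemma affineAt_base (y : ℕ) : AffineAt (P.base xA xB) y := affineAt_layerExt _ _ _ _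

lemma roundFn_base_iff [NeZero W] [NeZero T] :
    roundFn (Nat.clog 2 W) (Nat.clog 2 T) (P.base xA xB) 0 (fun _ => 0) = 1 ↔
      P.Accepts (Fin.append xA xB) := by
  rw [← P.walk_step_iff_accepts _ (Nat.le_pow_clog one_lt_two T)]
  exact roundFn_zero_eq_one_iff fun i u v h => h.lt.trans_le (Nat.le_pow_clog one_lt_two W)

/-- The coefficients which an honest Merlin sends in round `ρ` of the repetition `q`. -/
noncomputable def honestCoef (c : Fin (numRep W T k * repLen W T) → Fin (coinSize W T) → Bool)
    (q ρ i : ℕ) : ℕ :=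
  ((truePoly (Nat.clog 2 W) (Nat.clog 2 T) (P.base xA xB) ρ (roundPt (Nat.clog 2 W) (Nat.clog 2 T)
    (coinSeq (CoinField W T) c (q * repLen W T)) ρ)).coeff i).val

lemma honestCoef_congr {c d : Fin (numRep W T k * repLen W T) → Fin (coinSize W T) → Bool}
    {q ρ : ℕ} (hρ : ρ ≤ repLen W T) (h : ∀ j : Fin (numRep W T k * repLen W T),
      (j : ℕ) < q * repLen W T + ρ → c j = d j) :
    honestCoef P k xA xB c q ρ = honestCoef P k xA xB d q ρ := by
  ext e
  unfold honestCoef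
  rw [roundPt_congr hρ fun j hj => coinSeq_congr fun _ => h _ (Nat.add_lt_add_left hj _)]

/-- The honest Merlin. -/
noncomputable def honestMerlin : (P.protocol k).Merlin where
  msg c i j := (honestCoef P k xA xB c (i / repLen W T) (i % repLen W T)
    (j / (coinSize W T + 1))).testBit (j % (coinSize W T + 1))
  causal := by
    intro i c d h
    have hi : (i : ℕ) < numRep W T k * repLen W T := i.2
    have hR : 0 < repLen W T := Nat.pos_of_mul_pos_left (Nat.zero_lt_of_lt hi)
    have e := Nat.div_add_mod' (i : ℕ) (repLen W T)
    ext j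
    rw [honestCoef_congr P k xA xB (d := d) (Nat.mod_lt _ hR).le fun j hj =>
      h j (Fin.lt_def.2 (by rwa [e] at hj))]

lemma coefSeq_honest (c : Fin (numRep W T k * repLen W T) → Fin (coinSize W T) → Bool) {q ρ i : ℕ}
    (hq : q < numRep W T k) (hρ : ρ < repLen W T) (hi : i < 4) :
    coefSeq (CoinField W T) (n := numRep W T k * repLen W T) (l := 4 * (coinSize W T + 1))
      (coinSize W T + 1) ((honestMerlin P k xA xB).msg c) (q * repLen W T) ρ i =
    (truePoly (Nat.clog 2 W) (Nat.clog 2 T) (P.base xA xB) ρ (roundPt (Nat.clog 2 W) (Nat.clog 2 T)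
      (coinSeq (CoinField W T) c (q * repLen W T)) ρ)).coeff i := by
  have hR : 0 < repLen W T := by lia
  refine (congrArg Nat.cast ?_).trans (ZMod.natCast_zmod_val _)
  change _ = honestCoef P k xA xB c q ρ i
  rw [bitsNum_congr (y' := fun j => (honestCoef P k xA xB c q ρ i).testBit j), bitsNum_testBit]
  · refine (ZMod.val_lt _).trans_le ?_
    have h2 := (fieldPred_spec (Nat.clog 2 W) (Nat.clog 2 T)).1
    rw [pow_succ]
    change charPred W T + 1 ≤ _
    lia
  · intro j hj
    refine (blockBit_eq _ (mul_add_lt hq hρ) (mul_add_lt hi hj)).trans ?_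
    change (honestCoef P k xA xB c ((q * repLen W T + ρ) / repLen W T)
      ((q * repLen W T + ρ) % repLen W T) ((i * (coinSize W T + 1) + j) /
      (coinSize W T + 1))).testBit ((i * (coinSize W T + 1) + j) % (coinSize W T + 1)) = _
    rw [mul_comm q, mul_comm i, Nat.mul_add_div hR, Nat.mul_add_mod, Nat.div_eq_of_lt hρ,
      Nat.mod_eq_of_lt hρ, Nat.mul_add_div (Nat.succ_pos _), Nat.mul_add_mod, Nat.div_eq_of_lt hj,
      Nat.mod_eq_of_lt hj, add_zero, add_zero]

/-- Perfect completeness. -/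
theorem verdict_honest [NeZero W] [NeZero T] (h : P.Accepts (Fin.append xA xB))
    (c : (P.protocol k).Coins) :
    (P.protocol k).verdict xA xB (honestMerlin P k xA xB) c = true := by
  refine (verdict_iff P k xA xB _ c).2 fun q hq => ?_
  exact (fieldChecks_true (fun y _ => affineAt_base P xA xB y) _
    ((roundFn_base_iff P xA xB).2 h)).congr (fun _ _ => rfl)
    fun ρ hρ i hi => coefSeq_honest P k xA xB c hq hρ hi

/-! ### Soundness -/

/-- The field element named by the coins of a round. -/
noncomputable def coinElt (W T : ℕ) (x : Fin (coinSize W T) → Bool) : CoinField W T :=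
  (bitsNum (coinSize W T) fun j => if h : j < coinSize W T then x ⟨j, h⟩ else false : ℕ)

lemma coinElt_injective : Function.Injective (coinElt W T) := by
  intro x y h
  have hlt (x : Fin (coinSize W T) → Bool) := (bitsNum_lt (coinSize W T)
    fun j => if h : j < coinSize W T then x ⟨j, h⟩ else false).trans
      (fieldPred_spec (Nat.clog 2 W) (Nat.clog 2 T)).2.1
  have h1 := congrArg ZMod.val h
  rw [coinElt, coinElt, ZMod.val_cast_of_lt (hlt x), ZMod.val_cast_of_lt (hlt y)] at h1
  ext j
  have h2 := congrArg (fun n => n.testBit j) h1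
  simpa only [testBit_bitsNum _ j.2, dif_pos j.2] using h2

lemma card_badCoin_le (base : (ℕ → CoinField W T) → CoinField W T) (c : ℕ → CoinField W T)
    (g : ℕ → ℕ → CoinField W T) (ρ : ℕ) : Nat.card {x : Fin (coinSize W T) → Bool //
      BadCoin (Nat.clog 2 W) (Nat.clog 2 T) base c g ρ (coinElt W T x)} ≤ 3 := by
  classical
  set q := truePoly (Nat.clog 2 W) (Nat.clog 2 T) base ρ (roundPt (Nat.clog 2 W) (Nat.clog 2 T) c ρ)
    - cubic (g ρ) with hq
  have h1 : Nat.card {x : Fin (coinSize W T) → Bool //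
      BadCoin (Nat.clog 2 W) (Nat.clog 2 T) base c g ρ (coinElt W T x)} ≤ Nat.card q.roots.toFinset :=
    Nat.card_le_card_of_injective (fun x => ⟨coinElt W T x.1, Multiset.mem_toFinset.2 x.2⟩)
      fun x y h => Subtype.ext (coinElt_injective (Subtype.ext_iff.1 h))
  rw [Nat.card_eq_fintype_card (α := q.roots.toFinset), Fintype.card_coe] at h1
  exact h1.trans ((Multiset.toFinset_card_le _).trans ((Polynomial.card_roots' q).trans
    ((Polynomial.natDegree_sub_le _ _).trans (max_le (natDegree_truePoly _ _ _)
      (natDegree_cubic _)))))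

/-- If `P` rejects, then at most a fraction `2 ^ (-k)` of the coin sequences make Alice accept. -/
theorem card_accepting_le [NeZero W] [NeZero T] (h : ¬ P.Accepts (Fin.append xA xB))
    (M : (P.protocol k).Merlin) :
    Nat.card {c : (P.protocol k).Coins // (P.protocol k).verdict xA xB M c = true} * 2 ^ k ≤
      Nat.card (P.protocol k).Coins := by
  classical
  set R := repLen W T with hR
  set Bad : Fin (numRep W T k * R) → (Fin (numRep W T k * R) → Fin (coinSize W T) → Bool) →
      (Fin (coinSize W T) → Bool) → Prop := fun i c x =>
    BadCoin (Nat.clog 2 W) (Nat.clog 2 T) (P.base xA xB) (coinSeq (CoinField W T) c (i / R * R))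
      (coefSeq (CoinField W T) (n := numRep W T k * R) (l := 4 * (coinSize W T + 1))
        (coinSize W T + 1) (M.msg c) (i / R * R)) (i % R) (coinElt W T x) with hBad
  have hcount := card_all_blocks_bad_le 3 (numRep W T k) R Bad (by
    intro i c d hcd
    have hpos : 0 < R := Nat.pos_of_mul_pos_left (Nat.zero_lt_of_lt i.2)
    have e := Nat.div_add_mod' (i : ℕ) R
    have h1 :
        roundPt (Nat.clog 2 W) (Nat.clog 2 T) (coinSeq (CoinField W T) c (i / R * R)) (i % R) =
        roundPt (Nat.clog 2 W) (Nat.clog 2 T) (coinSeq (CoinField W T) d (i / R * R)) (i % R) :=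
      roundPt_congr (Nat.mod_lt _ hpos).le fun ρ hρ => coinSeq_congr fun hi =>
        hcd ⟨_, hi⟩ (Fin.lt_def.2 (by change _ + ρ < (i : ℕ); lia))
    have h2 : coefSeq (CoinField W T) (n := numRep W T k * R) (l := 4 * (coinSize W T + 1))
        (coinSize W T + 1) (M.msg c) (i / R * R) (i % R) =
        coefSeq (CoinField W T) (n := numRep W T k * R) (l := 4 * (coinSize W T + 1))
        (coinSize W T + 1) (M.msg d) (i / R * R) (i % R) :=
      coefSeq_congr fun hi => M.causal ⟨_, hi⟩ c d fun j hj => hcd j (Fin.lt_def.2 (by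
        have : (j : ℕ) < i / R * R + i % R := hj
        lia))
    ext x
    simp only [hBad, BadCoin, h1, h2]) fun i c => card_badCoin_le _ _ _ _
  have hsub : Nat.card {c : (P.protocol k).Coins // (P.protocol k).verdict xA xB M c = true} ≤
      Nat.card {c : Fin (numRep W T k * R) → Fin (coinSize W T) → Bool // ∀ q : Fin (numRep W T k),
        ∃ j : Fin R, Bad (finProdFinEquiv (q, j)) c (c (finProdFinEquiv (q, j)))} := by
    refine Nat.card_le_card_of_injective (fun c => ⟨c.1, fun q => ?_⟩) fun c d h =>
      Subtype.ext (Subtype.mk.inj h)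
    obtain ⟨ρ, hρ, hbad⟩ := ((verdict_iff P k xA xB M c.1).1 c.2 q q.2).exists_badCoin
      (fun y _ => affineAt_base P xA xB y) (mt (roundFn_base_iff P xA xB).1 h)
    refine ⟨⟨ρ, hρ⟩, ?_⟩
    have hval : ((finProdFinEquiv (q, (⟨ρ, hρ⟩ : Fin R)) : Fin (numRep W T k * R)) : ℕ) =
        R * q + ρ := by rw [finProdFinEquiv_apply_val]; exact add_comm _ _
    have hpos : 0 < R := by have : ρ < R := hρ; lia
    have hdiv : (R * q + ρ) / R = q := by
      rw [Nat.mul_add_div hpos, Nat.div_eq_of_lt hρ, add_zero]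
    have hmod : (R * q + ρ) % R = ρ := by rw [Nat.mul_add_mod, Nat.mod_eq_of_lt hρ]
    have hcoin : coinElt W T (c.1 (finProdFinEquiv (q, (⟨ρ, hρ⟩ : Fin R)))) =
        coinSeq (CoinField W T) (n := numRep W T k * R) (l := coinSize W T) c.1 (q * R) ρ := by
      have hlt : (q : ℕ) * R + ρ < numRep W T k * R := mul_add_lt q.2 hρ
      have e : (finProdFinEquiv (q, (⟨ρ, hρ⟩ : Fin R)) : Fin (numRep W T k * R)) =
          ⟨q * R + ρ, hlt⟩ := Fin.ext (by rw [hval, mul_comm])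
      rw [e]
      refine congrArg Nat.cast (bitsNum_congr fun j hj => (dif_pos hj).trans ?_)
      exact (blockBit_eq (n := numRep W T k * R) (l := coinSize W T) c.1 hlt hj).symm
    simp only [hBad, hval, hdiv, hmod]
    rw [hcoin]
    exact hbad
  have hcoins : Nat.card (P.protocol k).Coins =
      Fintype.card (Fin (coinSize W T) → Bool) ^ (numRep W T k * R) := by
    rw [← Nat.card_eq_fintype_card]
    change Nat.card (Fin (numRep W T k * R) → Fin (coinSize W T) → Bool) = _
    rw [Nat.card_fun, Nat.card_eq_fintype_card (α := Fin _), Fintype.card_fin]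
  rw [hcoins]
  set N := Nat.card {c : (P.protocol k).Coins // (P.protocol k).verdict xA xB M c = true}
  have hβ : Fintype.card (Fin (coinSize W T) → Bool) =
      2 ^ halfLen (Nat.clog 2 W) (Nat.clog 2 T) * 2 ^ halfLen (Nat.clog 2 W) (Nat.clog 2 T) := by
    rw [Fintype.card_fun, Fintype.card_bool, Fintype.card_fin, ← pow_add, ← two_mul]
    rfl
  have hsmall : R * 3 ≤ 2 ^ halfLen (Nat.clog 2 W) (Nat.clog 2 T) := by
    have := Nat.le_pow_clog one_lt_two (3 * numRounds (Nat.clog 2 W) (Nat.clog 2 T) + 2)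
    change numRounds (Nat.clog 2 W) (Nat.clog 2 T) * 3 ≤
      2 ^ Nat.clog 2 (3 * numRounds (Nat.clog 2 W) (Nat.clog 2 T) + 2)
    lia
  have hk : k ≤ halfLen (Nat.clog 2 W) (Nat.clog 2 T) * numRep W T k :=
    (Nat.lt_mul_div_succ k (halfLen_pos _ _)).le
  generalize Fintype.card (Fin (coinSize W T) → Bool) = B at *
  generalize halfLen (Nat.clog 2 W) (Nat.clog 2 T) = e at *
  have h2 : 0 < (2 ^ e) ^ numRep W T k := by positivity
  refine Nat.le_of_mul_le_mul_right (c := (2 ^ e) ^ numRep W T k) ?_ h2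
  calc N * 2 ^ k * (2 ^ e) ^ numRep W T k
      ≤ N * (2 ^ e) ^ numRep W T k * (2 ^ e) ^ numRep W T k := by
        rw [← pow_mul]
        gcongr
        norm_num
    _ = N * B ^ numRep W T k := by rw [hβ, mul_pow, mul_assoc]
    _ ≤ _ := (Nat.mul_le_mul_right _ hsub).trans hcount
    _ ≤ (2 ^ e) ^ numRep W T k * B ^ (numRep W T k * R) := by gcongr
    _ = _ := mul_comm _ _

end Correctness

/-! ### Running times -/

/-- An upper bound for the lengths of all inputs. -/
def inputBound (I : ℕ → ℕ) : ℕ :=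
  commonLen I + I 0 + I 1 + repCount I * repRounds I * (4 * (wordLen I + 1)) +
    repCount I * repRounds I * wordLen I + repCount I * (wordLen I + 1)

namespace RAM

variable {α : Type} [Ctx α]

namespace PC

lemma rounds : PC (fun x : α => _root_.repCount (Ctx.inp x) * _root_.repRounds (Ctx.inp x)) :=
  repCount.mul repRounds

lemma msgLen : PC (fun x : α => 4 * (_root_.wordLen (Ctx.inp x) + 1)) :=
  (const 4).mul (wordLen.add (const 1))

lemma bobLen : PC (fun x : α => _root_.repCount (Ctx.inp x) * (_root_.wordLen (Ctx.inp x) + 1)) :=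
  repCount.mul (wordLen.add (const 1))

lemma inputBound : PC (fun x : α => inputBound (Ctx.inp x)) :=
  ((((commonLen.add (cell 0)).add (cell 1)).add (rounds.mul msgLen)).add
    (rounds.mul wordLen)).add bobLen

end PC

lemma ComputesWithin.mono {p : Cmd} {inp out : List ℕ} {t t' : ℝ} (h : ComputesWithin p inp out t)
    (ht : t ≤ t') : ComputesWithin p inp out t' := by
  obtain ⟨s, c, h1, h2, h3⟩ := h
  exact ⟨s, c, h1, h2.trans ht, h3⟩

end RAM

section Implementation

variable {a b W T : ℕ} (P : BranchingProgram (a + b) W T) (k : ℕ)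

lemma le_one_of_mem_bitList {n : ℕ} {x : Fin n → Bool} {z : ℕ} (h : z ∈ bitList x) : z ≤ 1 := by
  obtain ⟨i, rfl⟩ := List.mem_ofFn.1 h
  exact Bool.toNat_le _

lemma le_one_of_mem_blockList {n l : ℕ} {x : Fin n → Fin l → Bool} {z : ℕ} (h : z ∈ blockList x) :
    z ≤ 1 := by
  obtain ⟨l, hl, hz⟩ := List.mem_flatten.1 h
  obtain ⟨i, rfl⟩ := List.mem_ofFn.1 hl
  exact le_one_of_mem_bitList hz

lemma get_bitList {n : ℕ} (x : Fin n → Bool) (i : Fin (bitList x).length) :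
    (bitList x).get i = (x ⟨i, i.2.trans_eq (length_bitList x)⟩).toNat := by
  rw [List.get_eq_getElem]
  exact List.getElem_ofFn _

lemma le_of_mem_commonInput {z : ℕ} (h : z ∈ commonInput P k) : z ≤ a + b + W + T + k + 5 := by
  rw [commonInput, BranchingProgram.encode, List.mem_append, List.mem_append] at h
  rcases h with h | h | h
  · simp only [List.mem_cons, List.not_mem_nil, or_false] at h
    lia
  · obtain ⟨i, rfl⟩ := List.mem_ofFn.1 h
    have := (P.var i).2
    lia
  · obtain ⟨l, hl, hz⟩ := List.mem_flatten.1 h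
    obtain ⟨i, rfl⟩ := List.mem_ofFn.1 hl
    obtain ⟨l, hl, hz⟩ := List.mem_flatten.1 hz
    obtain ⟨u, rfl⟩ := List.mem_ofFn.1 hl
    obtain ⟨l, hl, hz⟩ := List.mem_flatten.1 hz
    obtain ⟨v, rfl⟩ := List.mem_ofFn.1 hl
    simp only [List.mem_cons, List.not_mem_nil, or_false] at hz
    rcases hz with rfl | rfl <;> exact (Bool.toNat_le _).trans (by lia)

open RAM in
/-- The parties are implemented by fixed programs in polynomial time. -/
theorem exists_implementation : ∃ (shape bob alice : Cmd) (C : ℕ), ∀ {a b W T : ℕ}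
    (P : BranchingProgram (a + b) W T) (k : ℕ), (P.protocol k).ImplementedWithin P k shape bob alice
      (((a + b + W + T + k + 5 : ℕ) : ℝ) ^ C) := by
  classical
  obtain ⟨B, hB⟩ := PC.exists_bound (PC.inputBound (α := ℕ → ℕ))
  obtain ⟨shape, C₁, h₁⟩ := exists_program (PC.const (α := ℕ → ℕ) 4)
    (h := fun x => if x.2 = 0 then repCount x.1 * repRounds x.1 else if x.2 = 1 then
      4 * (wordLen x.1 + 1) else if x.2 = 2 then wordLen x.1 else repCount x.1 * (wordLen x.1 + 1))
    (.ite (.eq .last (.const 0)) .rounds (.ite (.eq .last (.const 1)) .msgLen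
      (.ite (.eq .last (.const 2)) .wordLen .bobLen)))
  obtain ⟨bob, C₂, h₂⟩ := exists_program (PC.bobLen (α := ℕ → ℕ)) (h := fun x => bobBit x.1 x.2)
    (PC.bobBit .last)
  obtain ⟨alice, C₃, h₃⟩ := exists_program (PC.const (α := ℕ → ℕ) 1)
    (h := fun x => if AliceAccepts x.1 then 1 else 0)
    (.ite PCP.aliceAccepts (.const 1) (.const 0))
  refine ⟨shape, bob, alice, (B + 1) * (C₁ + C₂ + C₃), fun {a b W T} P k => ?_⟩
  set Y := a + b + W + T + k + 5 with hY
  have hbound : commonLen (cells [a, b, W, T, k]) + a + b +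
      numRep W T k * repLen W T * (4 * (coinSize W T + 1)) +
      numRep W T k * repLen W T * coinSize W T + numRep W T k * (coinSize W T + 1) ≤ Y ^ B :=
    hB Y [a, b, W, T, k] (by lia) (by simp [hY]) (by
      intro z hz
      simp only [List.mem_cons, List.not_mem_nil, or_false] at hz
      lia)
  have hlen : (commonInput P k).length = commonLen (cells [a, b, W, T, k]) :=
    length_commonInput P k []
  have hYB : Y ^ B ≤ Y ^ (B + 1) := Nat.pow_le_pow_right (by lia) (Nat.le_succ B)
  have hYY : Y ≤ Y ^ (B + 1) := Nat.le_self_pow (Nat.succ_ne_zero B) Y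
  have hY2 : 2 ≤ Y ^ (B + 1) := by lia
  have htime {C : ℕ} (hC : C ≤ C₁ + C₂ + C₃) :
      (((Y ^ (B + 1) : ℕ) : ℝ)) ^ C ≤ (Y : ℝ) ^ ((B + 1) * (C₁ + C₂ + C₃)) := by
    rw [Nat.cast_pow, ← pow_mul]
    exact pow_le_pow_right₀ (by exact_mod_cast (by lia : 1 ≤ Y)) (Nat.mul_le_mul_left _ hC)
  have hcommon (z : ℕ) (hz : z ∈ commonInput P k) : z ≤ Y ^ (B + 1) :=
    (le_of_mem_commonInput P k hz).trans hYY
  have hne (l : List ℕ) : commonInput P k ++ l ≠ [] := by simp [commonInput]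
  refine ⟨?_, fun xB c => ?_, fun xA msg c y => ?_⟩
  · refine (h₁ (Y ^ (B + 1)) (commonInput P k) _ hY2 (by simp [commonInput]) (by lia) hcommon rfl
      ?_).mono (htime (by lia))
    intro i
    fin_cases i <;> rfl
  · have hb : (bitList xB).length = b := length_bitList _
    have hc : (blockList c).length = numRep W T k * repLen W T * coinSize W T := length_blockList _
    rw [List.append_assoc]
    refine (h₂ (Y ^ (B + 1)) _ _ hY2 (hne _) ?_ ?_ (length_bitList _) ?_).mono (htime (by lia))
    · rw [List.length_append, List.length_append]
      lia
    · intro z hz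
      rw [List.mem_append, List.mem_append] at hz
      rcases hz with hz | hz | hz
      · exact hcommon z hz
      · exact (le_one_of_mem_bitList hz).trans (by lia)
      · exact (le_one_of_mem_blockList hz).trans (by lia)
    · intro i
      refine (get_bitList (n := numRep W T k * (coinSize W T + 1)) _ i).trans ?_
      change (decide (bobBit (bobCells P k xB c) i = 1)).toNat = bobBit (bobCells P k xB c) i
      have h2 : bobBit (bobCells P k xB c) i < 2 := Nat.mod_lt _ two_pos
      interval_cases bobBit (bobCells P k xB c) i <;> rfl
  · have ha : (bitList xA).length = a := length_bitList _
    have hm : (blockList msg).length = numRep W T k * repLen W T * (4 * (coinSize W T + 1)) :=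
      length_blockList _
    have hc : (blockList c).length = numRep W T k * repLen W T * coinSize W T := length_blockList _
    have hy : (bitList y).length = numRep W T k * (coinSize W T + 1) := length_bitList _
    rw [List.append_assoc, List.append_assoc, List.append_assoc]
    refine (h₃ (Y ^ (B + 1)) _ _ hY2 (hne _) ?_ ?_ rfl ?_).mono (htime (by lia))
    · simp only [List.length_append]
      lia
    · intro z hz
      simp only [List.mem_append] at hz
      rcases hz with hz | hz | hz | hz | hz
      · exact hcommon z hz
      · exact (le_one_of_mem_bitList hz).trans (by lia)
      · exact (le_one_of_mem_blockList hz).trans (by lia)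
      · exact (le_one_of_mem_blockList hz).trans (by lia)
      · exact (le_one_of_mem_bitList hz).trans (by lia)
    · intro i
      obtain ⟨i, hi⟩ := i
      obtain rfl : i = 0 := Nat.lt_one_iff.1 hi
      change (decide (AliceAccepts (aliceCells P k xA msg c y))).toNat =
        if AliceAccepts (aliceCells P k xA msg c y) then 1 else 0
      split_ifs with h <;> simp [h]

end Implementation

/-! ### Communication and error probability -/

section Bounds

lemma one_le_lg (x : ℝ) : 1 ≤ lg x := le_max_left _ _

lemma logb_le_lg (x : ℝ) : Real.logb 2 x ≤ lg x := le_max_right _ _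

lemma clog_le (n : ℕ) : (Nat.clog 2 n : ℝ) ≤ 2 * lg n := by
  rw [← Real.natCeil_logb_natCast]
  have h1 := one_le_lg n
  have h2 := logb_le_lg n
  rcases le_total (Real.logb 2 n) 0 with h | h
  · have : ⌈Real.logb (2 : ℕ) n⌉₊ = 0 := Nat.ceil_eq_zero.2 h
    rw [this]
    push_cast
    linarith
  · have := Nat.ceil_lt_add_one h
    push_cast
    linarith

lemma ceil_logb_le (x : ℝ) : (⌈Real.logb 2 x⌉₊ : ℝ) ≤ 2 * lg x := by
  have h1 := one_le_lg x
  have h2 := logb_le_lg x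
  rcases le_total (Real.logb 2 x) 0 with h | h
  · rw [Nat.ceil_eq_zero.2 h]
    push_cast
    linarith
  · have := Nat.ceil_lt_add_one h
    linarith

lemma numRounds_le (W T : ℕ) :
    (numRounds (Nat.clog 2 W) (Nat.clog 2 T) : ℝ) ≤ 90 * (lg W ^ 2 * lg T ^ 2) := by
  have hm := clog_le W
  have hD := clog_le T
  have hx := one_le_lg W
  have hy := one_le_lg T
  rw [numRounds, numStages, numVars]
  push_cast
  generalize lg W = x at *
  generalize lg T = y at *
  have hxy : x ≤ x * y := le_mul_of_one_le_right (by linarith) hy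
  have hyx : y ≤ x * y := le_mul_of_one_le_left (by linarith) hx
  calc _ ≤ 2 * y * (2 * (2 * x) + 1) * (2 * y + 3 * (2 * x) + 1) := by gcongr
    _ ≤ 2 * y * (5 * x) * (9 * (x * y)) := by
        gcongr
        · linarith
        · nlinarith
    _ = _ := by ring

lemma halfLen_le (W T : ℕ) :
    (halfLen (Nat.clog 2 W) (Nat.clog 2 T) : ℝ) ≤ 7 * (lg (lg W) + lg (lg T)) := by
  have hR := numRounds_le W T
  have hx := one_le_lg W
  have hy := one_le_lg T
  have h1 := one_le_lg (lg W)
  have h2 := one_le_lg (lg T)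
  have h3 := logb_le_lg (lg W)
  have h4 := logb_le_lg (lg T)
  rw [halfLen, ← Real.natCeil_logb_natCast]
  push_cast
  generalize numRounds (Nat.clog 2 W) (Nat.clog 2 T) = R at *
  have h0 : 0 ≤ Real.logb 2 (3 * R + 2) :=
    Real.logb_nonneg one_lt_two (by linarith [Nat.cast_nonneg (α := ℝ) R])
  have h5 : Real.logb 2 (3 * R + 2) ≤ 9 + 2 * Real.logb 2 (lg W) + 2 * Real.logb 2 (lg T) := by
    have h6 : (1 : ℝ) ≤ lg W ^ 2 * lg T ^ 2 := by
      have := one_le_pow₀ hx (n := 2)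
      have := one_le_pow₀ hy (n := 2)
      nlinarith
    have h7 : (3 * R + 2 : ℝ) ≤ 2 ^ 9 * (lg W ^ 2 * lg T ^ 2) := by norm_num; linarith
    refine (Real.logb_le_logb_of_le one_lt_two (by positivity) h7).trans_eq ?_
    rw [Real.logb_mul (by positivity) (by positivity), Real.logb_mul (by positivity)
      (by positivity), Real.logb_pow, Real.logb_pow, Real.logb_pow,
      Real.logb_self_eq_one one_lt_two]
    push_cast
    ring
  have := Nat.ceil_lt_add_one h0
  linarith

variable {a b W T : ℕ} (P : BranchingProgram (a + b) W T) (ε : ℝ)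

lemma numRep_mul_halfLen_le : (numRep W T ⌈Real.logb 2 ε⁻¹⌉₊ : ℝ) *
    halfLen (Nat.clog 2 W) (Nat.clog 2 T) ≤ 7 * elementBits W T ε := by
  have h1 := ceil_logb_le ε⁻¹
  have h2 := halfLen_le W T
  have h3 : (numRep W T ⌈Real.logb 2 ε⁻¹⌉₊ * halfLen (Nat.clog 2 W) (Nat.clog 2 T) : ℕ) ≤
      ⌈Real.logb 2 ε⁻¹⌉₊ + halfLen (Nat.clog 2 W) (Nat.clog 2 T) := by
    rw [numRep, repetitions, Nat.succ_mul]
    exact Nat.add_le_add_right (Nat.div_mul_le_self _ _) _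
  have h4 := one_le_lg ε⁻¹
  have h5 := (Nat.cast_le (α := ℝ)).2 h3
  push_cast at h5
  rw [elementBits]
  linarith

lemma coinBits_protocol_le : ((P.protocol ⌈Real.logb 2 ε⁻¹⌉₊).coinBits : ℝ) ≤
    1260 * (lg W ^ 2 * lg T ^ 2 * elementBits W T ε) := by
  have h1 := numRounds_le W T
  have h2 := numRep_mul_halfLen_le (W := W) (T := T) ε
  have e : ((P.protocol ⌈Real.logb 2 ε⁻¹⌉₊).coinBits : ℝ) =
      2 * (numRounds (Nat.clog 2 W) (Nat.clog 2 T) * (numRep W T ⌈Real.logb 2 ε⁻¹⌉₊ *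
        halfLen (Nat.clog 2 W) (Nat.clog 2 T))) := by
    change ((numRep W T ⌈Real.logb 2 ε⁻¹⌉₊ * numRounds (Nat.clog 2 W) (Nat.clog 2 T) *
      (2 * halfLen (Nat.clog 2 W) (Nat.clog 2 T)) : ℕ) : ℝ) = _
    push_cast
    ring
  rw [e]
  calc _ ≤ 2 * (90 * (lg W ^ 2 * lg T ^ 2) * (7 * elementBits W T ε)) := by gcongr
    _ = _ := by ring

lemma exchangedBits_protocol_le : ((P.protocol ⌈Real.logb 2 ε⁻¹⌉₊).exchangedBits : ℝ) ≤
    8820 * (lg W ^ 2 * lg T ^ 2 * elementBits W T ε) := by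
  have h := coinBits_protocol_le P ε
  have h1 : (P.protocol ⌈Real.logb 2 ε⁻¹⌉₊).exchangedBits ≤
      7 * (P.protocol ⌈Real.logb 2 ε⁻¹⌉₊).coinBits := by
    have hs : 4 * (coinSize W T + 1) + coinSize W T ≤ 7 * coinSize W T := by
      have := halfLen_pos (Nat.clog 2 W) (Nat.clog 2 T)
      unfold coinSize fieldBits
      lia
    rw [IPProtocol.exchangedBits, IPProtocol.coinBits, ← mul_add]
    exact (Nat.mul_le_mul_left _ hs).trans_eq (Nat.mul_left_comm _ _ _)
  have h2 := (Nat.cast_le (α := ℝ)).2 h1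
  push_cast at h2
  linarith

lemma bobLen_protocol_le :
    ((P.protocol ⌈Real.logb 2 ε⁻¹⌉₊).bobLen : ℝ) ≤ 21 * elementBits W T ε := by
  have h := numRep_mul_halfLen_le (W := W) (T := T) ε
  have h1 : (P.protocol ⌈Real.logb 2 ε⁻¹⌉₊).bobLen ≤ 3 * (numRep W T ⌈Real.logb 2 ε⁻¹⌉₊ *
      halfLen (Nat.clog 2 W) (Nat.clog 2 T)) := by
    have hs : coinSize W T + 1 ≤ 3 * halfLen (Nat.clog 2 W) (Nat.clog 2 T) := by
      have := halfLen_pos (Nat.clog 2 W) (Nat.clog 2 T)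
      unfold coinSize fieldBits
      lia
    exact (Nat.mul_le_mul_left _ hs).trans_eq (Nat.mul_left_comm _ _ _)
  have h2 := (Nat.cast_le (α := ℝ)).2 h1
  push_cast at h2
  linarith

lemma IPProtocol.le_rejectProb {a b : ℕ} (Q : IPProtocol a b) (xA : Fin a → Bool)
    (xB : Fin b → Bool) (M : Q.Merlin) {k : ℕ} {ε : ℝ} (hε : 0 < ε) (hk : ε⁻¹ ≤ 2 ^ k)
    (h : Nat.card {c : Q.Coins // Q.verdict xA xB M c = true} * 2 ^ k ≤ Nat.card Q.Coins) :
    1 - ε ≤ Q.rejectProb xA xB M := by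
  classical
  rw [Nat.card_eq_fintype_card, Nat.card_eq_fintype_card, Fintype.card_subtype] at h
  have hsplit : (Finset.univ.filter fun c : Q.Coins => Q.verdict xA xB M c = true).card +
      (Finset.univ.filter fun c : Q.Coins => Q.verdict xA xB M c = false).card =
      Fintype.card Q.Coins := by
    rw [← Finset.card_univ, ← Finset.card_filter_add_card_filter_not
      (s := Finset.univ) (fun c : Q.Coins => Q.verdict xA xB M c = true)]
    simp only [Bool.not_eq_true]
  have hpos : (0 : ℝ) < Fintype.card Q.Coins := by exact_mod_cast Fintype.card_pos
  rw [IPProtocol.rejectProb, le_div_iff₀ hpos]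
  generalize (Finset.univ.filter fun c : Q.Coins => Q.verdict xA xB M c = true).card = A at h hsplit
  generalize Fintype.card Q.Coins = N at h hsplit ⊢
  have h1 := (Nat.cast_le (α := ℝ)).2 h
  push_cast at h1
  have h2 := (mul_le_mul_of_nonneg_left hk (Nat.cast_nonneg A)).trans h1
  rw [← div_eq_mul_inv, div_le_iff₀ hε, mul_comm] at h2
  have h3 := (Nat.cast_inj (R := ℝ)).2 hsplit
  push_cast at h3
  linarith

lemma inv_le_two_pow_ceil {ε : ℝ} (hε : 0 < ε) : ε⁻¹ ≤ 2 ^ ⌈Real.logb 2 ε⁻¹⌉₊ := by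
  rw [← Real.rpow_natCast, ← Real.logb_le_iff_le_rpow one_lt_two (by positivity)]
  exact Nat.le_ceil _

end Bounds

theorem mainTheorem2 :
    ∃ (C : ℕ) (shape bob alice : RAM.Cmd),
      ∀ (a b W T : ℕ) [NeZero W] [NeZero T] (P : BranchingProgram (a + b) W T) (ε : ℝ), 0 < ε →
        ∃ Q : IPProtocol a b,
          -- computational efficiency of Alice and Bob
          Q.ImplementedWithin P ⌈Real.logb 2 ε⁻¹⌉₊ shape bob alice
            (((a : ℝ) + b + W + T + lg ε⁻¹) ^ C) ∧
          -- communication and public coins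
          (Q.exchangedBits : ℝ) ≤ C * ((lg W) ^ 2 * (lg T) ^ 2 * elementBits W T ε) ∧
          (Q.coinBits : ℝ) ≤ C * ((lg W) ^ 2 * (lg T) ^ 2 * elementBits W T ε) ∧
          (Q.bobLen : ℝ) ≤ C * elementBits W T ε ∧
          -- perfect completeness
          (∀ (xA : Fin a → Bool) (xB : Fin b → Bool), P.Accepts (Fin.append xA xB) →
            ∃ M : Q.Merlin, ∀ c : Q.Coins, Q.verdict xA xB M c = true) ∧
          -- soundness error at most `ε`
          (∀ (xA : Fin a → Bool) (xB : Fin b → Bool), ¬ P.Accepts (Fin.append xA xB) →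
            ∀ M : Q.Merlin, 1 - ε ≤ Q.rejectProb xA xB M) := by
  obtain ⟨shape, bob, alice, C, hC⟩ := exists_implementation
  refine ⟨3 * C + 8820, shape, bob, alice, fun a b W T _ _ P ε hε => ?_⟩
  have hE : 0 ≤ elementBits W T ε := by
    have := one_le_lg (lg W)
    have := one_le_lg (lg T)
    have := one_le_lg ε⁻¹
    rw [elementBits]
    linarith
  have hE2 : 0 ≤ lg W ^ 2 * lg T ^ 2 * elementBits W T ε := by positivity
  have hC0 : (0 : ℝ) ≤ C := Nat.cast_nonneg C
  refine ⟨P.protocol ⌈Real.logb 2 ε⁻¹⌉₊, ?_, ?_, ?_, ?_,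
    fun xA xB h => ⟨_, verdict_honest P _ xA xB h⟩,
    fun xA xB h M => IPProtocol.le_rejectProb _ xA xB M hε (inv_le_two_pow_ceil hε)
      (card_accepting_le P _ xA xB h M)⟩
  · have htime : ((a + b + W + T + ⌈Real.logb 2 ε⁻¹⌉₊ + 5 : ℕ) : ℝ) ^ C ≤
        ((a : ℝ) + b + W + T + lg ε⁻¹) ^ (3 * C + 8820) := by
      have hk := ceil_logb_le ε⁻¹
      have h1 := one_le_lg ε⁻¹
      have hW : (1 : ℝ) ≤ W := by exact_mod_cast NeZero.pos W
      have hT : (1 : ℝ) ≤ T := by exact_mod_cast NeZero.pos T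
      have ha : (0 : ℝ) ≤ a := Nat.cast_nonneg a
      have hb : (0 : ℝ) ≤ b := Nat.cast_nonneg b
      set Z : ℝ := (a : ℝ) + b + W + T + lg ε⁻¹ with hZ
      have hZ3 : 3 ≤ Z := by linarith
      have hle : ((a + b + W + T + ⌈Real.logb 2 ε⁻¹⌉₊ + 5 : ℕ) : ℝ) ≤ Z ^ 3 := by
        push_cast
        nlinarith [mul_nonneg (by linarith : (0 : ℝ) ≤ Z) (mul_nonneg
          (by linarith : (0 : ℝ) ≤ Z - 3) (by linarith : (0 : ℝ) ≤ Z + 3))]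
      calc _ ≤ (Z ^ 3) ^ C := by gcongr
        _ = Z ^ (3 * C) := (pow_mul _ _ _).symm
        _ ≤ _ := pow_le_pow_right₀ (by linarith) (by lia)
    obtain ⟨h1, h2, h3⟩ := hC P ⌈Real.logb 2 ε⁻¹⌉₊
    exact ⟨h1.mono htime, fun xB c => (h2 xB c).mono htime,
      fun xA m c y => (h3 xA m c y).mono htime⟩
  · refine (exchangedBits_protocol_le P ε).trans (mul_le_mul_of_nonneg_right ?_ hE2)
    push_cast; linarith
  · refine (coinBits_protocol_le P ε).trans (mul_le_mul_of_nonneg_right ?_ hE2)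
    push_cast; linarith
  · refine (bobLen_protocol_le P ε).trans (mul_le_mul_of_nonneg_right ?_ hE)
    push_cast; linarith
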